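/- **Theorem.** In the red-blue dominance counting problem the input is a red list $R=(R(1),\dots,R(N))$ and a blue list $S=(S(1),\dots,S(N))$ of real numbers, and the task is to compute the number $K^*$ of domination pairs, i.e. of pairs $(i,j)$ such that the blue point $(j,S(j))$ dominates the red point $(i,R(i))$, which means $i<j$ and $S(j)<R(i)$. For $S=R$, $K^*$ is the number of inversions of $R$, i.e. of pairs $i<j$ with $R(i)>R(j)$. In the I/O model there are a main memory of $M$ words and a disk formatted into blocks of $B$ words, where $B\ge 1$ and $M\ge 2B$. One I/O reads a disk block into memory or writes $B$ words of memory into a disk block. Computation in main memory (with $O(1)$ additional CPU registers) is free. A word holds either one input value, which can only be copied and compared, or an integer of $O(\log(N+M))$ bits. Both lists are initially stored consecutively on the disk. There is a single (uniform, deterministic) algorithm that, for all such $M$ and $B$, all $N$ and all inputs $R,S$, computes $K^*$ with $$O\!\left(\left\lceil\frac NB\right\rceil+\frac NB\,\log^{+}_{M/B}\!\left(\frac{K^*}{NB}\right)\right)\ \text{I/Os},$$ where $\log^+_b x=\max\{0,\log_b x\}$ for $x>0$ and $\log^+_b 0=0$ (for $N=0$ the second term is $0$), and the constant in $O(\cdot)$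 is absolute. In particular, for every constant $A$, this algorithm uses only $O(\lceil N/B\rceil)$ I/Os on all inputs with $K^*\le A\,NM$, where the constant in $O(\cdot)$ depends only on $A$. -/

import Mathlib

namespace ExtMem

/-! ### Domination pairs and inversions -/

/-- The point `b` dominates the point `r`: larger `x`-coordinate and smaller `y`-coordinate. -/
def Dominates (b r : ℝ × ℝ) : Prop := r.1 < b.1 ∧ b.2 < r.2

/-- The `i`-th entry of a list, seen as the point `(i, L i)` of the plane. -/
def toPoint {N : ℕ} (L : Fin N → ℝ) (i : Fin N) : ℝ × ℝ := (((i : ℕ) : ℝ), L i)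

open scoped Classical in
/-- Number of pairs (red point, blue point) in which the blue point dominates the red point. -/
noncomputable def dominationPairs {N : ℕ} (red blue : Fin N → ℝ) : ℕ :=
  (Finset.univ.filter fun p : Fin N × Fin N =>
    Dominates (toPoint blue p.2) (toPoint red p.1)).card

open scoped Classical in
/-- Number of pairs `i < j` with `L i > L j`. -/
noncomputable def inversions {N : ℕ} (L : Fin N → ℝ) : ℕ :=
  (Finset.univ.filter fun p : Fin N × Fin N => p.1 < p.2 ∧ L p.1 > L p.2).card

/-! ### The machine -/

/-- A machine word holds a natural number (of bounded size, see `Params.W`) or one input value.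
Input values are atomic: a program can only copy them and compare two of them. -/
inductive Word where
  | num (n : ℕ)
  | key (x : ℝ)

/-- Parameters of a machine: `M` words of main memory, disk blocks of `B` words,
input lists of length `N`, and numbers in words are smaller than `W`. -/
structure Params where
  M : ℕ
  B : ℕ
  N : ℕ
  W : ℕ

/-- A configuration: CPU registers (a program mentions only finitely many of them, and their
number is fixed with the program), main memory (only the addresses below `M` are ever accessed),
and the disk (block number, then offset in the block; only offsets below `B` are ever accessed). -/
structure State where
  reg : ℕ → Word
  mem : ℕ → Word
  disk : ℕ → ℕ → Word

/-- Expressions; they compute with registers and main memory only. -/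
inductive Expr where
  | const (n : ℕ)
  | memSize
  | blockSize
  | inputSize
  | reg (r : ℕ)
  | mem (a : Expr)
  | add (e f : Expr)
  | sub (e f : Expr)
  | mul (e f : Expr)
  | div (e f : Expr)
  | mod (e f : Expr)

/-- The word that holds the number `n`, if `n` fits into a word. -/
def Params.mk? (P : Params) (n : ℕ) : Option Word :=
  if n < P.W then some (Word.num n) else none

/-- Arithmetic is possible on numbers only, and its result has to fit into a word. -/
def Params.arith (P : Params) (op : ℕ → ℕ → ℕ) : Option Word → Option Word → Option Word
  | some (Word.num m), some (Word.num n) => P.mk? (op m n)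
  | _, _ => none

/-- Value of an expression; `none` is a run-time error (overflow, address out of range,
arithmetic on an input value). Subtraction is truncated at `0` and division rounds down. -/
def Expr.eval (P : Params) (s : State) : Expr → Option Word
  | const n => P.mk? n
  | memSize => P.mk? P.M
  | blockSize => P.mk? P.B
  | inputSize => P.mk? P.N
  | reg r => some (s.reg r)
  | mem a => match a.eval P s with
    | some (Word.num i) => if i < P.M then some (s.mem i) else none
    | _ => none
  | add e f => P.arith (· + ·) (e.eval P s) (f.eval P s)
  | sub e f => P.arith (· - ·) (e.eval P s) (f.eval P s)
  | mul e f => P.arith (· * ·) (e.eval P s) (f.eval P s)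
  | div e f => P.arith (· / ·) (e.eval P s) (f.eval P s)
  | mod e f => P.arith (· % ·) (e.eval P s) (f.eval P s)

/-- Tests: comparison of two numbers, comparison of two input values, negation, conjunction. -/
inductive Test where
  | lt (e f : Expr)
  | keyLt (e f : Expr)
  | not (c : Test)
  | and (c d : Test)

/-- Outcome of a test; `none` is a run-time error. -/
noncomputable def Test.eval (P : Params) (s : State) : Test → Option Bool
  | lt e f => match e.eval P s, f.eval P s with
    | some (Word.num m), some (Word.num n) => some (decide (m < n))
    | _, _ => none
  | keyLt e f => match e.eval P s, f.eval P s with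
    | some (Word.key x), some (Word.key y) => some (decide (x < y))
    | _, _ => none
  | not c => (c.eval P s).map fun b => !b
  | and c d => match c.eval P s, d.eval P s with
    | some b, some b' => some (b && b')
    | _, _ => none

/-- Programs. A program is a finite text that does not depend on `M`, `B`, `N` or the input. -/
inductive Prog where
  | skip
  /-- `r := e` for a register `r`. -/
  | assign (r : ℕ) (e : Expr)
  /-- `mem[a] := e`. -/
  | store (a e : Expr)
  /-- Read disk block number `j` into the memory words `a, …, a + B - 1`. -/
  | readBlock (j a : Expr)
  /-- Write the memory words `a, …, a + B - 1` into disk block number `j`. -/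
  | writeBlock (j a : Expr)
  | seq (p q : Prog)
  | ite (c : Test) (p q : Prog)
  | loop (c : Test) (p : Prog)

/-- Configuration after reading block `j` into the memory words `a, …, a + B - 1`. -/
def State.readBlock (P : Params) (s : State) (j a : ℕ) : State :=
  { s with mem := fun i => if a ≤ i ∧ i < a + P.B then s.disk j (i - a) else s.mem i }

/-- Configuration after writing the memory words `a, …, a + B - 1` into block `j`. -/
def State.writeBlock (P : Params) (s : State) (j a : ℕ) : State :=
  { s with
    disk := fun i o => if i = j ∧ o < P.B then s.mem (a + o) else s.disk i o }

/-- `Exec P p s t s'`: started in `s`, the program `p` terminates without error in `s'` and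
performs exactly `t` block transfers. Internal computation is free. -/
inductive Exec (P : Params) : Prog → State → ℕ → State → Prop where
  | skip (s : State) : Exec P .skip s 0 s
  | assign {s : State} {r : ℕ} {e : Expr} {w : Word} (he : e.eval P s = some w) :
      Exec P (.assign r e) s 0 { s with reg := Function.update s.reg r w }
  | store {s : State} {a e : Expr} {i : ℕ} {w : Word}
      (ha : a.eval P s = some (Word.num i)) (hi : i < P.M) (he : e.eval P s = some w) :
      Exec P (.store a e) s 0 { s with mem := Function.update s.mem i w }
  | readBlock {s : State} {ej ea : Expr} {j a : ℕ}
      (hj : ej.eval P s = some (Word.num j)) (ha : ea.eval P s = some (Word.num a))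
      (hM : a + P.B ≤ P.M) : Exec P (.readBlock ej ea) s 1 (s.readBlock P j a)
  | writeBlock {s : State} {ej ea : Expr} {j a : ℕ}
      (hj : ej.eval P s = some (Word.num j)) (ha : ea.eval P s = some (Word.num a))
      (hM : a + P.B ≤ P.M) : Exec P (.writeBlock ej ea) s 1 (s.writeBlock P j a)
  | seq {p q : Prog} {s s' s'' : State} {t u : ℕ}
      (hp : Exec P p s t s') (hq : Exec P q s' u s'') : Exec P (.seq p q) s (t + u) s''
  | iteTrue {c : Test} {p q : Prog} {s s' : State} {t : ℕ}
      (hc : c.eval P s = some true) (hp : Exec P p s t s') : Exec P (.ite c p q) s t s'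
  | iteFalse {c : Test} {p q : Prog} {s s' : State} {t : ℕ}
      (hc : c.eval P s = some false) (hq : Exec P q s t s') : Exec P (.ite c p q) s t s'
  | loopTrue {c : Test} {p : Prog} {s s' s'' : State} {t u : ℕ}
      (hc : c.eval P s = some true) (hp : Exec P p s t s')
      (hl : Exec P (.loop c p) s' u s'') : Exec P (.loop c p) s (t + u) s''
  | loopFalse {c : Test} {p : Prog} {s : State}
      (hc : c.eval P s = some false) : Exec P (.loop c p) s 0 s

/-- Execution is deterministic: a program has at most one number of block transfers and at most
one final configuration. -/
theorem Exec.deterministic {P : Params} {p : Prog} {s s₁ s₂ : State} {t₁ t₂ : ℕ}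
    (h₁ : Exec P p s t₁ s₁) (h₂ : Exec P p s t₂ s₂) : t₁ = t₂ ∧ s₁ = s₂ := by
  induction h₁ generalizing t₂ s₂ with
  | seq _ _ ihp ihq =>
    cases h₂ with
    | seq a b =>
      obtain ⟨rfl, rfl⟩ := ihp a
      obtain ⟨rfl, rfl⟩ := ihq b
      exact ⟨rfl, rfl⟩
  | loopTrue hc _ _ ihp ihl =>
    cases h₂ with
    | loopTrue _ a b =>
      obtain ⟨rfl, rfl⟩ := ihp a
      obtain ⟨rfl, rfl⟩ := ihl b
      exact ⟨rfl, rfl⟩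
    | loopFalse hc' => simp_all
  | iteTrue hc _ ih =>
    cases h₂ with
    | iteTrue _ a => exact ih a
    | iteFalse hc' => simp_all
  | iteFalse hc _ ih =>
    cases h₂ with
    | iteTrue hc' => simp_all
    | iteFalse _ a => exact ih a
  | _ => cases h₂ <;> simp_all

/-! ### Input and output -/

/-- Initial disk: the red list, in order, in blocks `0, …, ⌈N/B⌉ - 1`, the blue list, in order,
in blocks `⌈N/B⌉, …, 2⌈N/B⌉ - 1`, and zeros elsewhere. -/
def initDisk {N : ℕ} (B : ℕ) (red blue : Fin N → ℝ) (j o : ℕ) : Word :=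
  if o < B then
    if h : j * B + o < N then Word.key (red ⟨j * B + o, h⟩)
    else if h : (N + B - 1) / B ≤ j ∧ (j - (N + B - 1) / B) * B + o < N then
      Word.key (blue ⟨(j - (N + B - 1) / B) * B + o, h.2⟩)
    else Word.num 0
  else Word.num 0

/-- Initial configuration: registers and main memory are zero, the input is on the disk. -/
def initState {N : ℕ} (B : ℕ) (red blue : Fin N → ℝ) : State where
  reg := fun _ => Word.num 0
  mem := fun _ => Word.num 0
  disk := initDisk B red blue

/-- On a machine with `M` words of memory and blocks of `B` words, whose words hold numbers of at
most `c * log₂ (N + M)` bits, the program `p` terminates without error on the input `red, blue`,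
with the number `k` as its output (in register `0`), after exactly `t` block transfers. -/
def Runs (p : Prog) (c M B : ℕ) {N : ℕ} (red blue : Fin N → ℝ) (k t : ℕ) : Prop :=
  ∃ s : State, Exec ⟨M, B, N, (N + M) ^ c⟩ p (initState B red blue) t s ∧ s.reg 0 = Word.num k

end ExtMem

namespace ExtMem

-- Interleave the lists into one colored sequence, with the blue element `S j` directly before the
-- red element `R j`. Then `K*` is the number `T` of inverted pairs, i.e. of pairs of a red element
-- and a later, strictly smaller blue one (`dominationPairs_eq_cnt`). Blue elements with few
-- partners are cheap to treat: they are counted and removed at once, and the others are postponed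
-- to a scan with a larger parameter.
--
-- A scan with parameter `k` maintains sorted blocks `E` of kept elements and, from some moment on,
-- a threshold `V` such that at least `k` red elements read so far are not below `V` and all red
-- elements above `V` are in `E`. Every red element is output, and kept as well if it is above `V`.
-- A blue element below `V` has at least `k` partners and is output. Any other blue element has all
-- its partners in `E` and is kept. When `E` has `3k` elements, it is sorted by `f`-way merging,
-- which counts its inverted pairs; then only the `k` largest red elements stay, and the smallest of
-- these becomes `V`. At least `2k` elements arrive between two such epochs, so sorting costs
-- `O(log_f(3k/β)/β)` transfers per element. The invariant is `Split`; its cases are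
-- `Split.red_keep`, `Split.red_skip`, `Split.blue_keep`, `Split.blue_deep` and `Split.epoch`, and
-- `Ctx.Tr.passE` does the amortization. Pairs are counted during a merge by the potential
-- `mergePot`.
--
-- The scan outputs all red elements and only those blue ones that have at least `k` partners.
-- Reversing both orders and exchanging the colors preserves inverted pairs (`cnt_reverse_neg`), so
-- a scan in the opposite direction does the same to the red elements. After both scans at most
-- `2T/k` elements are left, and none if `k` exceeds the number of elements at the start
-- (`Ctx.Tr.roundE`).
--
-- Round `j` uses `k = β f^(2^j)` and costs `O(2^j n_j/β)` transfers (up to an additive constant),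
-- where `n_j` is the number of elements left. If `T` is at most about `n β f^(2^i)`, the rounds up
-- to `i + 1` form a geometric sum of order `2^i n/β`, and later on `n_j` decreases doubly
-- exponentially, so these rounds add only `O(n/β)` (`remBound_add_two_le`, `sum_remBound_le`). The
-- least suitable `2^i` is of order `1 + log⁺_{M/B}(T/(NB))`, which gives the bound
-- (`transfers_le`).
--
-- The program is verified on a virtual machine of slots and files (`Ctx.Rel`, `Ctx.Tr`), whose
-- block size `β` and fan-in `f` satisfy `B ≤ 10 β` and `M ≤ B f^5` (`setup_wp`). Its numbers stay
-- below `X = (N + M)^20`, and intermediate values below `X^12`, so words of `O(log(N + M))` bits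
-- suffice. Loop invariants contain the cost: a partly filled or partly consumed buffer is a
-- potential that pays for the next transfer.

infixr:60 " ;; " => Prog.seq

/-! ### Weakest preconditions on machine states -/

/-- The program terminates from `s`, and the final state and the cost satisfy `Q`. -/
def Wp (P : Params) (p : Prog) (s : State) (Q : State → ℕ → Prop) : Prop :=
  ∃ t s', Exec P p s t s' ∧ Q s' t

theorem Wp.mono {P : Params} {p : Prog} {s : State} {Q Q' : State → ℕ → Prop}
    (h : Wp P p s Q) (hQ : ∀ s' t, Q s' t → Q' s' t) : Wp P p s Q' := by
  obtain ⟨t, s', h1, h2⟩ := h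
  exact ⟨t, s', h1, hQ _ _ h2⟩

theorem Wp.seq {P : Params} {p q : Prog} {s : State} {Q : State → ℕ → Prop}
    (h : Wp P p s fun s' t => Wp P q s' fun s'' u => Q s'' (t + u)) : Wp P (p ;; q) s Q := by
  obtain ⟨t, s', h1, u, s'', h2, h3⟩ := h
  exact ⟨_, _, .seq h1 h2, h3⟩

theorem Wp.skip {P : Params} {s : State} {Q : State → ℕ → Prop} (h : Q s 0) :
    Wp P .skip s Q := ⟨_, _, .skip s, h⟩

theorem Wp.ite {P : Params} {c : Test} {p q : Prog} {s : State} {Q : State → ℕ → Prop}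
    {b : Bool} (hc : c.eval P s = some b) (hp : b = true → Wp P p s Q)
    (hq : b = false → Wp P q s Q) : Wp P (.ite c p q) s Q := by
  cases b with
  | true =>
    obtain ⟨t, s', h1, h2⟩ := hp rfl
    exact ⟨_, _, .iteTrue hc h1, h2⟩
  | false =>
    obtain ⟨t, s', h1, h2⟩ := hq rfl
    exact ⟨_, _, .iteFalse hc h1, h2⟩

/-- Strong induction on the variant `i`. The invariant also sees the cost `t` accumulated so far, so
that amortized bounds can be part of it. -/
theorem Wp.loop {P : Params} {c : Test} {p : Prog} {Q : State → ℕ → Prop}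
    (Inv : ℕ → State → ℕ → Prop)
    (step : ∀ i s t, Inv i s t → (c.eval P s = some false ∧ Q s t) ∨
      (c.eval P s = some true ∧ Wp P p s fun s' u => ∃ j < i, Inv j s' (t + u)))
    {i : ℕ} {s : State} {t : ℕ} (h : Inv i s t) :
    Wp P (.loop c p) s fun s' u => Q s' (t + u) := by
  induction i using Nat.strong_induction_on generalizing s t with
  | _ i ih =>
    rcases step i s t h with ⟨hc, hQ⟩ | ⟨hc, u, s', hp, j, hj, hI⟩
    · exact ⟨0, s, .loopFalse hc, hQ⟩
    · obtain ⟨u', s'', hl, hQ⟩ := ih j hj hI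
      exact ⟨u + u', s'', .loopTrue hc hp hl, by rwa [add_assoc] at hQ⟩

theorem Wp.assign {P : Params} {r : ℕ} {e : Expr} {s : State} {w : Word}
    {Q : State → ℕ → Prop} (he : e.eval P s = some w)
    (h : Q { s with reg := Function.update s.reg r w } 0) : Wp P (.assign r e) s Q :=
  ⟨_, _, .assign he, h⟩

theorem Wp.store {P : Params} {a e : Expr} {s : State} {w : Word} {i : ℕ}
    {Q : State → ℕ → Prop} (ha : a.eval P s = some (.num i)) (hi : i < P.M)
    (he : e.eval P s = some w)
    (h : Q { s with mem := Function.update s.mem i w } 0) : Wp P (.store a e) s Q :=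
  ⟨_, _, .store ha hi he, h⟩

/-! ### Evaluation of expressions and tests -/

theorem Expr.eval_const {P : Params} {s : State} {n : ℕ} (h : n < P.W) :
    (Expr.const n).eval P s = some (.num n) := by simp [Expr.eval, Params.mk?, h]

theorem Expr.eval_blockSize {P : Params} {s : State} (h : P.B < P.W) :
    Expr.blockSize.eval P s = some (.num P.B) := by simp [Expr.eval, Params.mk?, h]

theorem Expr.eval_memSize {P : Params} {s : State} (h : P.M < P.W) :
    Expr.memSize.eval P s = some (.num P.M) := by simp [Expr.eval, Params.mk?, h]

theorem Expr.eval_inputSize {P : Params} {s : State} (h : P.N < P.W) :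
    Expr.inputSize.eval P s = some (.num P.N) := by simp [Expr.eval, Params.mk?, h]

theorem Expr.eval_reg {P : Params} {s : State} {r : ℕ} {w : Word} (h : s.reg r = w) :
    (Expr.reg r).eval P s = some w := by simp [Expr.eval, h]

theorem Expr.eval_mem {P : Params} {s : State} {a : Expr} {i : ℕ} {w : Word}
    (ha : a.eval P s = some (.num i)) (hi : i < P.M) (hw : s.mem i = w) :
    (Expr.mem a).eval P s = some w := by simp [Expr.eval, ha, hi, hw]

section
variable {P : Params} {s : State} {e f : Expr} {m n : ℕ}

theorem Expr.eval_add (he : e.eval P s = some (.num m)) (hf : f.eval P s = some (.num n))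
    (h : m + n < P.W) : (e.add f).eval P s = some (.num (m + n)) := by
  simp [Expr.eval, he, hf, Params.arith, Params.mk?, h]

theorem Expr.eval_mul (he : e.eval P s = some (.num m)) (hf : f.eval P s = some (.num n))
    (h : m * n < P.W) : (e.mul f).eval P s = some (.num (m * n)) := by
  simp [Expr.eval, he, hf, Params.arith, Params.mk?, h]

theorem Expr.eval_sub (he : e.eval P s = some (.num m)) (hf : f.eval P s = some (.num n))
    (h : m < P.W) : (e.sub f).eval P s = some (.num (m - n)) := by
  simp [Expr.eval, he, hf, Params.arith, Params.mk?, lt_of_le_of_lt (Nat.sub_le m n) h]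

theorem Expr.eval_div (he : e.eval P s = some (.num m)) (hf : f.eval P s = some (.num n))
    (h : m < P.W) : (e.div f).eval P s = some (.num (m / n)) := by
  simp [Expr.eval, he, hf, Params.arith, Params.mk?, lt_of_le_of_lt (Nat.div_le_self m n) h]

theorem Expr.eval_mod (he : e.eval P s = some (.num m)) (hf : f.eval P s = some (.num n))
    (h : m < P.W) : (e.mod f).eval P s = some (.num (m % n)) := by
  simp [Expr.eval, he, hf, Params.arith, Params.mk?, lt_of_le_of_lt (Nat.mod_le m n) h]

theorem Test.eval_lt (he : e.eval P s = some (.num m)) (hf : f.eval P s = some (.num n)) :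
    (Test.lt e f).eval P s = some (decide (m < n)) := by
  simp [Test.eval, he, hf]

/-- Equality test of two numbers. -/
def Test.eq (e f : Expr) : Test := .and (.not (.lt e f)) (.not (.lt f e))

theorem Test.eval_eq (he : e.eval P s = some (.num m)) (hf : f.eval P s = some (.num n)) :
    (Test.eq e f).eval P s = some (decide (m = n)) := by
  simp only [Test.eq, Test.eval, he, hf, Option.map_some]
  rcases lt_trichotomy m n with h | h | h
  · simp [h, h.ne]
  · simp [h]
  · simp [h, h.ne']
end

/-! ### The virtual machine

Pairs of words are addressed as cells, which live in main memory behind the first block, and,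
for the last ten cells, in registers. The cells are divided into slots of one header and `β`
buffer cells. The disk is divided into four files of blocks of `β` cells. -/

abbrev Cell := Word × Word

/-- Constants of the virtual machine. -/
structure Ctx where
  P : Params
  β : ℕ
  f : ℕ
  H : ℕ
  base : ℕ
  X : ℕ
  inp : ℕ → ℕ → Word

/-- State of the virtual machine. -/
structure View where
  v : ℕ → ℕ
  e : ℕ → Cell
  hd : ℕ → ℕ × ℕ
  buf : ℕ → ℕ → Cell
  fl : ℕ → ℕ → Cell

def View.setV (a : View) (r x : ℕ) : View := { a with v := Function.update a.v r x }

def View.setE (a : View) (r : ℕ) (w : Cell) : View := { a with e := Function.update a.e r w }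

def View.setHd (a : View) (σ : ℕ) (x : ℕ × ℕ) : View := { a with hd := Function.update a.hd σ x }

def View.setBuf (a : View) (σ : ℕ) (g : ℕ → Cell) : View :=
  { a with buf := Function.update a.buf σ g }

def View.setFl (a : View) (φ : ℕ) (g : ℕ → Cell) : View :=
  { a with fl := Function.update a.fl φ g }

section
variable (a : View) (i x : ℕ) (w : Cell) (y : ℕ × ℕ) (g : ℕ → Cell)

@[simp] theorem View.setBuf_setBuf (g' : ℕ → Cell) :
    (a.setBuf i g).setBuf i g' = a.setBuf i g' := by simp [View.setBuf]
@[simp] theorem View.setFl_setFl (g' : ℕ → Cell) :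
    (a.setFl i g).setFl i g' = a.setFl i g' := by simp [View.setFl]
@[simp] theorem View.setV_v : (a.setV i x).v = Function.update a.v i x := rfl
@[simp] theorem View.setV_e : (a.setV i x).e = a.e := rfl
@[simp] theorem View.setV_hd : (a.setV i x).hd = a.hd := rfl
@[simp] theorem View.setV_buf : (a.setV i x).buf = a.buf := rfl
@[simp] theorem View.setV_fl : (a.setV i x).fl = a.fl := rfl
@[simp] theorem View.setE_v : (a.setE i w).v = a.v := rfl
@[simp] theorem View.setE_e : (a.setE i w).e = Function.update a.e i w := rfl
@[simp] theorem View.setE_hd : (a.setE i w).hd = a.hd := rfl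
@[simp] theorem View.setE_buf : (a.setE i w).buf = a.buf := rfl
@[simp] theorem View.setE_fl : (a.setE i w).fl = a.fl := rfl
@[simp] theorem View.setHd_v : (a.setHd i y).v = a.v := rfl
@[simp] theorem View.setHd_e : (a.setHd i y).e = a.e := rfl
@[simp] theorem View.setHd_hd : (a.setHd i y).hd = Function.update a.hd i y := rfl
@[simp] theorem View.setHd_buf : (a.setHd i y).buf = a.buf := rfl
@[simp] theorem View.setHd_fl : (a.setHd i y).fl = a.fl := rfl
@[simp] theorem View.setBuf_v : (a.setBuf i g).v = a.v := rfl
@[simp] theorem View.setBuf_e : (a.setBuf i g).e = a.e := rfl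
@[simp] theorem View.setBuf_hd : (a.setBuf i g).hd = a.hd := rfl
@[simp] theorem View.setBuf_buf : (a.setBuf i g).buf = Function.update a.buf i g := rfl
@[simp] theorem View.setBuf_fl : (a.setBuf i g).fl = a.fl := rfl
@[simp] theorem View.setFl_v : (a.setFl i g).v = a.v := rfl
@[simp] theorem View.setFl_e : (a.setFl i g).e = a.e := rfl
@[simp] theorem View.setFl_hd : (a.setFl i g).hd = a.hd := rfl
@[simp] theorem View.setFl_buf : (a.setFl i g).buf = a.buf := rfl
@[simp] theorem View.setFl_fl : (a.setFl i g).fl = Function.update a.fl i g := rfl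

end

/-- In a scan, slots 0 and 1 buffer the input and the output and slot 2 the current block of a file
of runs; the other `f` slots hold the inputs of a merge. Ten cells are kept in registers because
main memory may offer none: for `M = 2` and `B = 1` there are no memory cells, and five slots of two
cells are needed. The field `W` makes room for expressions with twelve operands below `X`. -/
structure Ctx.Good (C : Ctx) : Prop where
  β_pos : 0 < C.β
  β_le : C.β ≤ C.P.B
  f_two : 2 ≤ C.f
  slots : (C.f + 3) * (C.β + 1) ≤ C.H + 10
  memory : C.P.B + 2 * C.H ≤ C.P.M
  X64 : 64 ≤ C.X
  W : C.X ^ 12 ≤ C.P.W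
  βX : C.β < C.X
  fX : C.f < C.X
  HX : C.H < C.X
  baseX : C.base < C.X
  BX : C.P.B < C.X
  NX : C.P.N < C.X
  MX : C.P.M < C.X

/-- Write the two words of a cell to the addresses `i` and `j`. -/
abbrev update₂ (g : ℕ → Word) (i j : ℕ) (w : Cell) : ℕ → Word :=
  Function.update (Function.update g i w.1) j w.2

theorem update₂_of_ne {g : ℕ → Word} {i j k : ℕ} {w : Cell} (hi : k ≠ i) (hj : k ≠ j) :
    update₂ g i j w k = g k := by
  rw [update₂, Function.update_of_ne hj, Function.update_of_ne hi]

/-- Content of cell number `c`. -/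
def Ctx.cell (C : Ctx) (s : State) (c : ℕ) : Cell :=
  if c < C.H then (s.mem (C.P.B + 2 * c), s.mem (C.P.B + 2 * c + 1))
  else (s.reg (60 + 2 * (c - C.H)), s.reg (61 + 2 * (c - C.H)))

/-- The state after writing `w` into cell number `c`. -/
def Ctx.setCell (C : Ctx) (s : State) (c : ℕ) (w : Cell) : State :=
  if c < C.H then
    { s with mem := update₂ s.mem (C.P.B + 2 * c) (C.P.B + 2 * c + 1) w }
  else
    { s with reg := update₂ s.reg (60 + 2 * (c - C.H)) (61 + 2 * (c - C.H)) w }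

theorem Ctx.cell_setCell (C : Ctx) (s : State) (c c' : ℕ) (w : Cell) :
    C.cell (C.setCell s c w) c' = if c' = c then w else C.cell s c' := by
  unfold Ctx.cell Ctx.setCell
  by_cases h : c < C.H <;> by_cases h' : c' < C.H
  · simp only [h, h', if_true, Function.update_apply]
    split_ifs <;> first | rfl | omega
  · simp only [h, h', if_true, if_false]
    rw [if_neg (by omega)]
  · simp only [h, h', if_true, if_false]
    rw [if_neg (by omega)]
  · simp only [h, h', if_false, Function.update_apply]
    split_ifs <;> first | rfl | omega

theorem Ctx.cell_congr {C : Ctx} {s s' : State} (hr : ∀ r, 60 ≤ r → s'.reg r = s.reg r)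
    (hm : ∀ i, C.P.B ≤ i → s'.mem i = s.mem i) (c : ℕ) : C.cell s' c = C.cell s c := by
  unfold Ctx.cell
  rw [hr _ (by omega), hr _ (by omega), hm _ (by omega), hm _ (by omega)]

theorem Ctx.cell_update (C : Ctx) (s : State) {r : ℕ} (w : Word) (hr : r < 60) (c : ℕ) :
    C.cell { s with reg := Function.update s.reg r w } c = C.cell s c := by
  refine Ctx.cell_congr ?_ ?_ c
  case refine_2 => exact fun _ _ => rfl
  intro r' hr'
  exact Function.update_of_ne (by omega) _ _

theorem Ctx.cell_update₂ (C : Ctx) (s : State) {i j : ℕ} (w : Cell) (hi : i < 60) (hj : j < 60)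
    (c : ℕ) : C.cell { s with reg := update₂ s.reg i j w } c = C.cell s c := by
  refine Ctx.cell_congr ?_ ?_ c
  case refine_2 => exact fun _ _ => rfl
  intro r' hr'
  exact update₂_of_ne (by omega) (by omega)

/-- The machine state `s` implements the state `a` of the virtual machine. -/
structure Ctx.Rel (C : Ctx) (s : State) (a : View) : Prop where
  v : ∀ i < 30, s.reg i = .num (a.v i)
  vX : ∀ i < 30, a.v i < C.X
  cβ : s.reg 30 = .num C.β
  cf : s.reg 31 = .num C.f
  cH : s.reg 32 = .num C.H
  cbase : s.reg 33 = .num C.base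
  e : ∀ r < 4, s.reg (40 + 2 * r) = (a.e r).1 ∧ s.reg (41 + 2 * r) = (a.e r).2
  hd : ∀ σ < C.f + 3, C.cell s (σ * (C.β + 1)) = (.num (a.hd σ).1, .num (a.hd σ).2)
  hdX : ∀ σ < C.f + 3, (a.hd σ).1 < C.X ∧ (a.hd σ).2 < C.X
  buf : ∀ σ < C.f + 3, ∀ o < C.β, C.cell s (σ * (C.β + 1) + (o + 1)) = a.buf σ o
  fl : ∀ φ < 4, ∀ p, s.disk (C.base + 2 * (4 * (p / C.β) + φ)) (p % C.β) = (a.fl φ p).1 ∧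
    s.disk (C.base + 2 * (4 * (p / C.β) + φ) + 1) (p % C.β) = (a.fl φ p).2
  inp : ∀ j < C.base, s.disk j = C.inp j

/-- Registers 34 to 39 and the first block of main memory are scratch space, about which `Ctx.Rel`
says nothing. -/
theorem Ctx.Rel.congr {C : Ctx} {s s' : State} {a : View} (h : C.Rel s a)
    (hr : ∀ r, ¬ (34 ≤ r ∧ r < 40) → s'.reg r = s.reg r)
    (hm : ∀ i, C.P.B ≤ i → s'.mem i = s.mem i) (hd : s'.disk = s.disk) : C.Rel s' a where
  v i hi := by rw [hr _ (by omega), h.v i hi]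
  vX := h.vX
  cβ := by rw [hr _ (by omega), h.cβ]
  cf := by rw [hr _ (by omega), h.cf]
  cH := by rw [hr _ (by omega), h.cH]
  cbase := by rw [hr _ (by omega), h.cbase]
  e r hr' := by rw [hr _ (by omega), hr _ (by omega)]; exact h.e r hr'
  hd σ hσ := by rw [Ctx.cell_congr (fun r _ => hr r (by omega)) hm]; exact h.hd σ hσ
  hdX := h.hdX
  buf σ hσ o ho := by rw [Ctx.cell_congr (fun r _ => hr r (by omega)) hm]; exact h.buf σ hσ o ho
  fl := by rw [hd]; exact h.fl
  inp := by rw [hd]; exact h.inp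

theorem Ctx.Rel.temp {C : Ctx} {s : State} {a : View} (h : C.Rel s a) {r : ℕ} (w : Word)
    (hr : 34 ≤ r ∧ r < 40) : C.Rel { s with reg := Function.update s.reg r w } a :=
  h.congr (fun r' hr' => Function.update_of_ne (by omega) _ _) (fun _ _ => rfl) rfl

theorem Ctx.Rel.setV {C : Ctx} {s : State} {a : View} (h : C.Rel s a) {r x : ℕ} (hr : r < 30)
    (hx : x < C.X) : C.Rel { s with reg := Function.update s.reg r (.num x) }
      { a with v := Function.update a.v r x } where
  v i hi := by by_cases hir : i = r <;> simp [hir, h.v, hi]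
  vX i hi := by by_cases hir : i = r <;> simp [hir, hx, h.vX, hi]
  cβ := by rw [← h.cβ]; exact Function.update_of_ne (by omega) _ _
  cf := by rw [← h.cf]; exact Function.update_of_ne (by omega) _ _
  cH := by rw [← h.cH]; exact Function.update_of_ne (by omega) _ _
  cbase := by rw [← h.cbase]; exact Function.update_of_ne (by omega) _ _
  e r' hr' := by
    rw [← (h.e r' hr').1, ← (h.e r' hr').2]
    exact ⟨Function.update_of_ne (by omega) _ _, Function.update_of_ne (by omega) _ _⟩
  hd σ hσ := by
    rw [← h.hd σ hσ]
    exact C.cell_update s _ (by omega) _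
  hdX := h.hdX
  buf σ hσ o ho := by
    rw [← h.buf σ hσ o ho]
    exact C.cell_update s _ (by omega) _
  fl := h.fl
  inp := h.inp

theorem Ctx.Rel.setE {C : Ctx} {s : State} {a : View} (h : C.Rel s a) {r : ℕ} (hr : r < 4)
    (w : Cell) : C.Rel { s with reg := update₂ s.reg (40 + 2 * r) (41 + 2 * r) w }
      { a with e := Function.update a.e r w } := by
  have key : ∀ r', r' ≠ 40 + 2 * r → r' ≠ 41 + 2 * r →
      update₂ s.reg (40 + 2 * r) (41 + 2 * r) w r' = s.reg r' := by
    intro r' h1 h2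
    exact update₂_of_ne h1 h2
  constructor
  · intro i hi; rw [← h.v i hi]; exact key _ (by omega) (by omega)
  · exact h.vX
  · rw [← h.cβ]; exact key _ (by omega) (by omega)
  · rw [← h.cf]; exact key _ (by omega) (by omega)
  · rw [← h.cH]; exact key _ (by omega) (by omega)
  · rw [← h.cbase]; exact key _ (by omega) (by omega)
  · intro r' hr'
    by_cases hrr : r' = r
    · subst hrr
      simp
    · simp only [Function.update_of_ne hrr]
      rw [← (h.e r' hr').1, ← (h.e r' hr').2]
      exact ⟨key _ (by omega) (by omega), key _ (by omega) (by omega)⟩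
  · intro σ hσ
    rw [← h.hd σ hσ]
    exact C.cell_update₂ s _ (by omega) (by omega) _
  · exact h.hdX
  · intro σ hσ o ho
    rw [← h.buf σ hσ o ho]
    exact C.cell_update₂ s _ (by omega) (by omega) _
  · exact h.fl
  · exact h.inp

theorem Ctx.setCell_reg (C : Ctx) (s : State) (c : ℕ) (w : Cell) {r : ℕ} (hr : r < 60) :
    (C.setCell s c w).reg r = s.reg r := by
  unfold Ctx.setCell
  split_ifs
  · rfl
  · exact update₂_of_ne (by omega) (by omega)

theorem Ctx.setCell_disk (C : Ctx) (s : State) (c : ℕ) (w : Cell) :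
    (C.setCell s c w).disk = s.disk := by
  unfold Ctx.setCell
  split_ifs <;> rfl

theorem Ctx.setCell_mem (C : Ctx) (s : State) (c : ℕ) (w : Cell) {i : ℕ} (hi : i < C.P.B) :
    (C.setCell s c w).mem i = s.mem i := by
  unfold Ctx.setCell
  split_ifs
  · exact update₂_of_ne (by omega) (by omega)
  · rfl

/-- Uniqueness of division with remainder. It separates the cells of different slots, and the header
of a slot from its buffer. -/
theorem slot_inj {b σ σ' o o' : ℕ} (ho : o < b) (ho' : o' < b)
    (h : σ * b + o = σ' * b + o') : σ = σ' ∧ o = o' := by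
  have hb : 0 < b := by omega
  have h1 : (σ * b + o) / b = σ := by
    rw [mul_comm, Nat.mul_add_div hb, Nat.div_eq_of_lt ho, add_zero]
  have h2 : (σ' * b + o') / b = σ' := by
    rw [mul_comm, Nat.mul_add_div hb, Nat.div_eq_of_lt ho', add_zero]
  have h3 : σ = σ' := by rw [← h1, ← h2, h]
  subst h3
  exact ⟨rfl, by omega⟩

theorem Ctx.Rel.setBuf {C : Ctx} {s : State} {a : View} (h : C.Rel s a) {σ o : ℕ}
    (ho : o < C.β) (w : Cell) :
    C.Rel (C.setCell s (σ * (C.β + 1) + (o + 1)) w)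
      { a with buf := Function.update a.buf σ (Function.update (a.buf σ) o w) } where
  v i hi := by rw [C.setCell_reg _ _ _ (by omega)]; exact h.v i hi
  vX := h.vX
  cβ := by rw [C.setCell_reg _ _ _ (by omega)]; exact h.cβ
  cf := by rw [C.setCell_reg _ _ _ (by omega)]; exact h.cf
  cH := by rw [C.setCell_reg _ _ _ (by omega)]; exact h.cH
  cbase := by rw [C.setCell_reg _ _ _ (by omega)]; exact h.cbase
  e r hr := by
    rw [C.setCell_reg _ _ _ (by omega), C.setCell_reg _ _ _ (by omega)]; exact h.e r hr
  hd σ' hσ' := by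
    rw [Ctx.cell_setCell, if_neg]
    · exact h.hd σ' hσ'
    · intro h'
      have := (slot_inj (b := C.β + 1) (o := 0) (o' := o + 1) (by omega) (by omega) h').2
      omega
  hdX := h.hdX
  buf σ' hσ' o' ho' := by
    rw [Ctx.cell_setCell, h.buf σ' hσ' o' ho']
    by_cases hs : σ' = σ
    · subst hs
      by_cases hoo : o' = o
      · simp [hoo]
      · simp [hoo]
    · simp only [Function.update_of_ne hs]
      rw [if_neg]
      intro h'
      exact hs (slot_inj (b := C.β + 1) (by omega) (by omega) h').1
  fl := by rw [C.setCell_disk]; exact h.fl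
  inp := by rw [C.setCell_disk]; exact h.inp

theorem Ctx.Rel.setHd {C : Ctx} {s : State} {a : View} (h : C.Rel s a) {σ m n : ℕ}
    (hm : m < C.X) (hn : n < C.X) :
    C.Rel (C.setCell s (σ * (C.β + 1)) (.num m, .num n))
      { a with hd := Function.update a.hd σ (m, n) } where
  v i hi := by rw [C.setCell_reg _ _ _ (by omega)]; exact h.v i hi
  vX := h.vX
  cβ := by rw [C.setCell_reg _ _ _ (by omega)]; exact h.cβ
  cf := by rw [C.setCell_reg _ _ _ (by omega)]; exact h.cf
  cH := by rw [C.setCell_reg _ _ _ (by omega)]; exact h.cH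
  cbase := by rw [C.setCell_reg _ _ _ (by omega)]; exact h.cbase
  e r hr := by
    rw [C.setCell_reg _ _ _ (by omega), C.setCell_reg _ _ _ (by omega)]; exact h.e r hr
  hd σ' hσ' := by
    rw [Ctx.cell_setCell]
    by_cases hs : σ' = σ
    · simp [hs]
    · simp only [Function.update_of_ne hs]
      rw [if_neg]
      · exact h.hd σ' hσ'
      · intro h'
        exact hs (slot_inj (b := C.β + 1) (o := 0) (o' := 0) (by omega) (by omega) h').1
  hdX σ' hσ' := by
    by_cases hs : σ' = σ
    · simp [hs, hm, hn]
    · simp only [Function.update_of_ne hs]; exact h.hdX σ' hσ'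
  buf σ' hσ' o' ho' := by
    rw [Ctx.cell_setCell, h.buf σ' hσ' o' ho', if_neg]
    intro h'
    have := (slot_inj (b := C.β + 1) (o := o' + 1) (o' := 0) (by omega) (by omega) h').2
    omega
  fl := by rw [C.setCell_disk]; exact h.fl
  inp := by rw [C.setCell_disk]; exact h.inp


/-! ### Expressions on the virtual machine -/

/-- Value of an expression without memory access on the virtual machine. -/
def Expr.val (C : Ctx) (v : ℕ → ℕ) : Expr → ℕ
  | const n => n
  | memSize => C.P.M
  | blockSize => C.P.B
  | inputSize => C.P.N
  | reg r => if r < 30 then v r else if r = 30 then C.β else if r = 31 then C.f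
      else if r = 32 then C.H else C.base
  | mem _ => 0
  | add e f => e.val C v + f.val C v
  | sub e f => e.val C v - f.val C v
  | mul e f => e.val C v * f.val C v
  | div e f => e.val C v / f.val C v
  | mod e f => e.val C v % f.val C v

/-- The expression has no memory access, small constants, and uses numeric registers only. -/
def Expr.plain : Expr → Bool
  | const n => decide (n < 64)
  | memSize => true
  | blockSize => true
  | inputSize => true
  | reg r => decide (r < 34)
  | mem _ => false
  | add e f => e.plain && f.plain
  | sub e f => e.plain && f.plain
  | mul e f => e.plain && f.plain
  | div e f => e.plain && f.plain
  | mod e f => e.plain && f.plain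

/-- Number of leaves. -/
def Expr.size : Expr → ℕ
  | add e f => e.size + f.size
  | sub e f => e.size + f.size
  | mul e f => e.size + f.size
  | div e f => e.size + f.size
  | mod e f => e.size + f.size
  | _ => 1

theorem Expr.size_pos (e : Expr) : 0 < e.size := by
  induction e <;> simp only [Expr.size] <;> omega

/-- Makes addition no worse than multiplication for overflow: in both cases the exponents of the
operands add up. -/
theorem pow_add_pow_le {X a b : ℕ} (hX : 2 ≤ X) (ha : 0 < a) (hb : 0 < b) :
    X ^ a + X ^ b ≤ X ^ (a + b) := by
  have h1 : 2 ≤ X ^ a := le_trans hX (Nat.le_self_pow ha.ne' X)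
  have h2 : 2 ≤ X ^ b := le_trans hX (Nat.le_self_pow hb.ne' X)
  rw [pow_add]
  nlinarith

/-- Every leaf is below `X`, and every operation at most adds the exponents of its operands.
Overflow is thus excluded by counting leaves, which is decidable on the program text. -/
theorem Expr.val_lt {C : Ctx} (hC : C.Good) {v : ℕ → ℕ} (hv : ∀ i < 30, v i < C.X) {e : Expr}
    (he : e.plain = true) : e.val C v < C.X ^ e.size := by
  have hX := hC.X64
  have mono : ∀ a b : ℕ, C.X ^ a ≤ C.X ^ (a + b) := fun a b =>
    Nat.pow_le_pow_right (by omega) (by omega)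
  induction e with
  | const n => simp [Expr.plain] at he; simp [Expr.val, Expr.size]; omega
  | memSize => simpa [Expr.val, Expr.size] using hC.MX
  | blockSize => simpa [Expr.val, Expr.size] using hC.BX
  | inputSize => simpa [Expr.val, Expr.size] using hC.NX
  | reg r =>
    simp only [Expr.val, Expr.size, pow_one]
    split_ifs with h
    · exact hv r h
    · exact hC.βX
    · exact hC.fX
    · exact hC.HX
    · exact hC.baseX
  | mem => simp [Expr.plain] at he
  | add e f ihe ihf =>
    simp only [Expr.plain, Bool.and_eq_true] at he
    have := pow_add_pow_le (X := C.X) (by omega) e.size_pos f.size_pos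
    have := ihe he.1
    have := ihf he.2
    simp only [Expr.val, Expr.size]
    omega
  | sub e f ihe ihf =>
    simp only [Expr.plain, Bool.and_eq_true] at he
    exact lt_of_le_of_lt (Nat.sub_le _ _) (lt_of_lt_of_le (ihe he.1) (mono _ _))
  | mul e f ihe ihf =>
    simp only [Expr.plain, Bool.and_eq_true] at he
    simp only [Expr.val, Expr.size, pow_add]
    exact Nat.mul_lt_mul'' (ihe he.1) (ihf he.2)
  | div e f ihe ihf =>
    simp only [Expr.plain, Bool.and_eq_true] at he
    exact lt_of_le_of_lt (Nat.div_le_self _ _) (lt_of_lt_of_le (ihe he.1) (mono _ _))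
  | mod e f ihe ihf =>
    simp only [Expr.plain, Bool.and_eq_true] at he
    exact lt_of_le_of_lt (Nat.mod_le _ _) (lt_of_lt_of_le (ihe he.1) (mono _ _))

theorem Ctx.Good.pow_le {C : Ctx} (hC : C.Good) {n : ℕ} (hn : n ≤ 12) : C.X ^ n ≤ C.P.W :=
  le_trans (Nat.pow_le_pow_right (by have := hC.X64; omega) hn) hC.W

theorem Ctx.Good.X_le {C : Ctx} (hC : C.Good) : C.X ≤ C.P.W := by
  simpa using hC.pow_le (n := 1) (by omega)

theorem Expr.eval_val {C : Ctx} (hC : C.Good) {s : State} {a : View} (h : C.Rel s a) {e : Expr}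
    (he : e.plain = true) (hs : e.size ≤ 12) : e.eval C.P s = some (.num (e.val C a.v)) := by
  have hlt : ∀ {e : Expr}, e.plain = true → e.size ≤ 12 → e.val C a.v < C.P.W := fun he hs =>
    lt_of_lt_of_le (Expr.val_lt hC h.vX he) (hC.pow_le hs)
  have hX := hC.X_le
  induction e with
  | const n => exact Expr.eval_const (hlt he hs)
  | memSize => exact Expr.eval_memSize (hlt he hs)
  | blockSize => exact Expr.eval_blockSize (hlt he hs)
  | inputSize => exact Expr.eval_inputSize (hlt he hs)
  | reg r =>
    apply Expr.eval_reg
    simp only [Expr.plain, decide_eq_true_eq] at he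
    simp only [Expr.val]
    split_ifs with h1 h2 h3 h4
    · exact h.v r h1
    · rw [h2]; exact h.cβ
    · rw [h3]; exact h.cf
    · rw [h4]; exact h.cH
    · rw [show r = 33 by omega]; exact h.cbase
  | mem => simp [Expr.plain] at he
  | add e f ihe ihf =>
    have hw := hlt he hs
    simp only [Expr.plain, Bool.and_eq_true] at he
    simp only [Expr.size] at hs
    exact Expr.eval_add (ihe he.1 (by omega)) (ihf he.2 (by omega)) hw
  | sub e f ihe ihf =>
    simp only [Expr.plain, Bool.and_eq_true] at he
    simp only [Expr.size] at hs
    exact Expr.eval_sub (ihe he.1 (by omega)) (ihf he.2 (by omega)) (hlt he.1 (by omega))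
  | mul e f ihe ihf =>
    have hw := hlt he hs
    simp only [Expr.plain, Bool.and_eq_true] at he
    simp only [Expr.size] at hs
    exact Expr.eval_mul (ihe he.1 (by omega)) (ihf he.2 (by omega)) hw
  | div e f ihe ihf =>
    simp only [Expr.plain, Bool.and_eq_true] at he
    simp only [Expr.size] at hs
    exact Expr.eval_div (ihe he.1 (by omega)) (ihf he.2 (by omega)) (hlt he.1 (by omega))
  | mod e f ihe ihf =>
    simp only [Expr.plain, Bool.and_eq_true] at he
    simp only [Expr.size] at hs
    exact Expr.eval_mod (ihe he.1 (by omega)) (ihf he.2 (by omega)) (hlt he.1 (by omega))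

/-- Plain expression with few leaves. -/
def Expr.ok (e : Expr) : Bool := e.plain && decide (e.size ≤ 12)

theorem Expr.eval_ok {C : Ctx} (hC : C.Good) {s : State} {a : View} (h : C.Rel s a) {e : Expr}
    (he : e.ok = true) : e.eval C.P s = some (.num (e.val C a.v)) := by
  simp only [Expr.ok, Bool.and_eq_true, decide_eq_true_eq] at he
  exact Expr.eval_val hC h he.1 he.2

/-- Outcome of a numeric test on the virtual machine. -/
def Test.val (C : Ctx) (v : ℕ → ℕ) : Test → Prop
  | lt e f => e.val C v < f.val C v
  | keyLt _ _ => False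
  | not c => ¬ c.val C v
  | and c d => c.val C v ∧ d.val C v

/-- Numeric test of small expressions. -/
def Test.ok : Test → Bool
  | lt e f => e.ok && f.ok
  | keyLt _ _ => false
  | not c => c.ok
  | and c d => c.ok && d.ok

theorem Test.eval_ok {C : Ctx} (hC : C.Good) {s : State} {a : View} (h : C.Rel s a) {c : Test}
    (hc : c.ok = true) : ∃ b, c.eval C.P s = some b ∧ (b = true ↔ c.val C a.v) := by
  induction c with
  | lt e f =>
    simp only [Test.ok, Bool.and_eq_true] at hc
    rw [Test.eval_lt (Expr.eval_ok hC h hc.1) (Expr.eval_ok hC h hc.2)]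
    simp [Test.val]
  | keyLt => simp [Test.ok] at hc
  | not c ih =>
    simp only [Test.ok] at hc
    obtain ⟨b, h1, h2⟩ := ih hc
    simp [Test.eval, h1, Test.val, ← h2]
  | and c d ihc ihd =>
    simp only [Test.ok, Bool.and_eq_true] at hc
    obtain ⟨b, h1, h2⟩ := ihc hc.1
    obtain ⟨b', h3, h4⟩ := ihd hc.2
    simp [Test.eval, h1, h3, Test.val, ← h2, ← h4]

/-! ### Access to cells -/

/-- Search for the register cell addressed by register 34. -/
def switchLoad (r₁ r₂ : ℕ) : ℕ → Prog
  | 0 => .skip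
  | i + 1 => .ite (.eq (.reg 34) (.add (.reg 32) (.const i)))
      (.assign r₁ (.reg (60 + 2 * i)) ;; .assign r₂ (.reg (61 + 2 * i))) (switchLoad r₁ r₂ i)

/-- Load the cell with address `a` into the registers `r₁` and `r₂`. -/
def cellLoad (r₁ r₂ : ℕ) (a : Expr) : Prog :=
  .assign 34 a ;;
  .ite (.lt (.reg 34) (.reg 32))
    (.assign r₁ (.mem (.add .blockSize (.mul (.const 2) (.reg 34)))) ;;
      .assign r₂ (.mem (.add (.add .blockSize (.mul (.const 2) (.reg 34))) (.const 1))))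
    (switchLoad r₁ r₂ 10)

/-- Search for the register cell addressed by register 34. -/
def switchStore (r₁ r₂ : ℕ) : ℕ → Prog
  | 0 => .skip
  | i + 1 => .ite (.eq (.reg 34) (.add (.reg 32) (.const i)))
      (.assign (60 + 2 * i) (.reg r₁) ;; .assign (61 + 2 * i) (.reg r₂)) (switchStore r₁ r₂ i)

/-- Store the registers `r₁` and `r₂` into the cell with address `a`. -/
def cellStore (r₁ r₂ : ℕ) (a : Expr) : Prog :=
  .assign 34 a ;;
  .ite (.lt (.reg 34) (.reg 32))
    (.store (.add .blockSize (.mul (.const 2) (.reg 34))) (.reg r₁) ;;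
      .store (.add (.add .blockSize (.mul (.const 2) (.reg 34))) (.const 1)) (.reg r₂))
    (switchStore r₁ r₂ 10)

section
variable {C : Ctx} {s : State} {Q : State → ℕ → Prop}

theorem Ctx.Good.add_lt {C : Ctx} (hC : C.Good) {m n : ℕ} (hm : m < C.X) (hn : n < C.X) :
    m + n < C.P.W := by
  have h1 := hC.pow_le (n := 2) (by omega)
  have h2 := hC.X64
  nlinarith

theorem switchLoad_wp (hC : C.Good) {r₁ r₂ i n : ℕ} (hn : n ≤ 10) (hi : i < n)
    (h34 : s.reg 34 = .num (C.H + i)) (h32 : s.reg 32 = .num C.H) (h₁ : r₁ < 60)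
    (hQ : Q { s with reg := update₂ s.reg r₁ r₂ (C.cell s (C.H + i)) } 0) :
    Wp C.P (switchLoad r₁ r₂ n) s Q := by
  induction n with
  | zero => omega
  | succ n ih =>
    have hX := hC.X64
    refine Wp.ite (Test.eval_eq (Expr.eval_reg h34) (Expr.eval_add (Expr.eval_reg h32)
      (Expr.eval_const (n := n) ?_) ?_)) ?_ ?_
    · have := hC.X_le; omega
    · exact hC.add_lt hC.HX (by omega)
    · intro h
      obtain rfl : i = n := by simpa using h
      refine Wp.seq (Wp.assign (Expr.eval_reg rfl) (Wp.assign (Expr.eval_reg rfl) ?_))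
      convert hQ using 2
      simp only [update₂, Ctx.cell]
      rw [Function.update_of_ne (a := 61 + 2 * i) (a' := r₁) (by omega)]
      simp
    · intro h
      have : i ≠ n := by simpa using h
      exact ih (by omega) (by omega)

theorem cellLoad_wp (hC : C.Good) {r₁ r₂ c : ℕ} {a : Expr} (hc : c < C.H + 10)
    (ha : a.eval C.P s = some (.num c)) (h32 : s.reg 32 = .num C.H)
    (h₁ : r₁ < 60 ∧ r₁ ≠ 34)
    (hQ : Q { s with reg := update₂ (Function.update s.reg 34 (.num c)) r₁ r₂ (C.cell s c) } 0) :
    Wp C.P (cellLoad r₁ r₂ a) s Q := by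
  have hX := hC.X64
  have hXW := hC.X_le
  refine Wp.seq (Wp.assign ha ?_)
  set s' : State := { s with reg := Function.update s.reg 34 (.num c) } with hs'
  have h34' : s'.reg 34 = .num c := by simp [hs']
  have h32' : s'.reg 32 = .num C.H := by simp [hs', h32]
  have hcell : C.cell s' c = C.cell s c := Ctx.cell_update C s _ (by omega) c
  refine Wp.ite (Test.eval_lt (Expr.eval_reg h34') (Expr.eval_reg h32')) ?_ ?_
  · intro h
    have hlt : c < C.H := by simpa using h
    have hM := hC.memory
    have hMX := hC.MX
    have e34 : ∀ s'' : State, s''.reg 34 = .num c →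
        (Expr.add .blockSize (.mul (.const 2) (.reg 34))).eval C.P s'' =
          some (.num (C.P.B + 2 * c)) := fun s'' h => by
      refine Expr.eval_add (Expr.eval_blockSize ?_) (Expr.eval_mul (Expr.eval_const ?_)
        (Expr.eval_reg h) ?_) ?_ <;> omega
    refine Wp.seq (Wp.assign (Expr.eval_mem (e34 _ h34') (by omega) rfl) (Wp.assign
      (Expr.eval_mem (Expr.eval_add (e34 _ ?_) (Expr.eval_const ?_) ?_) ?_ rfl) ?_))
    · simp only
      rw [Function.update_of_ne (Ne.symm h₁.2)]
      exact h34'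
    · omega
    · omega
    · omega
    · convert hQ using 2
      simp [update₂, Ctx.cell, hlt, hs']
  · intro h
    have hlt : C.H ≤ c := by simpa using h
    obtain ⟨i, rfl⟩ := Nat.exists_eq_add_of_le hlt
    refine (switchLoad_wp hC le_rfl (i := i) (by omega) h34' h32' h₁.1 ?_)
    simp only [zero_add]
    rw [hcell]
    exact hQ

theorem switchStore_wp (hC : C.Good) {r₁ r₂ i n : ℕ} (hn : n ≤ 10) (hi : i < n)
    (h34 : s.reg 34 = .num (C.H + i)) (h32 : s.reg 32 = .num C.H) (h₂ : r₂ < 60)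
    (hQ : Q (C.setCell s (C.H + i) (s.reg r₁, s.reg r₂)) 0) :
    Wp C.P (switchStore r₁ r₂ n) s Q := by
  induction n with
  | zero => omega
  | succ n ih =>
    have hX := hC.X64
    refine Wp.ite (Test.eval_eq (Expr.eval_reg h34) (Expr.eval_add (Expr.eval_reg h32)
      (Expr.eval_const (n := n) ?_) ?_)) ?_ ?_
    · have := hC.X_le; omega
    · exact hC.add_lt hC.HX (by omega)
    · intro h
      obtain rfl : i = n := by simpa using h
      refine Wp.seq (Wp.assign (Expr.eval_reg rfl) (Wp.assign (Expr.eval_reg rfl) ?_))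
      convert hQ using 1
      simp only [update₂, Ctx.setCell]
      rw [Function.update_of_ne (a := r₂) (a' := 60 + 2 * i) (by omega)]
      simp
    · intro h
      have : i ≠ n := by simpa using h
      exact ih (by omega) (by omega)

theorem cellStore_wp (hC : C.Good) {r₁ r₂ c : ℕ} {a : Expr} (hc : c < C.H + 10)
    (ha : a.eval C.P s = some (.num c)) (h32 : s.reg 32 = .num C.H)
    (h₁ : r₁ ≠ 34) (h₂ : r₂ < 60 ∧ r₂ ≠ 34)
    (hQ : Q (C.setCell { s with reg := Function.update s.reg 34 (.num c) } c
      (s.reg r₁, s.reg r₂)) 0) :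
    Wp C.P (cellStore r₁ r₂ a) s Q := by
  have hX := hC.X64
  have hXW := hC.X_le
  refine Wp.seq (Wp.assign ha ?_)
  set s' : State := { s with reg := Function.update s.reg 34 (.num c) } with hs'
  have h34' : s'.reg 34 = .num c := by simp [hs']
  have h32' : s'.reg 32 = .num C.H := by simp [hs', h32]
  have hr₁ : s'.reg r₁ = s.reg r₁ := by simp [hs', h₁]
  have hr₂ : s'.reg r₂ = s.reg r₂ := by simp [hs', h₂.2]
  refine Wp.ite (Test.eval_lt (Expr.eval_reg h34') (Expr.eval_reg h32')) ?_ ?_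
  · intro h
    have hlt : c < C.H := by simpa using h
    have hM := hC.memory
    have hMX := hC.MX
    have e34 : ∀ s'' : State, s''.reg 34 = .num c →
        (Expr.add .blockSize (.mul (.const 2) (.reg 34))).eval C.P s'' =
          some (.num (C.P.B + 2 * c)) := fun s'' h => by
      refine Expr.eval_add (Expr.eval_blockSize ?_) (Expr.eval_mul (Expr.eval_const ?_)
        (Expr.eval_reg h) ?_) ?_ <;> omega
    refine Wp.seq (Wp.store (e34 _ h34') (by omega) (Expr.eval_reg hr₁) (Wp.store
      (Expr.eval_add (e34 _ h34') (Expr.eval_const ?_) ?_) ?_ (Expr.eval_reg hr₂) ?_))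
    · omega
    · omega
    · omega
    · convert hQ using 1
      simp [update₂, Ctx.setCell, hlt]
  · intro h
    have hlt : C.H ≤ c := by simpa using h
    obtain ⟨i, rfl⟩ := Nat.exists_eq_add_of_le hlt
    refine switchStore_wp hC le_rfl (i := i) (by omega) h34' h32' h₂.1 ?_
    rw [hr₁, hr₂]
    exact hQ

end

/-! ### Weakest preconditions on the virtual machine -/

/-- Started in a state that implements `a`, the program terminates in a state that implements
some `a'`, with cost `t`, such that `Q a' t`. -/
def Ctx.Tr (C : Ctx) (p : Prog) (a : View) (Q : View → ℕ → Prop) : Prop :=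
  ∀ s, C.Rel s a → Wp C.P p s fun s' t => ∃ a', C.Rel s' a' ∧ Q a' t

section
variable {C : Ctx} {a : View} {p q : Prog} {Q : View → ℕ → Prop}

theorem Ctx.Tr.mono {Q' : View → ℕ → Prop} (h : C.Tr p a Q) (hQ : ∀ a' t, Q a' t → Q' a' t) :
    C.Tr p a Q' := fun s hs => (h s hs).mono fun _ _ ⟨a', h1, h2⟩ => ⟨a', h1, hQ _ _ h2⟩

theorem Ctx.Tr.seq (h : C.Tr p a fun a' t => C.Tr q a' fun a'' u => Q a'' (t + u)) :
    C.Tr (p ;; q) a Q := fun s hs =>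
  Wp.seq ((h s hs).mono fun s' _ ⟨_, h1, h2⟩ => h2 s' h1)

theorem Ctx.Tr.skip (h : Q a 0) : C.Tr .skip a Q := fun _ hs => Wp.skip ⟨a, hs, h⟩

theorem Ctx.Tr.ite (hC : C.Good) {c : Test} (hc : c.ok = true) (hp : c.val C a.v → C.Tr p a Q)
    (hq : ¬ c.val C a.v → C.Tr q a Q) : C.Tr (.ite c p q) a Q := fun s hs => by
  obtain ⟨b, h1, h2⟩ := Test.eval_ok hC hs hc
  refine Wp.ite h1 (fun hb => hp (h2.1 hb) s hs) (fun hb => hq ?_ s hs)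
  rw [← h2, hb]
  simp

theorem Ctx.Tr.loop (hC : C.Good) {c : Test} (hc : c.ok = true) (Inv : ℕ → View → ℕ → Prop)
    {i t : ℕ} (h : Inv i a t)
    (step : ∀ i a t, Inv i a t → c.val C a.v → C.Tr p a fun a' u => ∃ j < i, Inv j a' (t + u))
    (fin : ∀ i a t, Inv i a t → ¬ c.val C a.v → Q a t) :
    C.Tr (.loop c p) a fun a' u => Q a' (t + u) := fun s hs => by
  refine Wp.loop (Q := fun s' t => ∃ a', C.Rel s' a' ∧ Q a' t)
    (fun i s t => ∃ a, C.Rel s a ∧ Inv i a t) ?_ ⟨a, hs, h⟩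
  rintro i s t ⟨a, hs, hI⟩
  obtain ⟨b, h1, h2⟩ := Test.eval_ok hC hs hc
  cases b with
  | true =>
    refine Or.inr ⟨h1, (step i a t hI (h2.1 rfl) s hs).mono ?_⟩
    rintro s' u ⟨a', h3, j, h4, h5⟩
    exact ⟨j, h4, a', h3, h5⟩
  | false =>
    refine Or.inl ⟨h1, a, hs, fin i a t hI fun h => ?_⟩
    simpa using h2.2 h

theorem Ctx.Tr.loop₀ (hC : C.Good) {c : Test} (hc : c.ok = true) (Inv : ℕ → View → ℕ → Prop)
    (i : ℕ) (h : Inv i a 0)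
    (step : ∀ i a t, Inv i a t → c.val C a.v → C.Tr p a fun a' u => ∃ j < i, Inv j a' (t + u))
    (fin : ∀ i a t, Inv i a t → ¬ c.val C a.v → Q a t) : C.Tr (.loop c p) a Q := by
  simpa using Ctx.Tr.loop (Q := Q) hC hc Inv h step fin

/-- The relation itself records that the numeric registers are below `X`; this makes the bounds
available in proofs that only see the virtual state. -/
theorem Ctx.Tr.bound (h : (∀ i < 30, a.v i < C.X) → C.Tr p a Q) : C.Tr p a Q :=
  fun s hs => h hs.vX s hs

theorem Ctx.Tr.assign (hC : C.Good) {r : ℕ} {e : Expr} (hr : r < 30) (he : e.ok = true)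
    (hx : e.val C a.v < C.X) (h : Q (a.setV r (e.val C a.v)) 0) :
    C.Tr (.assign r e) a Q := fun _ hs =>
  Wp.assign (Expr.eval_ok hC hs he) ⟨_, hs.setV hr hx, h⟩

/-- Copy an element register. -/
def copyE (r r' : ℕ) : Prog :=
  .assign (40 + 2 * r) (.reg (40 + 2 * r')) ;; .assign (41 + 2 * r) (.reg (41 + 2 * r'))

theorem Ctx.Tr.copyE {r r' : ℕ} (hr : r < 4) (hr' : r' < 4)
    (h : Q (a.setE r (a.e r')) 0) :
    C.Tr (copyE r r') a Q := fun s hs => by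
  have h2 := hs.setE hr (a.e r')
  refine Wp.seq (Wp.assign (Expr.eval_reg (hs.e r' hr').1) (Wp.assign (Expr.eval_reg
    (w := (a.e r').2) ?_) ⟨_, h2, h⟩))
  simp only
  rw [Function.update_of_ne (by omega)]
  exact (hs.e r' hr').2

/-- Address of buffer cell `o` of slot `σ`. -/
def bufAddr (σ o : Expr) : Expr :=
  .add (.mul σ (.add (.reg 30) (.const 1))) (.add o (.const 1))

/-- Address of the header of slot `σ`. -/
def hdAddr (σ : Expr) : Expr := .mul σ (.add (.reg 30) (.const 1))

theorem Ctx.Good.slot_lt (hC : C.Good) {σ o : ℕ} (hσ : σ < C.f + 3) (ho : o < C.β) :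
    σ * (C.β + 1) + (o + 1) < C.H + 10 := by
  have h1 := hC.slots
  have h2 : (σ + 1) * (C.β + 1) ≤ (C.f + 3) * (C.β + 1) := Nat.mul_le_mul_right _ (by omega)
  have h3 := Nat.succ_mul σ (C.β + 1)
  simp only [Nat.succ_eq_add_one] at h3
  omega

theorem eval_hdAddr (hC : C.Good) {s : State} (hs : C.Rel s a) {σ : Expr} {m : ℕ}
    (hσ : σ.eval C.P s = some (.num m)) (hm : m < C.f + 3) :
    (hdAddr σ).eval C.P s = some (.num (m * (C.β + 1))) := by
  have h1 := hC.slot_lt hm (o := 0) hC.β_pos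
  have h2 := hC.X_le
  have h3 := hC.pow_le (n := 2) (by omega)
  have h4 := hC.X64
  have h5 := hC.HX
  have h6 := hC.βX
  have h7 : C.X * 2 ≤ C.X ^ 2 := by nlinarith
  exact Expr.eval_mul hσ (Expr.eval_add (Expr.eval_reg hs.cβ) (Expr.eval_const (by omega))
    (by omega)) (by omega)

theorem eval_bufAddr (hC : C.Good) {s : State} (hs : C.Rel s a) {σ o : Expr} {m n : ℕ}
    (hσ : σ.eval C.P s = some (.num m)) (ho : o.eval C.P s = some (.num n)) (hm : m < C.f + 3)
    (hn : n < C.β) : (bufAddr σ o).eval C.P s = some (.num (m * (C.β + 1) + (n + 1))) := by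
  have h1 := hC.slot_lt hm hn
  have h2 := hC.X_le
  have h3 := hC.pow_le (n := 2) (by omega)
  have h4 := hC.X64
  have h5 := hC.HX
  have h6 := hC.βX
  have h7 : C.X * 2 ≤ C.X ^ 2 := by nlinarith
  exact Expr.eval_add (eval_hdAddr hC hs hσ hm) (Expr.eval_add ho (Expr.eval_const (by omega))
    (by omega)) (by omega)

/-- Load buffer cell `o` of slot `σ` into element register `r`. -/
def loadE (r : ℕ) (σ o : Expr) : Prog := cellLoad (40 + 2 * r) (41 + 2 * r) (bufAddr σ o)

theorem Ctx.Tr.loadE (hC : C.Good) {r : ℕ} {σ o : Expr} (hr : r < 4) (hσ : σ.ok = true)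
    (ho : o.ok = true) (hm : σ.val C a.v < C.f + 3) (hn : o.val C a.v < C.β)
    (h : Q (a.setE r (a.buf (σ.val C a.v) (o.val C a.v))) 0) :
    C.Tr (loadE r σ o) a Q := fun s hs => by
  refine cellLoad_wp hC (hC.slot_lt hm hn) (eval_bufAddr hC hs (Expr.eval_ok hC hs hσ)
    (Expr.eval_ok hC hs ho) hm hn) hs.cH (by omega) ?_
  have h1 := (hs.temp (r := 34) (.num (σ.val C a.v * (C.β + 1) + (o.val C a.v + 1)))
    (by omega)).setE hr (a.buf (σ.val C a.v) (o.val C a.v))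
  rw [← hs.buf _ hm _ hn] at h1
  exact ⟨_, h1, by rw [hs.buf _ hm _ hn]; exact h⟩

/-- Store element register `r` into buffer cell `o` of slot `σ`. -/
def storeE (r : ℕ) (σ o : Expr) : Prog := cellStore (40 + 2 * r) (41 + 2 * r) (bufAddr σ o)

theorem Ctx.Tr.storeE (hC : C.Good) {r : ℕ} {σ o : Expr} (hr : r < 4) (hσ : σ.ok = true)
    (ho : o.ok = true) (hm : σ.val C a.v < C.f + 3) (hn : o.val C a.v < C.β)
    (h : Q (a.setBuf (σ.val C a.v)
      (Function.update (a.buf (σ.val C a.v)) (o.val C a.v) (a.e r))) 0) :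
    C.Tr (storeE r σ o) a Q := fun s hs => by
  refine cellStore_wp hC (hC.slot_lt hm hn) (eval_bufAddr hC hs (Expr.eval_ok hC hs hσ)
    (Expr.eval_ok hC hs ho) hm hn) hs.cH (by omega) (by omega) ?_
  have h1 := (hs.temp (r := 34) (.num (σ.val C a.v * (C.β + 1) + (o.val C a.v + 1)))
    (by omega)).setBuf (σ := σ.val C a.v) hn (a.e r)
  rw [(hs.e r hr).1, (hs.e r hr).2]
  exact ⟨_, h1, h⟩

/-- Load the header of slot `σ` into the registers `r` and `r'`. -/
def loadH (r r' : ℕ) (σ : Expr) : Prog := cellLoad r r' (hdAddr σ)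

theorem Ctx.Tr.loadH (hC : C.Good) {r r' : ℕ} {σ : Expr} (hr : r < 30) (hr' : r' < 30)
    (hσ : σ.ok = true) (hm : σ.val C a.v < C.f + 3)
    (h : Q ((a.setV r (a.hd (σ.val C a.v)).1).setV r' (a.hd (σ.val C a.v)).2) 0) :
    C.Tr (loadH r r' σ) a Q := fun s hs => by
  refine cellLoad_wp hC (lt_of_le_of_lt (by omega) (hC.slot_lt hm hC.β_pos))
    (eval_hdAddr hC hs (Expr.eval_ok hC hs hσ) hm) hs.cH (by omega) ?_
  have h1 := ((hs.temp (r := 34) (.num (σ.val C a.v * (C.β + 1)))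
    (by omega)).setV hr (hs.hdX _ hm).1).setV hr' (hs.hdX _ hm).2
  rw [hs.hd _ hm]
  exact ⟨_, h1, h⟩

/-- Store the registers `r` and `r'` into the header of slot `σ`. -/
def storeH (r r' : ℕ) (σ : Expr) : Prog := cellStore r r' (hdAddr σ)

theorem Ctx.Tr.storeH (hC : C.Good) {r r' : ℕ} {σ : Expr} (hr : r < 30) (hr' : r' < 30)
    (hσ : σ.ok = true) (hm : σ.val C a.v < C.f + 3)
    (h : Q (a.setHd (σ.val C a.v) (a.v r, a.v r')) 0) :
    C.Tr (storeH r r' σ) a Q := fun s hs => by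
  refine cellStore_wp hC (lt_of_le_of_lt (by omega) (hC.slot_lt hm hC.β_pos))
    (eval_hdAddr hC hs (Expr.eval_ok hC hs hσ) hm) hs.cH (by omega) (by omega) ?_
  have h1 := (hs.temp (r := 34) (.num (σ.val C a.v * (C.β + 1)))
    (by omega)).setHd (σ := σ.val C a.v) (hs.vX r hr) (hs.vX r' hr')
  rw [hs.v r hr, hs.v r' hr']
  exact ⟨_, h1, h⟩

/-! ### Transfer of blocks between slots and files -/

/-- Select or replace a component of a cell. -/
def Cell.get (b : Bool) (c : Cell) : Word := if b then c.1 else c.2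

def Cell.put (b : Bool) (c : Cell) (w : Word) : Cell := if b then (w, c.2) else (c.1, w)

/-- Disk block with one component of block `j` of file `φ`. -/
def blkAddr (b : Bool) (φ j : Expr) : Expr :=
  .add (.add (.reg 33) (.mul (.const 2) (.add (.mul (.const 4) j) φ)))
    (.const (if b then 0 else 1))

def half (b : Bool) : ℕ := if b then 36 else 37

/-- Copy the scratch area into one component of the buffer of slot `σ`. -/
def copyIn (b : Bool) (σ : Expr) : Prog :=
  .assign 35 (.const 0) ;;
  .loop (.lt (.reg 35) (.reg 30))
    (cellLoad 36 37 (bufAddr σ (.reg 35)) ;; .assign (half b) (.mem (.reg 35)) ;;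
      cellStore 36 37 (bufAddr σ (.reg 35)) ;; .assign 35 (.add (.reg 35) (.const 1)))

/-- Copy one component of the buffer of slot `σ` into the scratch area. -/
def copyOut (b : Bool) (σ : Expr) : Prog :=
  .assign 35 (.const 0) ;;
  .loop (.lt (.reg 35) (.reg 30))
    (cellLoad 36 37 (bufAddr σ (.reg 35)) ;; .store (.reg 35) (.reg (half b)) ;;
      .assign 35 (.add (.reg 35) (.const 1)))

/-- Only the offsets below `β` of a buffer exist on the machine, so the buffer functions may be
changed freely elsewhere. -/
theorem Ctx.Rel.buf_ext {s : State} (h : C.Rel s a) {b : ℕ → ℕ → Cell}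
    (hb : ∀ σ, ∀ o < C.β, b σ o = a.buf σ o) : C.Rel s { a with buf := b } :=
  { h with buf := fun σ hσ o ho => by rw [h.buf σ hσ o ho]; exact (hb σ o ho).symm }

theorem copyIn_wp (hC : C.Good) {b : Bool} {σ : Expr} (hσ : σ.ok = true)
    (hm : σ.val C a.v < C.f + 3) {s : State} (hs : C.Rel s a) {R : State → ℕ → Prop}
    (hR : ∀ s', C.Rel s' (a.setBuf (σ.val C a.v)
      fun o => Cell.put b (a.buf (σ.val C a.v) o) (s.mem o)) → R s' 0) :
    Wp C.P (copyIn b σ) s R := by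
  have hX := hC.X64
  have hXW := hC.X_le
  have hβ := hC.βX
  have hM := hC.memory
  have hBβ := hC.β_le
  set m := σ.val C a.v with hmdef
  refine Wp.seq (Wp.assign (Expr.eval_const (by omega)) ?_)
  simp only [zero_add]
  -- Reshapes the postcondition into the form `t + u` of `Wp.loop`, with initial cost `t = 0`.
  rw [← funext₂ fun s' u => congrArg (R s') (Nat.zero_add u)]
  refine Wp.loop (Q := R) (fun i s' t => t = 0 ∧ ∃ o, i + o = C.β ∧
    s'.reg 35 = .num o ∧ (∀ x < C.P.B, s'.mem x = s.mem x) ∧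
    C.Rel s' (a.setBuf m
      fun x => if x < o then Cell.put b (a.buf m x) (s.mem x) else a.buf m x))
    ?_ (i := C.β) ⟨rfl, 0, by omega, by simp, by simp, ?_⟩
  · rintro i s' t ⟨rfl, o, hio, h35, hmem, hrel⟩
    rw [Test.eval_lt (Expr.eval_reg h35) (Expr.eval_reg hrel.cβ)]
    by_cases ho : o < C.β
    · refine Or.inr ⟨by simp [ho], ?_⟩
      have ha := eval_bufAddr hC hrel (Expr.eval_ok hC hrel hσ) (Expr.eval_reg h35) hm ho
      refine Wp.seq (cellLoad_wp hC (hC.slot_lt hm ho) ha hrel.cH (by omega) ?_)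
      have hcell := hrel.buf m hm o ho
      simp only [View.setBuf_buf, Function.update_self, lt_irrefl, if_false] at hcell
      rw [hcell]
      set s₁ : State := { s' with reg := update₂ (Function.update s'.reg 34
        (.num (m * (C.β + 1) + (o + 1)))) 36 37 (a.buf m o) } with hs₁
      have h35₁ : s₁.reg 35 = .num o := by simp [hs₁, h35, update₂]
      have hrel₁ := ((hrel.temp (r := 34) (.num (m * (C.β + 1) + (o + 1))) (by omega)).temp
        (r := 36) (a.buf m o).1 (by omega)).temp (r := 37) (a.buf m o).2 (by omega)
      change C.Rel s₁ _ at hrel₁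
      refine Wp.seq (Wp.assign (Expr.eval_mem (Expr.eval_reg h35₁) (by omega) (hmem o (by omega)))
        ?_)
      set s₂ : State := { s₁ with reg := Function.update s₁.reg (half b) (s.mem o) } with hs₂
      have hrel₂ := hrel₁.temp (r := half b) (s.mem o) (by unfold half; split_ifs <;> omega)
      change C.Rel s₂ _ at hrel₂
      have h35₂ : s₂.reg 35 = .num o := by
        simp only [hs₂]
        rw [Function.update_of_ne (by unfold half; split_ifs <;> omega)]
        exact h35₁
      have ha₂ := eval_bufAddr hC hrel₂ (Expr.eval_ok hC hrel₂ hσ) (Expr.eval_reg h35₂) hm ho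
      refine Wp.seq (cellStore_wp hC (hC.slot_lt hm ho) ha₂ hrel₂.cH (by omega) (by omega) ?_)
      have hput : (s₂.reg 36, s₂.reg 37) = Cell.put b (a.buf m o) (s.mem o) := by
        cases b <;> simp [hs₂, hs₁, half, Cell.put, update₂]
      rw [hput]
      have hrel₃ := ((hrel₂.temp (r := 34) (.num (m * (C.β + 1) + (o + 1))) (by omega)).setBuf
        (σ := m) ho (Cell.put b (a.buf m o) (s.mem o)))
      refine Wp.assign (Expr.eval_add (Expr.eval_reg (w := .num o) ?_)
        (Expr.eval_const (by omega)) (by omega)) ⟨i - 1, by omega, rfl, o + 1, by omega, ?_, ?_, ?_⟩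
      · rw [C.setCell_reg _ _ _ (by omega)]
        simp [h35₂]
      · simp
      · intro x hx
        simp only
        rw [C.setCell_mem _ _ _ hx]
        exact hmem x hx
      · refine ((hrel₃.temp (r := 35) (.num (o + 1)) (by omega))).buf_ext ?_
        intro σ' x hx
        by_cases hσ' : σ' = m
        · subst hσ'
          simp only [View.setBuf_buf, Function.update_self, Function.update_apply]
          by_cases hxo : x = o
          · simp [hxo]
          · simp only [hxo, if_false]
            congr 1
            simp only [eq_iff_iff]
            omega
        · simp [hσ']
    · refine Or.inl ⟨by simp [ho], hR _ (hrel.buf_ext ?_)⟩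
      intro σ' x hx
      by_cases hσ' : σ' = m
      · subst hσ'
        simp only [View.setBuf_buf, Function.update_self]
        rw [if_pos (by omega)]
      · simp [hσ']
  · refine (hs.temp (r := 35) (.num 0) (by omega)).buf_ext ?_
    intro σ' x hx
    by_cases hσ' : σ' = m
    · subst hσ'
      simp
    · simp [hσ']

theorem copyOut_wp (hC : C.Good) {b : Bool} {σ : Expr} (hσ : σ.ok = true)
    (hm : σ.val C a.v < C.f + 3) {s : State} (hs : C.Rel s a) {R : State → ℕ → Prop}
    (hR : ∀ s', C.Rel s' a → (∀ o < C.β, s'.mem o = Cell.get b (a.buf (σ.val C a.v) o)) →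
      R s' 0) :
    Wp C.P (copyOut b σ) s R := by
  have hX := hC.X64
  have hXW := hC.X_le
  have hβ := hC.βX
  have hM := hC.memory
  have hBβ := hC.β_le
  set m := σ.val C a.v with hmdef
  refine Wp.seq (Wp.assign (Expr.eval_const (by omega)) ?_)
  simp only [zero_add]
  rw [← funext₂ fun s' u => congrArg (R s') (Nat.zero_add u)]
  refine Wp.loop (Q := R) (fun i s' t => t = 0 ∧ ∃ o, i + o = C.β ∧
    s'.reg 35 = .num o ∧ (∀ x < o, s'.mem x = Cell.get b (a.buf m x)) ∧ C.Rel s' a)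
    ?_ (i := C.β) ⟨rfl, 0, by omega, by simp, by simp, hs.temp (r := 35) (.num 0) (by omega)⟩
  rintro i s' t ⟨rfl, o, hio, h35, hmem, hrel⟩
  rw [Test.eval_lt (Expr.eval_reg h35) (Expr.eval_reg hrel.cβ)]
  by_cases ho : o < C.β
  · refine Or.inr ⟨by simp [ho], ?_⟩
    have ha := eval_bufAddr hC hrel (Expr.eval_ok hC hrel hσ) (Expr.eval_reg h35) hm ho
    refine Wp.seq (cellLoad_wp hC (hC.slot_lt hm ho) ha hrel.cH (by omega) ?_)
    have hcell := hrel.buf m hm o ho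
    rw [hcell]
    set s₁ : State := { s' with reg := update₂ (Function.update s'.reg 34
      (.num (m * (C.β + 1) + (o + 1)))) 36 37 (a.buf m o) } with hs₁
    have h35₁ : s₁.reg 35 = .num o := by simp [hs₁, h35, update₂]
    have hrel₁ := ((hrel.temp (r := 34) (.num (m * (C.β + 1) + (o + 1))) (by omega)).temp
      (r := 36) (a.buf m o).1 (by omega)).temp (r := 37) (a.buf m o).2 (by omega)
    change C.Rel s₁ _ at hrel₁
    have hw : s₁.reg (half b) = Cell.get b (a.buf m o) := by
      cases b <;> simp [hs₁, half, Cell.get, update₂]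
    refine Wp.seq (Wp.store (Expr.eval_reg h35₁) (by omega) (Expr.eval_reg hw) (Wp.assign
      (Expr.eval_add (Expr.eval_reg h35₁) (Expr.eval_const (by omega)) (by omega))
      ⟨i - 1, by omega, rfl, o + 1, by omega, by simp, ?_, ?_⟩))
    · intro x hx
      simp only [Function.update_apply]
      split_ifs with hxo
      · rw [hxo]
      · exact hmem x (by omega)
    · refine hrel₁.congr (fun r hr => ?_) (fun x hx => ?_) rfl
      · exact Function.update_of_ne (by omega) _ _
      · exact Function.update_of_ne (by omega) _ _
  · refine Or.inl ⟨by simp [ho], hR _ hrel fun x hx => hmem x (by omega)⟩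

/-- Read one component of block `j` of file `φ` into slot `σ`. -/
def loadHalf (b : Bool) (σ φ j : Expr) : Prog :=
  .readBlock (blkAddr b φ j) (.const 0) ;; copyIn b σ

/-- Read block `j` of file `φ` into slot `σ`. -/
def loadBlk (σ φ j : Expr) : Prog := loadHalf true σ φ j ;; loadHalf false σ φ j

theorem div_mod_of_lt {β j o : ℕ} (ho : o < β) : (j * β + o) / β = j ∧ (j * β + o) % β = o := by
  have hb : 0 < β := by omega
  constructor
  · rw [mul_comm, Nat.mul_add_div hb, Nat.div_eq_of_lt ho, add_zero]
  · rw [mul_comm, Nat.mul_add_mod, Nat.mod_eq_of_lt ho]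

theorem blkAddr_val {b : Bool} {φ j : Expr} {v : ℕ → ℕ} : (blkAddr b φ j).val C v =
    C.base + 2 * (4 * j.val C v + φ.val C v) + (if b then 0 else 1) := by
  simp [blkAddr, Expr.val]

theorem blkAddr_ok {b : Bool} {φ j : Expr} (h : (blkAddr true φ j).ok = true) :
    (blkAddr b φ j).ok = true := by
  cases b
  · exact h
  · exact h

/-- A block of `β ≤ B` cells has `2β` words and may not fit into one disk block. Hence its first and
its second components occupy two neighbouring disk blocks, and each of them passes through the
scratch block separately. -/
theorem Ctx.Tr.loadHalf (hC : C.Good) {b : Bool} {σ φ j : Expr} (hσ : σ.ok = true)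
    (hj : (blkAddr true φ j).ok = true) (hm : σ.val C a.v < C.f + 3) (hφ : φ.val C a.v < 4)
    (h : Q (a.setBuf (σ.val C a.v) fun o => Cell.put b
      (a.buf (σ.val C a.v) o) (Cell.get b (a.fl (φ.val C a.v) (j.val C a.v * C.β + o)))) 1) :
    C.Tr (loadHalf b σ φ j) a Q := fun s hs => by
  have hX := hC.X64
  have hXW := hC.X_le
  have hM := hC.memory
  have hBβ := hC.β_le
  refine Wp.seq ⟨1, _, Exec.readBlock (Expr.eval_ok hC hs (blkAddr_ok hj))
    (Expr.eval_const (by omega)) (by omega), ?_⟩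
  have hs' : C.Rel (s.readBlock C.P ((blkAddr b φ j).val C a.v) 0) a :=
    hs.congr (fun _ _ => rfl) (fun i hi => by simp [State.readBlock]; omega) rfl
  refine copyIn_wp hC hσ hm hs' fun s' hs'' => ⟨_, hs''.buf_ext (b := Function.update a.buf
    (σ.val C a.v) (fun o => Cell.put b (a.buf (σ.val C a.v) o)
      (Cell.get b (a.fl (φ.val C a.v) (j.val C a.v * C.β + o))))) ?_, h⟩
  intro σ' o ho
  by_cases hσ' : σ' = σ.val C a.v
  · subst hσ'
    simp only [Function.update_self]
    have hdm := div_mod_of_lt (j := j.val C a.v) ho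
    have hfl := hs.fl (φ.val C a.v) hφ (j.val C a.v * C.β + o)
    rw [hdm.1, hdm.2] at hfl
    simp only [State.readBlock, View.setBuf_buf, Function.update_self]
    rw [if_pos (by omega), blkAddr_val]
    cases b
    · simp [Cell.get, hfl.2]
    · simp [Cell.get, hfl.1]
  · simp [hσ']

theorem Ctx.Tr.loadBlk (hC : C.Good) {σ φ j : Expr} (hσ : σ.ok = true)
    (hj : (blkAddr true φ j).ok = true) (hm : σ.val C a.v < C.f + 3) (hφ : φ.val C a.v < 4)
    (h : Q (a.setBuf (σ.val C a.v)
      fun o => a.fl (φ.val C a.v) (j.val C a.v * C.β + o)) 2) :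
    C.Tr (loadBlk σ φ j) a Q := by
  refine Ctx.Tr.seq (Ctx.Tr.loadHalf hC hσ hj hm hφ (Ctx.Tr.loadHalf hC hσ hj hm hφ ?_))
  simpa [Cell.put, Cell.get] using h

/-- Write one component of the buffer of slot `σ` into block `j` of file `φ`. -/
def saveHalf (b : Bool) (σ φ j : Expr) : Prog :=
  copyOut b σ ;; .writeBlock (blkAddr b φ j) (.const 0)

/-- Write the buffer of slot `σ` into block `j` of file `φ`. -/
def saveBlk (σ φ j : Expr) : Prog := saveHalf true σ φ j ;; saveHalf false σ φ j

/-- For `φ < 4` the address `base + 2 (4 j + φ)`, plus 0 or 1 for the component, determines block,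
file and component, and it is not below `base`. So nothing else is overwritten, in particular not
the input. -/
theorem Ctx.Tr.saveHalf (hC : C.Good) {b : Bool} {σ φ j : Expr} (hσ : σ.ok = true)
    (hj : (blkAddr true φ j).ok = true) (hm : σ.val C a.v < C.f + 3) (hφ : φ.val C a.v < 4)
    (h : Q (a.setFl (φ.val C a.v) fun p =>
      if p / C.β = j.val C a.v then Cell.put b (a.fl (φ.val C a.v) p)
        (Cell.get b (a.buf (σ.val C a.v) (p % C.β))) else a.fl (φ.val C a.v) p) 1) :
    C.Tr (saveHalf b σ φ j) a Q := fun s hs => by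
  have hX := hC.X64
  have hXW := hC.X_le
  have hM := hC.memory
  have hBβ := hC.β_le
  refine Wp.seq (copyOut_wp hC hσ hm hs fun s' hs' hmem => ⟨1, _, Exec.writeBlock
    (Expr.eval_ok hC hs' (blkAddr_ok hj)) (Expr.eval_const (by omega)) (by omega), _, ?_, h⟩)
  rw [blkAddr_val]
  exact { hs' with
    fl := by
      intro φ' hφ' p
      have hp := Nat.mod_lt p hC.β_pos
      have h1 := hs'.fl φ' hφ' p
      simp only [State.writeBlock, zero_add]
      by_cases hφφ : φ' = φ.val C a.v
      · subst hφφ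
        simp only [View.setFl_fl, Function.update_self]
        by_cases hpj : p / C.β = j.val C a.v
        · rw [if_pos hpj]
          cases b
          · rw [if_neg (by simp; omega), if_pos (by simp [hpj]; omega)]
            exact ⟨h1.1, hmem _ hp⟩
          · rw [if_pos (by simp [hpj]; omega), if_neg (by simp [hpj])]
            exact ⟨hmem _ hp, h1.2⟩
        · rw [if_neg hpj, if_neg, if_neg]
          · exact h1
          · cases b <;> simp <;> omega
          · cases b <;> simp <;> omega
      · simp only [View.setFl_fl, Function.update_of_ne hφφ]
        rw [if_neg, if_neg]
        · exact h1
        · cases b <;> simp <;> omega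
        · cases b <;> simp <;> omega
    inp := by
      intro i hi
      ext o
      simp only [State.writeBlock]
      rw [if_neg (by omega), hs'.inp i hi] }

theorem Ctx.Tr.saveBlk (hC : C.Good) {σ φ j : Expr} (hσ : σ.ok = true)
    (hj : (blkAddr true φ j).ok = true) (hm : σ.val C a.v < C.f + 3) (hφ : φ.val C a.v < 4)
    (h : Q (a.setFl (φ.val C a.v) fun p =>
      if p / C.β = j.val C a.v then a.buf (σ.val C a.v) (p % C.β)
      else a.fl (φ.val C a.v) p) 2) :
    C.Tr (saveBlk σ φ j) a Q := by
  refine Ctx.Tr.seq (Ctx.Tr.saveHalf hC hσ hj hm hφ (Ctx.Tr.saveHalf hC hσ hj hm hφ ?_))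
  simp only [View.setFl_fl, View.setFl_v, View.setFl_buf, Function.update_self, View.setFl_setFl]
  convert h using 3 with p
  split_ifs <;> simp [Cell.put, Cell.get]

end

/-! ### Counting inverted pairs in colored sequences -/

/-- A colored element: `true` is red. -/
abbrev El := Bool × ℝ

/-- Pairs to be counted: a red element followed by a smaller blue element. -/
noncomputable def inv (x y : El) : Bool := x.1 && !y.1 && decide (y.2 < x.2)

/-- Number of inverted pairs of an element of `l₁` with an element of `l₂`. -/
noncomputable def crs (l₁ l₂ : List El) : ℕ := (l₁.map fun x => l₂.countP (inv x)).sum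

/-- Number of inverted pairs in a sequence. -/
noncomputable def cnt : List El → ℕ
  | [] => 0
  | x :: l => l.countP (inv x) + cnt l

/-- Number of inverted pairs of elements of different lists. -/
noncomputable def Xc : List (List El) → ℕ
  | [] => 0
  | r :: rs => crs r rs.flatten + Xc rs

/-- Number of red elements. -/
def reds (l : List El) : ℕ := l.countP fun x => x.1

/-- Number of blue elements. -/
def blues (l : List El) : ℕ := l.countP fun x => !x.1

/-- Number of red elements above `z`. -/
noncomputable def above (z : ℝ) (l : List El) : ℕ := l.countP fun x => x.1 && decide (z < x.2)

@[simp] theorem crs_nil_left (l : List El) : crs [] l = 0 := rfl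

@[simp] theorem crs_nil_right (l : List El) : crs l [] = 0 := by simp [crs]

theorem crs_cons_left (x : El) (l₁ l₂ : List El) :
    crs (x :: l₁) l₂ = l₂.countP (inv x) + crs l₁ l₂ := by simp [crs]

theorem crs_cons_right (y : El) (l₁ l₂ : List El) :
    crs l₁ (y :: l₂) = l₁.countP (inv · y) + crs l₁ l₂ := by
  induction l₁ with
  | nil => simp
  | cons x l ih =>
    rw [crs_cons_left, crs_cons_left, ih, List.countP_cons, List.countP_cons]
    omega

theorem crs_append_left (l₁ l₂ l : List El) : crs (l₁ ++ l₂) l = crs l₁ l + crs l₂ l := by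
  simp [crs]

theorem crs_append_right (l l₁ l₂ : List El) : crs l (l₁ ++ l₂) = crs l l₁ + crs l l₂ := by
  induction l with
  | nil => simp
  | cons x l ih => rw [crs_cons_left, crs_cons_left, crs_cons_left, ih, List.countP_append]; omega

theorem crs_perm {l₁ l₂ l₁' l₂' : List El} (h₁ : l₁.Perm l₁') (h₂ : l₂.Perm l₂') :
    crs l₁ l₂ = crs l₁' l₂' := by
  unfold crs
  rw [(h₁.map _).sum_eq]
  congr 2
  ext x
  exact h₂.countP_eq _

theorem crs_singleton (l : List El) (y : El) : crs l [y] = l.countP (inv · y) := by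
  simp [crs_cons_right]

theorem crs_red (l : List El) {y : El} (hy : y.1 = true) : crs l [y] = 0 := by
  rw [crs_singleton]
  simp [inv, hy]

theorem crs_blue (l : List El) {y : El} (hy : y.1 = false) : crs l [y] = above y.2 l := by
  rw [crs_singleton]
  simp [inv, hy, above]

theorem cnt_append (l₁ l₂ : List El) : cnt (l₁ ++ l₂) = cnt l₁ + crs l₁ l₂ + cnt l₂ := by
  induction l₁ with
  | nil => simp [cnt]
  | cons x l ih =>
    simp only [List.cons_append, cnt, ih, crs_cons_left, List.countP_append]
    omega

theorem cnt_concat (l : List El) (x : El) : cnt (l ++ [x]) = cnt l + crs l [x] := by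
  simp [cnt_append, cnt]

theorem Xc_append (A B : List (List El)) :
    Xc (A ++ B) = Xc A + crs A.flatten B.flatten + Xc B := by
  induction A with
  | nil => simp [Xc]
  | cons r A ih =>
    simp only [List.cons_append, Xc, ih, List.flatten_append, List.flatten_cons, crs_append_left,
      crs_append_right]
    omega

theorem Xc_singleton (r : List El) : Xc [r] = 0 := by simp [Xc]

/-- Pairs of different lists are either inside the group `G` or involve a list outside of it. The
latter depend only on the multiset of elements of `G`, so merging the group into one list costs
exactly the pairs inside. -/
theorem Xc_merge (A G B : List (List El)) {r : List El} (h : r.Perm G.flatten) :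
    Xc (A ++ (G ++ B)) = Xc (A ++ [r] ++ B) + Xc G := by
  simp only [Xc_append, Xc_singleton, List.flatten_append, crs_append_right, crs_append_left,
    List.flatten_singleton]
  rw [crs_perm h (List.Perm.refl B.flatten), crs_perm (List.Perm.refl A.flatten) h]
  omega

/-- Pairs inside the last list are not part of `Xc`, so the place of the new element does not
matter; only its pairs with earlier lists are new. -/
theorem Xc_insert (A : List (List El)) {r r' : List El} {x : El} (h : r'.Perm (x :: r)) :
    Xc (A ++ [r']) = Xc (A ++ [r]) + crs A.flatten [x] := by
  simp only [Xc_append, Xc_singleton, List.flatten_singleton]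
  rw [crs_perm (List.Perm.refl _) h, crs_cons_right, crs_singleton]
  omega

theorem crs_le_of_blues_eq_zero {l₁ l₂ : List El} (h : blues l₂ = 0) : crs l₁ l₂ = 0 := by
  induction l₂ with
  | nil => simp
  | cons y l ih =>
    simp only [blues, List.countP_cons] at h ih
    have hy : y.1 = true := by
      by_contra hy
      simp [hy] at h
    rw [crs_cons_right, ih (by omega), ← crs_singleton, crs_red _ hy]

theorem Xc_eq_zero {A : List (List El)} (h : blues A.flatten = 0) : Xc A = 0 := by
  induction A with
  | nil => rfl
  | cons r A ih =>
    simp only [List.flatten_cons, blues, List.countP_append] at h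
    have h' : blues A.flatten = 0 := by unfold blues; omega
    rw [Xc, ih h', crs_le_of_blues_eq_zero h']

theorem reds_append (l₁ l₂ : List El) : reds (l₁ ++ l₂) = reds l₁ + reds l₂ := by
  simp [reds]

theorem blues_append (l₁ l₂ : List El) : blues (l₁ ++ l₂) = blues l₁ + blues l₂ := by
  simp [blues]

theorem above_append (z : ℝ) (l₁ l₂ : List El) :
    above z (l₁ ++ l₂) = above z l₁ + above z l₂ := by
  simp [above]

theorem above_perm (z : ℝ) {l₁ l₂ : List El} (h : l₁.Perm l₂) : above z l₁ = above z l₂ :=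
  h.countP_eq _

theorem blues_perm {l₁ l₂ : List El} (h : l₁.Perm l₂) : blues l₁ = blues l₂ := h.countP_eq _

theorem reds_add_blues (l : List El) : reds l + blues l = l.length := by
  rw [List.length_eq_countP_add_countP (fun x : El => x.1) (l := l)]
  simp [reds, blues]

/-- Reversal of both orders and exchange of the colors. -/
def El.neg (x : El) : El := (!x.1, -x.2)

theorem inv_neg (x y : El) : inv x.neg y.neg = inv y x := by
  simp [inv, El.neg, Bool.and_comm]

/-- Both orders and the colors are reversed together, so a red element before a smaller blue one
becomes such a pair again, with exchanged roles. Through this symmetry one scan program thins out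
either color. -/
theorem cnt_reverse_neg (l : List El) : cnt (l.map El.neg).reverse = cnt l := by
  induction l with
  | nil => rfl
  | cons x l ih =>
    rw [List.map_cons, List.reverse_cons, cnt_concat, ih, crs_singleton, cnt, add_comm,
      List.countP_reverse, List.countP_map]
    congr 2
    ext y
    simp [inv_neg]

theorem reds_reverse_neg (l : List El) : reds (l.map El.neg).reverse = blues l := by
  simp only [reds, blues, List.countP_reverse, List.countP_map]
  rfl

/-! ### Sorted runs -/

/-- Ascending keys. -/
def Asc (l : List El) : Prop := l.Pairwise fun x y => x.2 ≤ y.2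

/-- Ascending runs of length `L`, the last one may be shorter. -/
def IsRuns (L : ℕ) : List (List El) → Prop
  | [] => True
  | r :: rs => Asc r ∧ 0 < r.length ∧ r.length ≤ L ∧ (rs ≠ [] → r.length = L) ∧ IsRuns L rs

/-- Only the last run may be short, so run `s` starts at position `s * L`; past the end both sides
are empty. -/
theorem IsRuns.getD {L : ℕ} {Rs : List (List El)} (h : IsRuns L Rs) (s : ℕ) :
    Rs.getD s [] = (Rs.flatten.drop (s * L)).take L := by
  induction Rs generalizing s with
  | nil => simp
  | cons r rs ih =>
    obtain ⟨-, -, h1, h2, h3⟩ := h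
    by_cases hrs : rs = []
    · subst hrs
      cases s with
      | zero => simp [List.take_of_length_le h1]
      | succ s =>
        have : L ≤ (s + 1) * L := Nat.le_mul_of_pos_left _ (by omega)
        simp [List.drop_eq_nil_of_le (show r.length ≤ (s + 1) * L by omega)]
    · have hL := h2 hrs
      cases s with
      | zero => simp [← hL]
      | succ s =>
        have h0 : r.drop ((s + 1) * L) = [] :=
          List.drop_eq_nil_of_le (by rw [hL]; exact Nat.le_mul_of_pos_left _ (by omega))
        rw [List.getD_cons_succ, ih h3, List.flatten_cons, List.drop_append, h0]
        simp [hL, Nat.succ_mul]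

theorem IsRuns.drop {L : ℕ} {Rs : List (List El)} (h : IsRuns L Rs) (n : ℕ) :
    IsRuns L (Rs.drop n) := by
  induction Rs generalizing n with
  | nil => simp [IsRuns]
  | cons r rs ih =>
    cases n with
    | zero => exact h
    | succ n => exact ih h.2.2.2.2 n

theorem IsRuns.take_length {L : ℕ} {Rs : List (List El)} (h : IsRuns L Rs) {n : ℕ}
    (hn : Rs.drop n ≠ []) : (Rs.take n).flatten.length = n * L := by
  induction Rs generalizing n with
  | nil => simp at hn
  | cons r rs ih =>
    cases n with
    | zero => simp
    | succ n =>
      simp only [List.drop_succ_cons] at hn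
      have hrs : rs ≠ [] := by rintro rfl; simp at hn
      simp only [List.take_succ_cons, List.flatten_cons, List.length_append, ih h.2.2.2.2 hn,
        h.2.2.2.1 hrs, Nat.succ_mul]
      omega

theorem IsRuns.take_length_le {L : ℕ} {Rs : List (List El)} (h : IsRuns L Rs) (n : ℕ) :
    (Rs.take n).flatten.length ≤ n * L := by
  induction Rs generalizing n with
  | nil => simp
  | cons r rs ih =>
    cases n with
    | zero => simp
    | succ n =>
      have := ih h.2.2.2.2 n
      have := h.2.2.1
      simp only [List.take_succ_cons, List.flatten_cons, List.length_append, Nat.succ_mul]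
      omega

theorem IsRuns.asc {L : ℕ} {Rs : List (List El)} (h : IsRuns L Rs) {r : List El} (hr : r ∈ Rs) :
    Asc r ∧ 0 < r.length := by
  induction Rs with
  | nil => simp at hr
  | cons r' rs ih =>
    rcases List.mem_cons.1 hr with rfl | hr
    · exact ⟨h.1, h.2.1⟩
    · exact ih h.2.2.2.2 hr

theorem IsRuns.concat {L : ℕ} {Rs : List (List El)} (h : ∀ r ∈ Rs, Asc r ∧ r.length = L)
    (hL : 0 < L) {r : List El} (hr : Asc r) (hr0 : 0 < r.length) (hrL : r.length ≤ L) :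
    IsRuns L (Rs ++ [r]) := by
  induction Rs with
  | nil => simp [IsRuns, hr, hr0, hrL]
  | cons r' rs ih =>
    have h' := h r' (by simp)
    exact ⟨h'.1, by omega, h'.2.le, fun _ => h'.2, ih fun x hx => h x (by simp [hx])⟩

theorem IsRuns.of_full {L : ℕ} {Rs : List (List El)} (h : ∀ r ∈ Rs, Asc r ∧ r.length = L)
    (hL : 0 < L) : IsRuns L Rs := by
  induction Rs with
  | nil => trivial
  | cons r' rs ih =>
    have h' := h r' (by simp)
    exact ⟨h'.1, by omega, h'.2.le, fun _ => h'.2, ih fun x hx => h x (by simp [hx])⟩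

/-! ### Counting during a merge

`rem s` is the rest of run `s`, and `bo s` is the number of its blue elements that were output. -/

/-- Number of pairs of different runs that are still to be counted. -/
noncomputable def mergePot (f : ℕ) (rem : ℕ → List El) (bo : ℕ → ℕ) : ℕ :=
  ∑ s ∈ Finset.range f, ∑ s' ∈ Finset.range f,
    if s < s' then crs (rem s) (rem s') + bo s' * reds (rem s) else 0

theorem mergePot_nil {f : ℕ} {rem : ℕ → List El} (bo : ℕ → ℕ) (h : ∀ s < f, rem s = []) :
    mergePot f rem bo = 0 := by
  refine Finset.sum_eq_zero fun s hs => Finset.sum_eq_zero fun s' hs' => ?_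
  simp [h s (Finset.mem_range.1 hs), reds]

/-- Before any output the potential consists of the pairs across the lists of the group. Absent
lists count as empty, so a group of fewer than `f` lists needs no special treatment. -/
theorem mergePot_init {f : ℕ} {G : List (List El)} (h : G.length ≤ f) :
    mergePot f (fun s => G.getD s []) (fun _ => 0) = Xc G := by
  have key : ∀ (G : List (List El)) (f : ℕ) (r : List El), G.length ≤ f →
      ∑ s ∈ Finset.range f, crs r (G.getD s []) = crs r G.flatten := by
    intro G
    induction G with
    | nil => simp
    | cons r' G ih =>
      intro f r hf
      obtain ⟨f, rfl⟩ : ∃ f', f = f' + 1 := ⟨f - 1, by simp at hf; omega⟩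
      rw [Finset.sum_range_succ']
      simp only [List.getD_cons_succ, List.getD_cons_zero, List.flatten_cons, crs_append_right]
      rw [ih f r (by simpa using hf)]
      omega
  unfold mergePot
  simp only [zero_mul, add_zero]
  induction G generalizing f with
  | nil => simp [Xc]
  | cons r G ih =>
    obtain ⟨f, rfl⟩ : ∃ f', f = f' + 1 := ⟨f - 1, by simp at h; omega⟩
    have hG : G.length ≤ f := by simpa using h
    rw [Finset.sum_range_succ', Xc, ← key G f r hG, add_comm]
    congr 1
    · rw [Finset.sum_range_succ']
      simp
    · rw [← ih hG]
      refine Finset.sum_congr rfl fun s _ => ?_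
      rw [Finset.sum_range_succ']
      simp

/-- A minimal red element has no strictly smaller blue element left in any run. What it contributes
to the potential are the blue elements output earlier from later runs, `bo s` for each `s > b`.
These pairs move into the counter when it is output. -/
theorem mergePot_red {f b : ℕ} {rem : ℕ → List El} {bo : ℕ → ℕ} {x : El} {tl : List El}
    (hb : b < f) (hrem : rem b = x :: tl) (hx : x.1 = true)
    (hmin : ∀ s < f, ∀ y ∈ rem s, x.2 ≤ y.2) :
    mergePot f rem bo = mergePot f (Function.update rem b tl) bo +
      ∑ s ∈ Finset.range f, if b < s then bo s else 0 := by
  -- As a double sum supported on the row `s = b`, the loss can be compared with the potential term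
  -- by term.
  have hsum : (∑ s ∈ Finset.range f, if b < s then bo s else 0) =
      ∑ s ∈ Finset.range f, ∑ s' ∈ Finset.range f, if s = b ∧ s < s' then bo s' else 0 := by
    rw [← Finset.add_sum_erase _ _ (Finset.mem_range.2 hb), Finset.sum_eq_single_of_mem b
      (Finset.mem_range.2 hb)] <;> simp +contextual
    simpa using Finset.add_sum_erase _ (fun s => if b < s then bo s else 0)
      (Finset.mem_range.2 hb)
  rw [hsum]
  unfold mergePot
  simp only [← Finset.sum_add_distrib]
  refine Finset.sum_congr rfl fun s hs => Finset.sum_congr rfl fun s' hs' => ?_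
  rw [Finset.mem_range] at hs hs'
  by_cases hss : s < s'
  · by_cases hsb : s = b
    · subst hsb
      have h0 : (rem s').countP (inv x) = 0 := by
        rw [List.countP_eq_zero]
        intro y hy
        have := hmin s' hs' y hy
        simp [inv, this]
      simp only [hss, and_self, if_true, Function.update_self, hrem]
      rw [Function.update_of_ne (by omega), crs_cons_left, h0]
      simp only [reds, List.countP_cons, hx, if_true]
      ring
    · by_cases hsb' : s' = b
      · subst hsb'
        simp only [hss, hsb, false_and, if_true, if_false, Function.update_self, hrem]
        rw [Function.update_of_ne hsb, crs_cons_right, ← crs_singleton, crs_red _ hx]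
        omega
      · simp [hss, hsb, hsb']
  · simp [hss]

/-- The pairs of `x` with red elements of earlier runs are not counted yet: they turn from a term of
`crs` into one more unit of `bo b` per red element. This requires every remaining red element of an
earlier run to be strictly above `x`, which is why ties must be resolved in favour of the first run.
-/
theorem mergePot_blue {f b : ℕ} {rem : ℕ → List El} {bo : ℕ → ℕ} {x : El} {tl : List El}
    (hrem : rem b = x :: tl) (hx : x.1 = false)
    (hmin : ∀ s < b, ∀ y ∈ rem s, x.2 < y.2) :
    mergePot f rem bo =
      mergePot f (Function.update rem b tl) (Function.update bo b (bo b + 1)) := by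
  unfold mergePot
  refine Finset.sum_congr rfl fun s hs => Finset.sum_congr rfl fun s' hs' => ?_
  by_cases hss : s < s'
  · simp only [hss, if_true]
    by_cases hsb : s = b
    · subst hsb
      have h0 : (rem s').countP (inv x) = 0 := by
        rw [List.countP_eq_zero]
        intro y hy
        simp [inv, hx]
      rw [Function.update_self, Function.update_of_ne (by omega), Function.update_of_ne (by omega),
        hrem, crs_cons_left, h0]
      simp [reds, hx]
    · by_cases hsb' : s' = b
      · subst hsb'
        have h0 : (rem s).countP (inv · x) = reds (rem s) := by
          refine List.countP_congr fun y hy => ?_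
          have := hmin s hss y hy
          simp [inv, hx, this]
        rw [Function.update_self, Function.update_self, Function.update_of_ne hsb, hrem,
          crs_cons_right, h0]
        ring
      · simp [hsb, hsb']
  · simp [hss]


/-! ### Elements on the virtual machine

The program works on the input or, if the direction `d` is `true`, on its image under `El.neg`. -/

/-- Cell that represents an element. -/
noncomputable def enc (d : Bool) (x : El) : Cell :=
  (.num (x.1 ^^ d).toNat, .key (if d then -x.2 else x.2))

/-- The same cells represent a sequence in one direction and its negated image in the other. Hence
the scanning direction changes without rewriting a file. -/
theorem enc_neg (d : Bool) (x : El) : enc (!d) x.neg = enc d x := by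
  cases d <;> simp [enc, El.neg]

/-- Test whether the element register `r` holds a red element. -/
def redT (d : Bool) (r : ℕ) : Test :=
  if d then .lt (.reg (40 + 2 * r)) (.const 1) else .lt (.const 0) (.reg (40 + 2 * r))

/-- Comparison of the element registers `r` and `r'`. -/
def ltT (d : Bool) (r r' : ℕ) : Test :=
  if d then .keyLt (.reg (41 + 2 * r')) (.reg (41 + 2 * r))
  else .keyLt (.reg (41 + 2 * r)) (.reg (41 + 2 * r'))

section
variable {C : Ctx} {a : View} {p q : Prog} {Q : View → ℕ → Prop}

theorem Ctx.Tr.iteRed (hC : C.Good) {d : Bool} {r : ℕ} {x : El} (hr : r < 4)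
    (he : a.e r = enc d x) (hp : x.1 = true → C.Tr p a Q) (hq : x.1 = false → C.Tr q a Q) :
    C.Tr (.ite (redT d r) p q) a Q := fun s hs => by
  have h1 := (hs.e r hr).1
  rw [he] at h1
  have hX := hC.X64
  have hXW := hC.X_le
  refine Wp.ite (b := x.1) ?_ (fun h => hp h s hs) (fun h => hq h s hs)
  cases d
  · rw [redT, if_neg (by simp), Test.eval_lt (Expr.eval_const (by omega)) (Expr.eval_reg h1)]
    cases x.1 <;> simp
  · rw [redT, if_pos rfl, Test.eval_lt (Expr.eval_reg h1) (Expr.eval_const (by omega))]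
    cases x.1 <;> simp

theorem Ctx.Tr.iteLt {d : Bool} {r r' : ℕ} {x y : El} (hr : r < 4) (hr' : r' < 4)
    (he : a.e r = enc d x) (he' : a.e r' = enc d y) (hp : x.2 < y.2 → C.Tr p a Q)
    (hq : y.2 ≤ x.2 → C.Tr q a Q) :
    C.Tr (.ite (ltT d r r') p q) a Q := fun s hs => by
  have h1 := (hs.e r hr).2
  have h2 := (hs.e r' hr').2
  rw [he] at h1
  rw [he'] at h2
  refine Wp.ite (b := decide (x.2 < y.2)) ?_ (fun h => hp (by simpa using h) s hs)
    (fun h => hq (by simpa using h) s hs)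
  cases d <;> simp [ltT, Test.eval, Expr.eval, h1, h2, enc]

/-! ### Sequential output -/

/-- The cells of `l` were written to file `φ` through slot `σ`; the last incomplete block is
still in the buffer. -/
def Written (C : Ctx) (a : View) (σ φ : ℕ) (l : List Cell) : Prop :=
  ∀ p c, l[p]? = some c →
    (if p / C.β = l.length / C.β then a.buf σ (p % C.β) else a.fl φ p) = c

/-- The file `φ` holds the cells of `l`. -/
def Holds (a : View) (φ : ℕ) (l : List Cell) : Prop := ∀ p c, l[p]? = some c → a.fl φ p = c

theorem Written.nil (C : Ctx) (a : View) (σ φ : ℕ) : Written C a σ φ [] := by simp [Written]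

/-- Append the element register `r` to the file `φ` through slot `σ`; the register `n` holds the
length of the file. -/
def writeE (σ : ℕ) (φ : Expr) (n r : ℕ) : Prog :=
  storeE r (.const σ) (.mod (.reg n) (.reg 30)) ;;
  .assign n (.add (.reg n) (.const 1)) ;;
  .ite (.lt (.const 0) (.mod (.reg n) (.reg 30))) .skip
    (saveBlk (.const σ) φ (.sub (.div (.reg n) (.reg 30)) (.const 1)))

theorem succ_div_mod {b : ℕ} (hb : 0 < b) (n : ℕ) :
    (n % b + 1 < b ∧ (n + 1) % b = n % b + 1 ∧ (n + 1) / b = n / b) ∨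
    (n % b + 1 = b ∧ (n + 1) % b = 0 ∧ (n + 1) / b = n / b + 1) := by
  have h1 := Nat.div_add_mod n b
  have h2 := Nat.mod_lt n hb
  by_cases h : n % b + 1 < b
  · left
    have : n + 1 = n / b * b + (n % b + 1) := by rw [mul_comm (n / b)]; omega
    have h3 := div_mod_of_lt (j := n / b) h
    rw [← this] at h3
    exact ⟨h, h3.2, h3.1⟩
  · right
    have h4 : n % b + 1 = b := by omega
    have : n + 1 = (n / b + 1) * b + 0 := by
      rw [Nat.add_mul, mul_comm (n / b)]; omega
    have h3 := div_mod_of_lt (j := n / b + 1) hb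
    rw [← this] at h3
    exact ⟨h4, h3.2, h3.1⟩

/-- Each element prepays `2/β` transfers; when the block is full, the prepaid amount covers its two
transfers. The hypothesis on `φ` says that the file number does not depend on the register `n`,
which is incremented before the block is saved. -/
theorem Ctx.Tr.writeE (hC : C.Good) {σ n r : ℕ} {φ : Expr} {l : List Cell} (hσ : σ < 5)
    (hn : n < 30) (hr : r < 4) (hφ : φ.plain = true) (hφs : φ.size ≤ 2)
    (hφv : ∀ v : ℕ → ℕ, v n = l.length + 1 → (∀ i, i ≠ n → v i = a.v i) →
      φ.val C v = φ.val C a.v) (hφ4 : φ.val C a.v < 4)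
    (hl : a.v n = l.length) (hX : l.length + 1 < C.X) (hw : Written C a σ (φ.val C a.v) l)
    (h : ∀ b f t, Written C (((a.setV n (l.length + 1)).setBuf σ b).setFl (φ.val C a.v) f) σ
        (φ.val C a.v) (l ++ [a.e r]) →
      C.β * t + 2 * ((l.length + 1) % C.β) = 2 * (l.length % C.β) + 2 →
      Q (((a.setV n (l.length + 1)).setBuf σ b).setFl (φ.val C a.v) f) t) :
    C.Tr (writeE σ φ n r) a Q := by
  have hβ := hC.β_pos
  have hf := hC.f_two
  have hmod := Nat.mod_lt l.length hβ
  have hval : ∀ v : ℕ → ℕ, (Expr.reg n).val C v = v n := fun v => by simp [Expr.val, hn]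
  have hσo : (Expr.const σ).ok = true := by
    simp [Expr.ok, Expr.plain, Expr.size]; omega
  refine Ctx.Tr.seq (Ctx.Tr.storeE hC hr hσo ?_ ?_ ?_ ?_)
  · simp [Expr.ok, Expr.plain, Expr.size]; omega
  · simp [Expr.val]; omega
  · simp only [Expr.val, hn, if_true, hl]; simpa using hmod
  simp only [Expr.val, hn, if_true, hl]
  simp only [show ¬ 30 < 30 by omega, if_false]
  set b := Function.update (a.buf σ) (l.length % C.β) (a.e r) with hb
  refine Ctx.Tr.seq (Ctx.Tr.assign hC hn ?_ ?_ ?_)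
  · simp [Expr.ok, Expr.plain, Expr.size]; omega
  · simpa [Expr.val, hn, hl] using hX
  have hassign : (Expr.add (.reg n) (.const 1)).val C (a.setBuf σ b).v = l.length + 1 := by
    simp [Expr.val, hn, hl]
  rw [hassign]
  have hval1 : φ.val C ((a.setBuf σ b).setV n (l.length + 1)).v = φ.val C a.v :=
    hφv _ (by simp) fun i hi => by simp [hi]
  -- After the store, the buffer is correct for the block of the new element, and the disk is
  -- correct for all other blocks; this covers both the full and the incomplete case.
  have hstart : ∀ (p : ℕ) (c : Cell), (l ++ [a.e r])[p]? = some c →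
      (p / C.β = l.length / C.β → b (p % C.β) = c) ∧
      (p / C.β ≠ l.length / C.β → a.fl (φ.val C a.v) p = c) := by
    intro p c hp
    rcases Nat.lt_trichotomy p l.length with hlt | heq | hgt
    · rw [List.getElem?_append_left hlt] at hp
      have := hw p c hp
      refine ⟨fun h' => ?_, fun h' => ?_⟩
      · rw [if_pos h'] at this
        rw [hb, Function.update_of_ne, this]
        intro h''
        have h1 := Nat.div_add_mod p C.β
        have h2 := Nat.div_add_mod l.length C.β
        rw [h', h''] at h1
        omega
      · rwa [if_neg h'] at this
    · subst heq
      simp only [List.getElem?_concat_length, Option.some.injEq] at hp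
      refine ⟨fun _ => ?_, fun h' => absurd rfl h'⟩
      simp [hb, hp]
    · rw [List.getElem?_eq_none (by simp; omega)] at hp
      simp at hp
  rcases succ_div_mod hβ l.length with ⟨h1, h2, h3⟩ | ⟨h1, h2, h3⟩
  · refine Ctx.Tr.ite hC ?_ (fun _ => Ctx.Tr.skip ?_) (fun hc => absurd ?_ hc)
    · simp [Test.ok, Expr.ok, Expr.plain, Expr.size]; omega
    · have := h b (a.fl (φ.val C a.v)) 0 ?_ ?_
      · simpa [View.setFl, View.setV, View.setBuf] using this
      · intro p c hp
        have := hstart p c hp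
        simp only [List.length_append, List.length_singleton, h3, View.setFl_buf, View.setBuf_buf,
          Function.update_self, View.setFl_fl, View.setBuf_fl, View.setV_fl]
        split_ifs with h'
        · exact this.1 h'
        · exact this.2 h'
      · omega
    · simp only [Test.val, Expr.val, hn, if_true, View.setV_v, Function.update_self]
      simp [h2]
  · refine Ctx.Tr.ite hC ?_ (fun hc => ?_) (fun _ => ?_)
    · simp [Test.ok, Expr.ok, Expr.plain, Expr.size]; omega
    · simp only [Test.val, Expr.val, hn, if_true, View.setV_v, Function.update_self] at hc
      simp [h2] at hc
    · refine Ctx.Tr.saveBlk hC hσo ?_ ?_ ?_ ?_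
      · simp [blkAddr, Expr.ok, Expr.plain, Expr.size, hφ]; omega
      · simp [Expr.val]; omega
      · rw [hval1]; exact hφ4
      rw [hval1]
      have hj : (Expr.sub (.div (.reg n) (.reg 30)) (.const 1)).val C
          ((a.setBuf σ b).setV n (l.length + 1)).v = l.length / C.β := by
        simp [Expr.val, hn, h3]
      rw [hj]
      refine h b _ _ ?_ ?_
      · intro p c hp
        have hps : p < l.length + 1 := by
          by_contra hps
          rw [List.getElem?_eq_none (by simp; omega)] at hp
          simp at hp
        have := hstart p c hp
        have hpd : p / C.β ≤ l.length / C.β := Nat.div_le_div_right (by omega)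
        simp only [List.length_append, List.length_singleton, h3, View.setFl_fl,
          Function.update_self]
        rw [if_neg (by omega)]
        split_ifs with h'
        · simpa [Expr.val] using this.1 h'
        · exact this.2 h'
      · rw [h2]; omega

/-- Write the last incomplete block. -/
def flushE (σ : ℕ) (φ : Expr) (n : ℕ) : Prog :=
  .ite (.lt (.const 0) (.mod (.reg n) (.reg 30)))
    (saveBlk (.const σ) φ (.div (.reg n) (.reg 30))) .skip

theorem Ctx.Tr.flushE (hC : C.Good) {σ n : ℕ} {φ : Expr} {l : List Cell} (hσ : σ < 5)
    (hn : n < 30) (hφ : φ.plain = true) (hφs : φ.size ≤ 2) (hφ4 : φ.val C a.v < 4)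
    (hl : a.v n = l.length) (hw : Written C a σ (φ.val C a.v) l)
    (h : ∀ f t, Holds (a.setFl (φ.val C a.v) f) (φ.val C a.v) l → t ≤ 2 →
      (l.length % C.β = 0 → t = 0) → Q (a.setFl (φ.val C a.v) f) t) :
    C.Tr (flushE σ φ n) a Q := by
  have hβ := hC.β_pos
  have hf := hC.f_two
  have hσo : (Expr.const σ).ok = true := by
    simp [Expr.ok, Expr.plain, Expr.size]; omega
  have hlt : ∀ (p : ℕ) (c : Cell), l[p]? = some c → p < l.length := fun p c hp => by
    by_contra hps
    rw [List.getElem?_eq_none (by omega)] at hp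
    simp at hp
  refine Ctx.Tr.ite hC ?_ (fun hc => ?_) (fun hc => ?_)
  · simp [Test.ok, Expr.ok, Expr.plain, Expr.size]; omega
  · refine Ctx.Tr.saveBlk hC hσo ?_ ?_ hφ4 ?_
    · simp [blkAddr, Expr.ok, Expr.plain, Expr.size, hφ]; omega
    · simp [Expr.val]; omega
    refine h _ _ ?_ le_rfl ?_
    · intro p c hp
      have := hw p c hp
      simpa [Expr.val, hn, hl] using this
    · intro h0
      simp [Test.val, Expr.val, hn, hl, h0] at hc
  · have h0 : l.length % C.β = 0 := by
      simpa [Test.val, Expr.val, hn, hl] using hc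
    refine Ctx.Tr.skip ?_
    have := h (a.fl (φ.val C a.v)) 0 ?_ (by omega) fun _ => rfl
    · simpa [View.setFl] using this
    · intro p c hp
      have h1 := hw p c hp
      rw [if_neg] at h1
      · simpa using h1
      · have h2 := Nat.div_add_mod l.length C.β
        have h3 := Nat.div_add_mod p C.β
        have h4 := Nat.mod_lt p hβ
        have := hlt p c hp
        intro h'
        rw [h'] at h3
        omega

end

/-! ### Insertion into the file of runs

Registers: 0 counter of pairs, 7 length of the file, 9 its number, 10 position in the buffer,
11 red elements passed, 12 continue. Element registers: 0 new element, 1 element of the buffer. -/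

/-- Sort the element in register 0 into the current block of the file of runs. -/
def insertE (d : Bool) : Prog :=
  .assign 10 (.mod (.reg 7) (.reg 30)) ;;
  .assign 11 (.const 0) ;;
  .assign 12 (.reg 10) ;;
  .loop (.lt (.const 0) (.reg 12))
    (loadE 1 (.const 2) (.sub (.reg 10) (.const 1)) ;;
      .ite (ltT d 0 1)
        (storeE 1 (.const 2) (.reg 10) ;;
          .ite (redT d 1) (.assign 11 (.add (.reg 11) (.const 1))) .skip ;;
          .assign 10 (.sub (.reg 10) (.const 1)) ;;
          .assign 12 (.reg 10))
        (.assign 12 (.const 0))) ;;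
  .ite (redT d 0) .skip (.assign 0 (.add (.reg 0) (.reg 11))) ;;
  storeE 0 (.const 2) (.reg 10) ;;
  .assign 7 (.add (.reg 7) (.const 1)) ;;
  .ite (.lt (.const 0) (.mod (.reg 7) (.reg 30))) .skip
    (saveBlk (.const 2) (.reg 9) (.sub (.div (.reg 7) (.reg 30)) (.const 1)))

/-- The file of runs consists of full blocks on the disk and an incomplete block in slot 2. -/
structure Building (C : Ctx) (d : Bool) (a : View) (full : List (List El)) (part : List El) :
    Prop where
  runs : ∀ r ∈ full, Asc r ∧ r.length = C.β
  asc : Asc part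
  lt : part.length < C.β
  file : a.v 9 < 4
  len : a.v 7 = full.length * C.β + part.length
  disk : ∀ p x, full.flatten[p]? = some x → a.fl (a.v 9) p = enc d x
  buf : ∀ o x, part[o]? = some x → a.buf 2 o = enc d x

/-- Registers outside of `L` are unchanged. -/
def Frame (L : List ℕ) (v v' : ℕ → ℕ) : Prop := ∀ i, i ∉ L → v' i = v i

theorem flatten_length_of_full {b : ℕ} {full : List (List El)}
    (h : ∀ r ∈ full, Asc r ∧ r.length = b) : full.flatten.length = full.length * b := by
  induction full with
  | nil => simp
  | cons r rs ih =>
    rw [List.flatten_cons, List.length_append, ih fun x hx => h x (by simp [hx]),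
      (h r (by simp)).2, List.length_cons, Nat.succ_mul, add_comm]

theorem asc_insert {l₁ l₂ : List El} {x : El} (h : Asc (l₁ ++ l₂)) (h₁ : ∀ z ∈ l₁, z.2 ≤ x.2)
    (h₂ : ∀ z ∈ l₂, x.2 ≤ z.2) : Asc (l₁ ++ x :: l₂) := by
  unfold Asc at *
  rw [List.pairwise_append] at h ⊢
  refine ⟨h.1, List.pairwise_cons.2 ⟨h₂, h.2.1⟩, fun z hz y hy => ?_⟩
  rcases List.mem_cons.1 hy with rfl | hy
  · exact h₁ z hz
  · exact h.2.2 z hz y hy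

section
variable {C : Ctx} {a : View} {Q : View → ℕ → Prop}

/-- Insertion sort from the right end: elements above `x` move up by one cell and leave a gap behind
`l₁`. Register 12 is the loop condition; it equals the position in register 10 until an element not
above `x` is met, and is then set to 0. -/
theorem insertE_loop (hC : C.Good) {d : Bool} {part : List El} {x : El} (hpart : Asc part)
    (hlt : part.length < C.β) (he : a.e 0 = enc d x)
    (hbuf : ∀ o z, part[o]? = some z → a.buf 2 o = enc d z)
    (h10 : a.v 10 = part.length) (h11 : a.v 11 = 0) (h12 : a.v 12 = part.length)
    (h : ∀ v y b (l₁ l₂ : List El), Frame [10, 11, 12] a.v v → part = l₁ ++ l₂ →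
      v 10 = l₁.length → v 11 = reds l₂ → (∀ z ∈ l₁, z.2 ≤ x.2) → (∀ z ∈ l₂, x.2 < z.2) →
      (∀ o z, l₁[o]? = some z → b o = enc d z) →
      (∀ o z, l₂[o]? = some z → b (l₁.length + 1 + o) = enc d z) →
      Q ⟨v, Function.update a.e 1 y, a.hd, Function.update a.buf 2 b, a.fl⟩ 0) :
    C.Tr (.loop (.lt (.const 0) (.reg 12))
      (loadE 1 (.const 2) (.sub (.reg 10) (.const 1)) ;;
      .ite (ltT d 0 1)
        (storeE 1 (.const 2) (.reg 10) ;;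
          .ite (redT d 1) (.assign 11 (.add (.reg 11) (.const 1))) .skip ;;
          .assign 10 (.sub (.reg 10) (.const 1)) ;;
          .assign 12 (.reg 10))
        (.assign 12 (.const 0)))) a Q := by
  have hβX := hC.βX
  have hX := hC.X64
  have hf := hC.f_two
  -- The invariant is introduced as an opaque predicate with a defining equivalence, so that
  -- simplification of the program states does not unfold it. The same device serves in the later
  -- loops.
  obtain ⟨Inv, hInv⟩ : ∃ Inv : ℕ → View → ℕ → Prop, ∀ i a₁ t, Inv i a₁ t ↔
      (t = 0 ∧ ∃ v y b, ∃ l₁ l₂ : List El,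
      a₁ = ⟨v, Function.update a.e 1 y, a.hd, Function.update a.buf 2 b, a.fl⟩ ∧
      Frame [10, 11, 12] a.v v ∧ part = l₁ ++ l₂ ∧ i = v 12 ∧
      v 10 = l₁.length ∧ v 11 = reds l₂ ∧ (∀ z ∈ l₂, x.2 < z.2) ∧
      (∀ o z, l₁[o]? = some z → b o = enc d z) ∧
      (∀ o z, l₂[o]? = some z → b (l₁.length + 1 + o) = enc d z) ∧
      (v 12 = l₁.length ∨ v 12 = 0 ∧ ∀ z ∈ l₁, z.2 ≤ x.2)) := ⟨_, fun _ _ _ => Iff.rfl⟩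
  refine Ctx.Tr.loop₀ hC rfl Inv part.length ((hInv _ _ _).2 ?_) (fun i a₁ t hI hc => ?_)
    fun i a₁ t hI hc => ?_
  · refine ⟨rfl, a.v, a.e 1, a.buf 2, part, [], ?_, fun _ _ => rfl, by simp, h12.symm, h10, h11,
      by simp, hbuf, by simp, Or.inl h12⟩
    simp
  · obtain ⟨rfl, v, y, b, l₁, l₂, rfl, hv, hp, hi, hv10, hv11, hl₂, hb₁, hb₂, hor⟩ :=
      (hInv _ _ _).1 hI
    simp [Test.val, Expr.val] at hc
    have h12' : v 12 = l₁.length := by omega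
    obtain ⟨l₀, z, rfl⟩ : ∃ l₀ z, l₁ = l₀ ++ [z] :=
      ⟨l₁.dropLast, l₁.getLast (by rintro rfl; simp at h12'; omega),
        (List.dropLast_append_getLast _).symm⟩
    simp only [List.length_append, List.length_singleton] at hv10 h12' hb₂
    have hlen : l₀.length + 1 + l₂.length < C.β := by
      rw [hp] at hlt; simp at hlt; omega
    have hz : b l₀.length = enc d z := hb₁ _ _ (by simp)
    refine Ctx.Tr.seq (Ctx.Tr.loadE hC (by omega) rfl rfl ?_ ?_ ?_)
    · simp [Expr.val]
    · simp [Expr.val, hv10]; omega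
    simp only [Expr.val, hv10]
    simp [hz]
    refine Ctx.Tr.iteLt (x := x) (y := z) (by omega) (by omega) ?_ ?_ (fun hlt' => ?_)
      (fun hle => ?_)
    · simp [he]
    · simp
    · refine Ctx.Tr.seq (Ctx.Tr.storeE hC (by omega) rfl rfl ?_ ?_ ?_)
      · simp [Expr.val]
      · simp [Expr.val, hv10]; omega
      simp [Expr.val, hv10]
      have hred : reds (z :: l₂) = reds l₂ + (if z.1 then 1 else 0) := by
        simp [reds, List.countP_cons]
      have hredle : reds (z :: l₂) ≤ l₂.length + 1 := by
        simpa [reds] using List.countP_le_length (p := fun x : El => x.1) (l := z :: l₂)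
      refine Ctx.Tr.seq (Ctx.Tr.mono (Q := fun a₂ t => t = 0 ∧ a₂ = ⟨Function.update v 11
        (reds (z :: l₂)), Function.update a.e 1 (enc d z), a.hd, Function.update a.buf 2
          (Function.update b (l₀.length + 1) (enc d z)), a.fl⟩) ?_ ?_)
      · refine Ctx.Tr.iteRed hC (x := z) (by omega) ?_ (fun hr => ?_) (fun hr => ?_)
        · simp [View.setBuf, View.setE]
        · refine Ctx.Tr.assign hC (by omega) rfl ?_ ⟨rfl, ?_⟩
          · simp [Expr.val, View.setBuf, View.setE]; simp [hr] at hred; omega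
          · simp [View.setBuf, View.setE, View.setV, Expr.val, hred, hr, hv11]
        · refine Ctx.Tr.skip ⟨rfl, ?_⟩
          simp [View.setBuf, View.setE, hred, hr, ← hv11]
      · rintro a₂ t ⟨rfl, rfl⟩
        refine Ctx.Tr.seq (Ctx.Tr.assign hC (by omega) rfl ?_ ?_)
        · simp [Expr.val, hv10]; omega
        simp [Expr.val, hv10]
        refine Ctx.Tr.assign hC (by omega) rfl ?_ ?_
        · simp [Expr.val]; omega
        simp [Expr.val, View.setV]
        refine ⟨l₀.length, by omega, (hInv _ _ _).2 ⟨rfl, _, _, _, l₀, z :: l₂, rfl, ?_, ?_, ?_, ?_, ?_, ?_,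
          ?_, ?_, ?_⟩⟩
        · intro j hj
          simp only [List.mem_cons, List.not_mem_nil, or_false, not_or] at hj
          simp [hj, hv j (by simp [hj])]
        · simp [hp]
        · simp
        · simp
        · simp
        · intro w hw
          rcases List.mem_cons.1 hw with rfl | hw
          · exact hlt'
          · exact hl₂ w hw
        · intro o w hw
          have : o < l₀.length := by
            by_contra ho
            rw [List.getElem?_eq_none (by omega)] at hw
            simp at hw
          rw [Function.update_of_ne (by omega)]
          exact hb₁ o w (by rw [List.getElem?_append_left this]; exact hw)
        · intro o w hw
          cases o with
          | zero =>
            simp at hw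
            simp [hw]
          | succ o =>
            rw [Function.update_of_ne (by omega)]
            have := hb₂ o w (by simpa using hw)
            rw [← this]
            congr 1
            omega
        · simp
    · refine Ctx.Tr.assign hC (by omega) rfl ?_ ?_
      · simp [Expr.val]; omega
      simp [Expr.val, View.setV, View.setE]
      refine ⟨0, by omega, (hInv _ _ _).2 ⟨rfl, _, _, _, l₀ ++ [z], l₂, rfl, ?_, ?_, ?_, ?_, ?_, hl₂, ?_, ?_,
        ?_⟩⟩
      · intro j hj
        simp only [List.mem_cons, List.not_mem_nil, or_false, not_or] at hj
        simp [hj, hv j (by simp [hj])]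
      · simp [hp]
      · simp
      · simp [hv10]
      · simp [hv11]
      · exact hb₁
      · simpa using hb₂
      · right
        refine ⟨by simp, ?_⟩
        have hasc : Asc (l₀ ++ [z]) := by
          rw [hp] at hpart
          exact (List.pairwise_append.1 hpart).1
        intro w hw
        rcases List.mem_append.1 hw with hw' | hw'
        · exact le_trans ((List.pairwise_append.1 hasc).2.2 w hw' z (by simp)) hle
        · simp at hw'; rw [hw']; exact hle
  · obtain ⟨rfl, v, y, b, l₁, l₂, rfl, hv, hp, hi, hv10, hv11, hl₂, hb₁, hb₂, hor⟩ :=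
      (hInv _ _ _).1 hI
    simp [Test.val, Expr.val] at hc
    refine h v y b l₁ l₂ hv hp hv10 hv11 ?_ hl₂ hb₁ hb₂
    rcases hor with h0 | ⟨-, h0⟩
    · have : l₁ = [] := List.length_eq_zero_iff.1 (by omega)
      simp [this]
    · exact h0

/-- Partners of `x` in the current block are counted at once, by the number of red elements passed;
partners in the full blocks enter `Xc` and are counted when the runs are merged. So counter plus
`Xc` increases by all pairs of kept elements with `x`. -/
theorem Ctx.Tr.insertE (hC : C.Good) {d : Bool} {full : List (List El)} {part : List El} {x : El}
    (hB : Building C d a full part) (he : a.e 0 = enc d x) (hlen : a.v 7 + 1 < C.X)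
    (hK : a.v 0 + crs (full.flatten ++ part) [x] < C.X)
    (h : ∀ v y b f t full' part', Frame [0, 7, 10, 11, 12] a.v v →
      Building C d ⟨v, Function.update a.e 1 y, a.hd, Function.update a.buf 2 b,
        Function.update a.fl (a.v 9) f⟩ full' part' →
      v 7 = a.v 7 + 1 →
      v 0 + Xc (full' ++ [part']) = a.v 0 + Xc (full ++ [part]) + crs (full.flatten ++ part) [x] →
      (full'.flatten ++ part').Perm (x :: (full.flatten ++ part)) →
      C.β * t + 2 * part'.length = 2 * part.length + 2 →
      Q ⟨v, Function.update a.e 1 y, a.hd, Function.update a.buf 2 b,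
        Function.update a.fl (a.v 9) f⟩ t) :
    C.Tr (insertE d) a Q := by
  have hβX := hC.βX
  have hX := hC.X64
  have hf := hC.f_two
  have hlt := hB.lt
  have hmod : a.v 7 % C.β = part.length ∧ a.v 7 / C.β = full.length := by
    rw [hB.len]; exact ⟨(div_mod_of_lt hlt).2, (div_mod_of_lt hlt).1⟩
  have hflen := flatten_length_of_full hB.runs
  refine Ctx.Tr.seq (Ctx.Tr.assign hC (by omega) rfl ?_ ?_)
  · simp [Expr.val, hmod]; omega
  simp [Expr.val, hmod]
  refine Ctx.Tr.seq (Ctx.Tr.assign hC (by omega) rfl ?_ ?_)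
  · simp [Expr.val]; omega
  refine Ctx.Tr.seq (Ctx.Tr.assign hC (by omega) rfl ?_ ?_)
  · simp [Expr.val]; omega
  simp [Expr.val]
  refine Ctx.Tr.seq (insertE_loop hC (d := d) (x := x) hB.asc hlt (by simpa using he)
    (by simpa using hB.buf) (by simp) (by simp) (by simp) ?_)
  rintro v y b l₁ l₂ hv rfl hv10 hv11 hl₁ hl₂ hb₁ hb₂
  simp only [View.setV_e, View.setV_hd, View.setV_buf, View.setV_fl]
  have hv' : ∀ i, i ∉ [10, 11, 12] → v i = a.v i := by
    intro i hi
    rw [hv i hi]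
    simp only [List.mem_cons, List.not_mem_nil, or_false, not_or] at hi
    simp [hi]
  set r := l₁ ++ x :: l₂ with hr
  have hrl : r.length = (l₁ ++ l₂).length + 1 := by simp [hr]; omega
  have hrasc : Asc r := asc_insert hB.asc hl₁ fun z hz => (hl₂ z hz).le
  have hrperm : r.Perm (x :: (l₁ ++ l₂)) := List.perm_middle
  -- Elements equal to `x` are not passed, and inverted pairs require strict inequality, so the
  -- passed red elements are exactly the partners of a blue `x`. A red `x` has no partner before it.
  have hKc : (if x.1 then 0 else reds l₂) = crs (l₁ ++ l₂) [x] := by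
    split_ifs with hx
    · rw [crs_red _ hx]
    · have hx : x.1 = false := by simpa using hx
      rw [crs_blue _ hx, above_append]
      have h1 : above x.2 l₁ = 0 := by
        unfold above
        rw [List.countP_eq_zero]
        intro z hz
        have := hl₁ z hz
        simp [this]
      have h2 : above x.2 l₂ = reds l₂ := by
        refine List.countP_congr fun z hz => ?_
        have := hl₂ z hz
        simp [this]
      omega
  rw [crs_append_left] at hK
  refine Ctx.Tr.seq (Ctx.Tr.mono (Q := fun a₂ t => t = 0 ∧ a₂ = ⟨Function.update v 0
    (a.v 0 + crs (l₁ ++ l₂) [x]), Function.update a.e 1 y, a.hd, Function.update a.buf 2 b, a.fl⟩)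
    ?_ ?_)
  · refine Ctx.Tr.iteRed hC (x := x) (by omega) (by simpa using he) (fun hx => ?_) fun hx => ?_
    · refine Ctx.Tr.skip ⟨rfl, ?_⟩
      simp [← hKc, hx, ← hv' 0 (by simp)]
    · simp only [hx] at hKc
      refine Ctx.Tr.assign hC (by omega) rfl ?_ ⟨rfl, ?_⟩
      · simp [Expr.val, hv11, hv' 0]; simp at hKc; omega
      · simp at hKc
        simp [Expr.val, hv11, hv' 0, View.setV, hKc]
  rintro a₂ t ⟨rfl, rfl⟩
  have hl₁r : l₁.length < C.β := by simp at hlt; omega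
  refine Ctx.Tr.seq (Ctx.Tr.storeE hC (by omega) rfl rfl ?_ ?_ ?_)
  · simp [Expr.val]
  · simp [Expr.val, hv10, hl₁r]
  simp [Expr.val, hv10, he]
  set b' := Function.update b l₁.length (enc d x) with hb'
  have hbr : ∀ o z, r[o]? = some z → b' o = enc d z := by
    intro o z hz
    rcases Nat.lt_trichotomy o l₁.length with ho | ho | ho
    · rw [hb', Function.update_of_ne (by omega)]
      exact hb₁ o z (by rw [← hz, hr, List.getElem?_append_left ho])
    · subst ho
      simp [hr] at hz
      simp [hb', hz]
    · obtain ⟨j, rfl⟩ := Nat.exists_eq_add_of_lt ho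
      rw [hb', Function.update_of_ne (by omega)]
      have := hb₂ j z (by
        rw [← hz, hr, List.getElem?_append_right (by omega),
          show l₁.length + j + 1 - l₁.length = j + 1 by omega]
        simp)
      rw [← this]
      congr 1
      omega
  refine Ctx.Tr.seq (Ctx.Tr.assign hC (by omega) rfl ?_ ?_)
  · simp [Expr.val, View.setBuf, hv' 7]; omega
  simp only [View.setBuf, Expr.val]
  simp [hv' 7]
  have hXc : Xc (full ++ [r]) = Xc (full ++ [l₁ ++ l₂]) + crs full.flatten [x] :=
    Xc_insert full hrperm
  have hperm : (full.flatten ++ r).Perm (x :: (full.flatten ++ (l₁ ++ l₂))) :=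
    (List.Perm.append_left _ hrperm).trans List.perm_middle
  have hframe : Frame [0, 7, 10, 11, 12] a.v
      (Function.update (Function.update v 0 (a.v 0 + crs (l₁ ++ l₂) [x])) 7 (a.v 7 + 1)) := by
    intro i hi
    simp only [List.mem_cons, List.not_mem_nil, or_false, not_or] at hi
    rw [Function.update_of_ne hi.2.1, Function.update_of_ne hi.1]
    exact hv' i (by simp [hi])
  have hsd := succ_div_mod hC.β_pos (a.v 7)
  rw [hmod.1, hmod.2] at hsd
  rcases hsd with ⟨h1, h2, h3⟩ | ⟨h1, h2, h3⟩
  · refine Ctx.Tr.ite hC rfl (fun _ => Ctx.Tr.skip ?_) (fun hc => absurd ?_ hc)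
    · have := h (Function.update (Function.update v 0 (a.v 0 + crs (l₁ ++ l₂) [x])) 7 (a.v 7 + 1))
        y b' (a.fl (a.v 9)) 0 full r hframe ?_ (by simp) ?_ hperm ?_
      · simpa [View.setV] using this
      · refine ⟨hB.runs, hrasc, by omega, ?_, ?_, ?_, ?_⟩
        · simpa [hv' 9] using hB.file
        · simp [hB.len, hrl]; omega
        · simpa [hv' 9] using hB.disk
        · simpa using hbr
      · simp [hXc, crs_append_left]; omega
      · rw [hrl]; ring
    · simp [Test.val, Expr.val, View.setV, h2]
  · refine Ctx.Tr.ite hC rfl (fun hc => ?_) (fun _ => ?_)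
    · simp [Test.val, Expr.val, View.setV, h2] at hc
    refine Ctx.Tr.saveBlk hC rfl rfl ?_ ?_ ?_
    · simp [Expr.val]
    · simpa [Expr.val, View.setV, hv' 9] using hB.file
    simp [Expr.val, View.setV, hv' 9, View.setFl, h3]
    refine h _ _ _ _ 2 (full ++ [r]) [] hframe ?_ (by simp) ?_ (by simpa using hperm) ?_
    · refine ⟨?_, List.Pairwise.nil, hC.β_pos, ?_, ?_, ?_, by simp⟩
      · intro z hz
        rcases List.mem_append.1 hz with hz | hz
        · exact hB.runs z hz
        · simp at hz
          rw [hz]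
          exact ⟨hrasc, by omega⟩
      · simpa [hv' 9] using hB.file
      · simp [hB.len, Nat.add_mul]
        simp at h1
        omega
      · intro p z hz
        simp only [List.flatten_append, List.flatten_singleton] at hz
        simp [hv' 9]
        have hdm := Nat.div_add_mod p C.β
        have hpm := Nat.mod_lt p hC.β_pos
        have hlr : (full.flatten ++ r).length = full.length * C.β + C.β := by
          rw [List.length_append, hflen, hrl, h1]
        split_ifs with hp
        · have h4 : full.flatten.length ≤ p := by
            rw [hflen, mul_comm, ← hp]
            omega
          rw [List.getElem?_append_right h4] at hz
          rw [show p % C.β = p - full.flatten.length by rw [hflen, mul_comm, ← hp]; omega]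
          exact hbr _ z hz
        · refine hB.disk p z ?_
          rw [← hz, List.getElem?_append_left]
          by_contra hge
          rw [hflen, not_lt] at hge
          have h4 : full.length ≤ p / C.β := (Nat.le_div_iff_mul_le hC.β_pos).2 hge
          have h5 : p < (full.flatten ++ r).length := by
            by_contra h6
            rw [List.getElem?_eq_none (not_lt.1 h6)] at hz
            simp at hz
          have h6 : p / C.β < full.length + 1 := by
            rw [Nat.div_lt_iff_lt_mul hC.β_pos, Nat.add_mul]
            omega
          omega
    -- The completed block joins the full ones and an empty part takes its place, which contributes
    -- no pairs.
    · have : Xc (full ++ [r] ++ [[]]) = Xc (full ++ [r]) := by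
        rw [Xc_append _ [[]]]
        simp [Xc_singleton]
      rw [this]
      simp [hXc, crs_append_left]
      omega
    · simp at h1 ⊢
      omega

end

/-! ### Merging

Registers: 7 length of the file, 9 its number, 13 length of the runs, 14 start of the group,
15 length of the output, 16 current slot, 17 slot of the minimum, 18 end of the group,
21 and 22 header. Element registers: 1 head of a run, 3 minimum. The header of slot `3 + s` holds
the position of run `s` and the number of its blue elements that were output. -/

/-- Slot of run number `s`, for the number in register `r`. -/
def runSlot (r : ℕ) : Expr := .add (.const 3) (.reg r)

/-- Find the first minimal head. -/
def findMin (d : Bool) : Prog :=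
  .assign 17 (.reg 31) ;;
  .assign 16 (.const 0) ;;
  .loop (.lt (.reg 16) (.reg 31))
    (loadH 21 22 (runSlot 16) ;;
      .ite (.and (.lt (.reg 21) (.reg 7))
          (.lt (.reg 21) (.add (.reg 14) (.mul (.add (.reg 16) (.const 1)) (.reg 13)))))
        (loadE 1 (runSlot 16) (.mod (.reg 21) (.reg 30)) ;;
          .ite (.lt (.reg 17) (.reg 31))
            (.ite (ltT d 1 3) (copyE 3 1 ;; .assign 17 (.reg 16)) .skip)
            (copyE 3 1 ;; .assign 17 (.reg 16)))
        .skip ;;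
      .assign 16 (.add (.reg 16) (.const 1)))

/-- Add the numbers of blue elements output from the runs behind the minimum. -/
def addBlues : Prog :=
  .assign 16 (.add (.reg 17) (.const 1)) ;;
  .loop (.lt (.reg 16) (.reg 31))
    (loadH 21 22 (runSlot 16) ;; .assign 0 (.add (.reg 0) (.reg 22)) ;;
      .assign 16 (.add (.reg 16) (.const 1)))

/-- Output the minimum. -/
def mergeStep (d : Bool) : Prog :=
  findMin d ;;
  .ite (redT d 3) (addBlues ;; loadH 21 22 (runSlot 17))
    (loadH 21 22 (runSlot 17) ;; .assign 22 (.add (.reg 22) (.const 1))) ;;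
  .assign 21 (.add (.reg 21) (.const 1)) ;;
  storeH 21 22 (runSlot 17) ;;
  .ite (.lt (.const 0) (.mod (.reg 21) (.reg 30))) .skip
    (loadBlk (runSlot 17) (.reg 9) (.div (.reg 21) (.reg 30))) ;;
  writeE 2 (.sub (.const 5) (.reg 9)) 15 3

/-- The rest of run `s` is `rem s`. -/
structure Merging (C : Ctx) (d : Bool) (a : View) (rem : ℕ → List El) : Prop where
  len : ∀ s < C.f, (rem s).length =
    min (a.v 14 + (s + 1) * a.v 13) (a.v 7) - (a.hd (3 + s)).1
  data : ∀ s < C.f, ∀ i x, (rem s)[i]? = some x → a.fl (a.v 9) ((a.hd (3 + s)).1 + i) = enc d x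
  buf : ∀ s < C.f, rem s ≠ [] → ∀ o < C.β,
    a.buf (3 + s) o = a.fl (a.v 9) ((a.hd (3 + s)).1 / C.β * C.β + o)
  asc : ∀ s < C.f, Asc (rem s)
  blues : ∀ s < C.f, (a.hd (3 + s)).2 ≤ (a.hd (3 + s)).1

/-- The part of the state that belongs to the other phases is unchanged. -/
structure Keep (L : List ℕ) (a a' : View) : Prop where
  v : Frame L a.v a'.v
  e : ∀ r, r ≠ 1 → r ≠ 3 → a'.e r = a.e r
  buf : ∀ σ < 2, a'.buf σ = a.buf σ
  fl : ∀ φ < 2, a'.fl φ = a.fl φ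

theorem Keep.trans {L : List ℕ} {a b c : View} (h : Keep L a b) (h' : Keep L b c) : Keep L a c :=
  ⟨fun i hi => (h'.v i hi).trans (h.v i hi), fun r h1 h2 => (h'.e r h1 h2).trans (h.e r h1 h2),
    fun σ hσ => (h'.buf σ hσ).trans (h.buf σ hσ), fun φ hφ => (h'.fl φ hφ).trans (h.fl φ hφ)⟩

theorem Keep.mono {L L' : List ℕ} {a b : View} (h : Keep L a b) (hL : L ⊆ L') : Keep L' a b :=
  ⟨fun i hi => h.v i fun hi' => hi (hL hi'), h.e, h.buf, h.fl⟩

section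
variable {C : Ctx} {a : View} {Q : View → ℕ → Prop}

/-- The value `f` of register 17 stands for "no head found yet". A later head replaces the minimum
only if it is strictly smaller, hence the strict inequality for the earlier runs, which
`mergePot_blue` needs. -/
theorem Ctx.Tr.findMin (hC : C.Good) {d : Bool} {rem : ℕ → List El} (hM : Merging C d a rem)
    (hne : ∃ s < C.f, rem s ≠ [])
    (h : ∀ v e b x tl, Frame [16, 17, 21, 22] a.v v → (∀ r, r ≠ 1 → r ≠ 3 → e r = a.e r) →
      b < C.f → v 17 = b → rem b = x :: tl → e 3 = enc d x →
      (∀ s < C.f, ∀ y ∈ rem s, x.2 ≤ y.2) → (∀ s < b, ∀ y ∈ rem s, x.2 < y.2) →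
      Q ⟨v, e, a.hd, a.buf, a.fl⟩ 0) :
    C.Tr (findMin d) a Q := by
  have hβX := hC.βX
  have hfX := hC.fX
  have hX := hC.X64
  have hf := hC.f_two
  refine Ctx.Tr.seq (Ctx.Tr.assign hC (by omega) rfl ?_ ?_)
  · simp [Expr.val]; omega
  refine Ctx.Tr.seq (Ctx.Tr.assign hC (by omega) rfl ?_ ?_)
  · simp [Expr.val]; omega
  simp [Expr.val]
  obtain ⟨Inv, hInv⟩ : ∃ Inv : ℕ → View → ℕ → Prop, ∀ i a₁ t, Inv i a₁ t ↔
      (t = 0 ∧ ∃ v e, a₁ = ⟨v, e, a.hd, a.buf, a.fl⟩ ∧ Frame [16, 17, 21, 22] a.v v ∧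
        (∀ r, r ≠ 1 → r ≠ 3 → e r = a.e r) ∧ i + v 16 = C.f ∧
        ((v 17 = C.f ∧ ∀ s < v 16, rem s = []) ∨
          (∃ x tl, v 17 < v 16 ∧ rem (v 17) = x :: tl ∧ e 3 = enc d x ∧
            (∀ s < v 16, ∀ y ∈ rem s, x.2 ≤ y.2) ∧ ∀ s < v 17, ∀ y ∈ rem s, x.2 < y.2))) :=
    ⟨_, fun _ _ _ => Iff.rfl⟩
  refine Ctx.Tr.loop₀ hC rfl Inv C.f ((hInv _ _ _).2 ?_) (fun i a₁ t hI hc => ?_)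
    fun i a₁ t hI hc => ?_
  · refine ⟨rfl, _, _, rfl, ?_, fun _ _ _ => rfl, by simp, Or.inl ⟨by simp, by simp⟩⟩
    intro i hi
    simp only [List.mem_cons, List.not_mem_nil, or_false, not_or] at hi
    simp [hi]
  · obtain ⟨rfl, v, e, rfl, hv, he, hi, hor⟩ := (hInv _ _ _).1 hI
    simp [Test.val, Expr.val] at hc
    have hs : v 16 < C.f := by omega
    refine Ctx.Tr.seq (Ctx.Tr.loadH hC (by omega) (by omega) rfl ?_ ?_)
    · simp [Expr.val, runSlot]; omega
    simp [Expr.val, runSlot, View.setV]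
    have hlen := hM.len _ hs
    set pos := (a.hd (3 + v 16)).1 with hpos
    -- The common end of all branches: advance the slot counter and reestablish the invariant.
    have hstep : ∀ v' e', Frame [16, 17, 21, 22] a.v v' → (∀ r, r ≠ 1 → r ≠ 3 → e' r = a.e r) →
        v' 16 = v 16 →
        ((v' 17 = C.f ∧ ∀ s < v 16 + 1, rem s = []) ∨
          (∃ x tl, v' 17 < v 16 + 1 ∧ rem (v' 17) = x :: tl ∧ e' 3 = enc d x ∧
            (∀ s < v 16 + 1, ∀ y ∈ rem s, x.2 ≤ y.2) ∧ ∀ s < v' 17, ∀ y ∈ rem s, x.2 < y.2)) →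
        C.Tr (.assign 16 (.add (.reg 16) (.const 1))) ⟨v', e', a.hd, a.buf, a.fl⟩
          fun a' u => ∃ j < i, Inv j a' (0 + u) := by
      simp only [Nat.zero_add]
      intro v' e' h1 h2 h3 h4
      refine Ctx.Tr.assign hC (by omega) rfl ?_ ?_
      · simp [Expr.val, h3]; omega
      refine ⟨i - 1, by omega, (hInv _ _ _).2 ⟨rfl, _, _, rfl, ?_, h2, ?_, ?_⟩⟩
      · intro j hj
        have hj' := hj
        simp only [List.mem_cons, List.not_mem_nil, or_false, not_or] at hj'
        simp [hj', h1 j hj]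
      · simp [Expr.val, h3]; omega
      · simpa [Expr.val, h3] using h4
    have hframe : ∀ (v' : ℕ → ℕ) x y, v' = Function.update (Function.update v 21 x) 22 y →
        Frame [16, 17, 21, 22] a.v v' ∧ Frame [16, 17, 21, 22] a.v (Function.update v' 17 (v 16)) := by
      rintro v' x y rfl
      constructor <;>
      · intro j hj
        have hj' := hj
        simp only [List.mem_cons, List.not_mem_nil, or_false, not_or] at hj'
        simp [hj', hv j hj]
    have h7 : v 7 = a.v 7 := hv 7 (by simp)
    have h13 : v 13 = a.v 13 := hv 13 (by simp)
    have h14 : v 14 = a.v 14 := hv 14 (by simp)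
    refine Ctx.Tr.seq ?_
    refine Ctx.Tr.ite hC rfl (fun hc1 => ?_) (fun hc1 => ?_)
    · simp [Test.val, Expr.val, h7, h13, h14] at hc1
      have hpl : 0 < (rem (v 16)).length := by omega
      obtain ⟨y, tl, hy⟩ : ∃ y tl, rem (v 16) = y :: tl := by
        cases hr : rem (v 16) with
        | nil => simp [hr] at hpl
        | cons y tl => exact ⟨y, tl, rfl⟩
      have hbuf : a.buf (3 + v 16) (pos % C.β) = enc d y := by
        rw [hM.buf _ hs (by simp [hy]) _ (Nat.mod_lt _ hC.β_pos), ← hpos,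
          Nat.div_add_mod', ← hM.data _ hs 0 y (by simp [hy])]
        simp [hpos]
      have hyle : ∀ z ∈ rem (v 16), y.2 ≤ z.2 := by
        intro z hz
        have hasc := hM.asc _ hs
        rw [hy] at hz hasc
        rcases List.mem_cons.1 hz with rfl | hz
        · exact le_rfl
        · exact (List.pairwise_cons.1 hasc).1 z hz
      refine Ctx.Tr.seq (Ctx.Tr.loadE hC (by omega) rfl rfl ?_ ?_ ?_)
      · simp [Expr.val]; omega
      · simp [Expr.val]; exact Nat.mod_lt _ hC.β_pos
      simp [Expr.val, View.setE, hbuf]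
      set v' := Function.update (Function.update v 21 pos) 22 (a.hd (3 + v 16)).2 with hv'
      obtain ⟨hfr, hfr'⟩ := hframe v' _ _ hv'
      have hupd : C.Tr (ExtMem.copyE 3 1 ;; .assign 17 (.reg 16))
          ⟨v', Function.update e 1 (enc d y), a.hd, a.buf, a.fl⟩ fun a' t => t = 0 ∧
          a' = ⟨Function.update v' 17 (v 16), Function.update (Function.update e 1 (enc d y)) 3
            (enc d y), a.hd, a.buf, a.fl⟩ := by
        refine Ctx.Tr.seq (Ctx.Tr.copyE (by omega) (by omega) ?_)
        refine Ctx.Tr.assign hC (by omega) rfl ?_ ⟨rfl, ?_⟩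
        · simp [Expr.val, hv', View.setE]; omega
        · simp [Expr.val, hv', View.setE, View.setV]
      refine Ctx.Tr.ite hC rfl (fun hc2 => ?_) (fun hc2 => ?_)
      · simp [Test.val, Expr.val, hv'] at hc2
        rcases hor with ⟨h17, -⟩ | ⟨x, tl', hb, hrem, he3, hmin, hlt⟩
        · omega
        refine Ctx.Tr.iteLt (x := y) (y := x) (by omega) (by omega) (by simp) (by simp [he3])
          (fun hyx => ?_) (fun hxy => ?_)
        · refine Ctx.Tr.mono hupd ?_
          rintro a' t ⟨rfl, rfl⟩
          refine hstep _ _ hfr' ?_ (by simp [hv']) (Or.inr ⟨y, tl, ?_, ?_, ?_, ?_, ?_⟩)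
          · intro r h1 h3
            simp [h1, h3, he]
          · simp
          · simpa using hy
          · simp
          · intro s hs' z hz
            rcases Nat.lt_succ_iff_lt_or_eq.1 hs' with hs' | rfl
            · exact hyx.le.trans (hmin s hs' z hz)
            · exact hyle z hz
          · simp only [Function.update_self]
            intro s hs' z hz
            exact hyx.trans_le (hmin s hs' z hz)
        · refine Ctx.Tr.skip ?_
          refine hstep _ _ hfr ?_ (by simp [hv']) (Or.inr ⟨x, tl', ?_, ?_, ?_, ?_, ?_⟩)
          · intro r h1 h3
            simp [h1, he r h1 h3]
          · simp [hv']; omega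
          · simpa [hv'] using hrem
          · simp [he3]
          · intro s hs' z hz
            rcases Nat.lt_succ_iff_lt_or_eq.1 hs' with hs' | rfl
            · exact hmin s hs' z hz
            · exact hxy.trans (hyle z hz)
          · simpa [hv'] using hlt
      · simp [Test.val, Expr.val, hv'] at hc2
        rcases hor with ⟨h17, hnil⟩ | ⟨x, tl', hb, hrem, he3, hmin, hlt⟩
        · refine Ctx.Tr.mono hupd ?_
          rintro a' t ⟨rfl, rfl⟩
          refine hstep _ _ hfr' ?_ (by simp [hv']) (Or.inr ⟨y, tl, ?_, ?_, ?_, ?_, ?_⟩)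
          · intro r h1 h3
            simp [h1, h3, he]
          · simp
          · simpa using hy
          · simp
          · intro s hs' z hz
            rcases Nat.lt_succ_iff_lt_or_eq.1 hs' with hs' | rfl
            · simp [hnil s hs'] at hz
            · exact hyle z hz
          · simp only [Function.update_self]
            intro s hs' z hz
            simp [hnil s hs'] at hz
        · omega
    · simp [Test.val, Expr.val, h7, h13, h14] at hc1
      have hnil : rem (v 16) = [] := by
        apply List.length_eq_zero_iff.1
        rw [hlen]
        omega
      refine Ctx.Tr.skip ?_
      refine hstep _ _ (hframe _ _ _ rfl).1 he (by simp) ?_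
      rcases hor with ⟨h17, hn⟩ | ⟨x, tl', hb, hrem, he3, hmin, hlt⟩
      · refine Or.inl ⟨by simpa using h17, fun s hs' => ?_⟩
        rcases Nat.lt_succ_iff_lt_or_eq.1 hs' with hs' | rfl
        · exact hn s hs'
        · exact hnil
      · refine Or.inr ⟨x, tl', ?_, ?_, he3, ?_, ?_⟩
        · simp; omega
        · simpa using hrem
        · intro s hs' z hz
          rcases Nat.lt_succ_iff_lt_or_eq.1 hs' with hs' | rfl
          · exact hmin s hs' z hz
          · simp [hnil] at hz
        · simpa using hlt
  · obtain ⟨rfl, v, e, rfl, hv, he, hi, hor⟩ := (hInv _ _ _).1 hI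
    simp [Test.val, Expr.val] at hc
    have h16 : v 16 = C.f := by omega
    rw [h16] at hor
    rcases hor with ⟨-, hn⟩ | ⟨x, tl, hb, hrem, he3, hmin, hlt⟩
    · obtain ⟨s, hs, hsn⟩ := hne
      exact absurd (hn s hs) hsn
    · exact h v e (v 17) x tl hv he hb rfl hrem he3 hmin hlt

theorem Ctx.Tr.addBlues (hC : C.Good) (h17 : a.v 17 < C.f)
    (hK : a.v 0 + (∑ s ∈ Finset.range C.f, if a.v 17 < s then (a.hd (3 + s)).2 else 0) < C.X)
    (h : ∀ v, Frame [0, 16, 21, 22] a.v v → v 0 = a.v 0 +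
        (∑ s ∈ Finset.range C.f, if a.v 17 < s then (a.hd (3 + s)).2 else 0) →
      Q ⟨v, a.e, a.hd, a.buf, a.fl⟩ 0) :
    C.Tr addBlues a Q := by
  have hfX := hC.fX
  have hX := hC.X64
  have hf := hC.f_two
  refine Ctx.Tr.seq (Ctx.Tr.assign hC (by omega) rfl ?_ ?_)
  · simp [Expr.val]; omega
  simp [Expr.val]
  obtain ⟨Inv, hInv⟩ : ∃ Inv : ℕ → View → ℕ → Prop, ∀ i a₁ t, Inv i a₁ t ↔
      (t = 0 ∧ ∃ v, a₁ = ⟨v, a.e, a.hd, a.buf, a.fl⟩ ∧ Frame [0, 16, 21, 22] a.v v ∧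
        i + v 16 = C.f ∧ a.v 17 < v 16 ∧
        v 0 = a.v 0 + ∑ s ∈ Finset.range (v 16), if a.v 17 < s then (a.hd (3 + s)).2 else 0) :=
    ⟨_, fun _ _ _ => Iff.rfl⟩
  refine Ctx.Tr.loop₀ hC rfl Inv (C.f - (a.v 17 + 1)) ((hInv _ _ _).2 ?_) (fun i a₁ t hI hc => ?_)
    fun i a₁ t hI hc => ?_
  · refine ⟨rfl, _, rfl, ?_, by simp; omega, by simp, ?_⟩
    · intro i hi
      simp only [List.mem_cons, List.not_mem_nil, or_false, not_or] at hi
      simp [hi]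
    · simp only [Function.update_self]
      rw [Finset.sum_eq_zero]
      · simp
      · intro s hs
        rw [if_neg]
        simp at hs
        omega
  · obtain ⟨rfl, v, rfl, hv, hi, hlt, hv0⟩ := (hInv _ _ _).1 hI
    simp [Test.val, Expr.val] at hc
    -- All summands are nonnegative, so a partial sum is at most the full one and the counter cannot
    -- overflow on the way.
    have hle : (∑ s ∈ Finset.range (v 16 + 1), if a.v 17 < s then (a.hd (3 + s)).2 else 0) ≤
        ∑ s ∈ Finset.range C.f, if a.v 17 < s then (a.hd (3 + s)).2 else 0 :=
      Finset.sum_le_sum_of_subset (Finset.range_subset_range.2 (by omega))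
    rw [Finset.sum_range_succ, if_pos hlt] at hle
    refine Ctx.Tr.seq (Ctx.Tr.loadH hC (by omega) (by omega) rfl ?_ ?_)
    · simp [Expr.val, runSlot]; omega
    simp [Expr.val, runSlot, View.setV]
    refine Ctx.Tr.seq (Ctx.Tr.assign hC (by omega) rfl ?_ ?_)
    · simp [Expr.val]; omega
    simp [Expr.val, View.setV]
    refine Ctx.Tr.assign hC (by omega) rfl ?_ ?_
    · simp [Expr.val]; omega
    simp [Expr.val, View.setV]
    refine ⟨i - 1, by omega, (hInv _ _ _).2 ⟨rfl, _, rfl, ?_, ?_, ?_, ?_⟩⟩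
    · intro j hj
      have hj' := hj
      simp only [List.mem_cons, List.not_mem_nil, or_false, not_or] at hj'
      simp [hj', hv j hj]
    · simp; omega
    · simp; omega
    · simp only [Function.update_self]
      rw [Finset.sum_range_succ, if_pos hlt]
      simp
      omega
  · obtain ⟨rfl, v, rfl, hv, hi, hlt, hv0⟩ := (hInv _ _ _).1 hI
    simp [Test.val, Expr.val] at hc
    rw [show v 16 = C.f by omega] at hv0
    exact h v hv hv0

end
section
variable {C : Ctx} {a : View} {Q : View → ℕ → Prop}

/-- Number of blocks that the merge is ahead. -/
def readPot (C : Ctx) (hd : ℕ → ℕ × ℕ) : ℕ := ∑ s ∈ Finset.range C.f, (hd (3 + s)).1 % C.β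

theorem readPot_update (C : Ctx) (hd : ℕ → ℕ × ℕ) {b : ℕ} (hb : b < C.f) (x : ℕ × ℕ) :
    readPot C (Function.update hd (3 + b) x) + (hd (3 + b)).1 % C.β =
      readPot C hd + x.1 % C.β := by
  have hb' := Finset.mem_range.2 hb
  unfold readPot
  rw [← Finset.add_sum_erase _ _ hb', ← Finset.add_sum_erase _ _ hb']
  have : ∑ s ∈ (Finset.range C.f).erase b, (Function.update hd (3 + b) x (3 + s)).1 % C.β =
      ∑ s ∈ (Finset.range C.f).erase b, (hd (3 + s)).1 % C.β := by
    refine Finset.sum_congr rfl fun s hs => ?_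
    rw [Function.update_of_ne]
    have := Finset.ne_of_mem_erase hs
    omega
  rw [this]
  simp
  omega

/-- Counter plus `mergePot` is conserved: a red output moves pairs from the potential into the
counter, a blue output changes only how they are represented. Each element pays 2 for reading and 2
for writing; `readPot` holds what was prepaid for the blocks that are being consumed. -/
theorem Ctx.Tr.mergeStep (hC : C.Good) {d : Bool} {rem : ℕ → List El} {out : List El}
    (hM : Merging C d a rem) (hne : ∃ s < C.f, rem s ≠ [])
    (hW : Written C a 2 (5 - a.v 9) (out.map (enc d))) (h15 : a.v 15 = out.length)
    (hX : out.length + 1 < C.X) (h9 : a.v 9 = 2 ∨ a.v 9 = 3)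
    (hK : a.v 0 + mergePot C.f rem (fun s => (a.hd (3 + s)).2) < C.X)
    (h : ∀ a' b x tl t, b < C.f → rem b = x :: tl → (∀ s < C.f, ∀ y ∈ rem s, x.2 ≤ y.2) →
      Merging C d a' (Function.update rem b tl) →
      Written C a' 2 (5 - a.v 9) ((out ++ [x]).map (enc d)) → a'.v 15 = out.length + 1 →
      a'.v 0 + mergePot C.f (Function.update rem b tl) (fun s => (a'.hd (3 + s)).2) =
        a.v 0 + mergePot C.f rem (fun s => (a.hd (3 + s)).2) →
      Keep [0, 15, 16, 17, 21, 22] a a' → a'.fl (a.v 9) = a.fl (a.v 9) →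
      C.β * t + 2 * readPot C a'.hd + 2 * ((out.length + 1) % C.β) =
        2 * readPot C a.hd + 2 * (out.length % C.β) + 4 →
      Q a' t) :
    C.Tr (mergeStep d) a Q := by
  refine Ctx.Tr.bound fun hvX => ?_
  refine Ctx.Tr.seq (Ctx.Tr.findMin hC hM hne ?_)
  intro v e b x tl hv he hb h17 hrem he3 hmin hlt
  set pos := (a.hd (3 + b)).1 with hpos
  have hlen := hM.len b hb
  rw [hrem, List.length_cons, ← hpos] at hlen
  have h7X := hvX 7 (by omega)
  have hbl := hM.blues b hb
  rw [← hpos] at hbl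
  have hβ := hC.β_pos
  simp only [Nat.zero_add]
  refine Ctx.Tr.seq (Ctx.Tr.mono (Q := fun a₂ t => t = 0 ∧ ∃ v₂ n, a₂ = ⟨v₂, e, a.hd, a.buf, a.fl⟩ ∧
    Frame [0, 16, 17, 21, 22] a.v v₂ ∧ v₂ 17 = b ∧ v₂ 21 = pos ∧ v₂ 22 = n ∧ n ≤ pos + 1 ∧
    v₂ 0 + mergePot C.f (Function.update rem b tl)
      (Function.update (fun s => (a.hd (3 + s)).2) b n) =
      a.v 0 + mergePot C.f rem (fun s => (a.hd (3 + s)).2)) ?_ ?_)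
  · refine Ctx.Tr.iteRed hC (x := x) (by omega) he3 (fun hx => ?_) fun hx => ?_
    · have hpot := mergePot_red (bo := fun s => (a.hd (3 + s)).2) hb hrem hx hmin
      refine Ctx.Tr.seq (Ctx.Tr.addBlues hC (by simp [h17, hb]) ?_ ?_)
      · simp only [h17, hv 0 (by simp)]
        omega
      intro v' hv' h0
      simp only [h17, hv 0 (by simp)] at h0
      have h17' : v' 17 = b := (hv' 17 (by simp)).trans h17
      refine Ctx.Tr.loadH hC (by omega) (by omega) rfl ?_ ⟨rfl, ?_⟩
      · simp [Expr.val, runSlot, h17']; omega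
      simp only [Expr.val, runSlot, h17', View.setV]
      refine ⟨_, (a.hd (3 + b)).2, rfl, ?_, ?_, ?_, ?_, by omega, ?_⟩
      · intro i hi
        simp only [List.mem_cons, List.not_mem_nil, or_false, not_or] at hi
        simp [hi, hv' i, hv i]
      · simp [h17']
      · simp [hpos]
      · simp
      · rw [hpot]
        simp [h0]
        ring
    · have hpot := mergePot_blue (f := C.f) (bo := fun s => (a.hd (3 + s)).2) hrem hx hlt
      refine Ctx.Tr.seq (Ctx.Tr.loadH hC (by omega) (by omega) rfl ?_ ?_)
      · simp [Expr.val, runSlot, h17]; omega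
      simp only [Expr.val, Nat.reduceLT, reduceIte, runSlot, View.setV, h17]
      refine Ctx.Tr.assign hC (by omega) rfl ?_ ⟨rfl, ?_⟩
      · simp [Expr.val]; omega
      simp only [Expr.val, Nat.reduceLT, reduceIte, View.setV]
      refine ⟨_, (a.hd (3 + b)).2 + 1, rfl, ?_, ?_, ?_, ?_, ?_, ?_⟩
      · intro i hi
        simp only [List.mem_cons, List.not_mem_nil, or_false, not_or] at hi
        simp [hi, hv i]
      · simp [h17]
      · simp [hpos]
      · simp
      · omega
      · simp [hpot, hv 0]
  rintro a₂ t ⟨rfl, v₂, n, rfl, hv₂, h17₂, h21₂, h22₂, hn, hpot⟩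
  refine Ctx.Tr.seq (Ctx.Tr.assign hC (by omega) rfl ?_ ?_)
  · simp [Expr.val, h21₂]; omega
  simp [Expr.val, h21₂, View.setV]
  refine Ctx.Tr.seq (Ctx.Tr.storeH hC (by omega) (by omega) rfl ?_ ?_)
  · simp [Expr.val, runSlot, h17₂]; omega
  simp [Expr.val, runSlot, h17₂, h22₂, View.setHd]
  set v₃ := Function.update v₂ 21 (pos + 1) with hv₃
  set hd₃ := Function.update a.hd (3 + b) (pos + 1, n) with hhd₃
  have hv₃' : Frame [0, 16, 17, 21, 22] a.v v₃ := by
    intro i hi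
    have hi' := hi
    simp only [List.mem_cons, List.not_mem_nil, or_false, not_or] at hi'
    simp [hv₃, hi', hv₂ i hi]
  have h9₃ : v₃ 9 = a.v 9 := hv₃' 9 (by simp)
  -- At a block boundary the next block is fetched even if the run ends there. Its content is then
  -- irrelevant, since `Merging` restricts the buffers of nonempty runs only.
  refine Ctx.Tr.seq (Ctx.Tr.mono (Q := fun a₂ t => ∃ bu, a₂ = ⟨v₃, e, hd₃, bu, a.fl⟩ ∧
    (∀ σ, σ ≠ 3 + b → bu σ = a.buf σ) ∧
    (∀ o < C.β, bu (3 + b) o = a.fl (a.v 9) ((pos + 1) / C.β * C.β + o)) ∧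
    C.β * t + 2 * ((pos + 1) % C.β) = 2 * (pos % C.β) + 2) ?_ ?_)
  · rcases succ_div_mod hβ pos with ⟨h1, h2, h3⟩ | ⟨h1, h2, h3⟩
    · refine Ctx.Tr.ite hC rfl (fun hc => Ctx.Tr.skip ?_) fun hc => ?_
      · refine ⟨_, rfl, fun _ _ => rfl, ?_, ?_⟩
        · rw [h3]
          exact hM.buf b hb (by simp [hrem])
        · rw [h2]; omega
      · simp [Test.val, Expr.val, hv₃, h2] at hc
    · refine Ctx.Tr.ite hC rfl (fun hc => ?_) fun hc => ?_
      · simp [Test.val, Expr.val, hv₃, h2] at hc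
      · refine Ctx.Tr.loadBlk hC rfl rfl ?_ ?_ ?_
        · simp [Expr.val, hv₃, h17₂]; omega
        · simp [Expr.val, h9₃]; omega
        · simp only [Expr.val, Nat.reduceLT, reduceIte, h9₃, View.setBuf]
          rw [show v₃ 17 = b by simp [hv₃, h17₂], show v₃ 21 = pos + 1 by simp [hv₃], h3]
          refine ⟨_, rfl, fun σ hσ => by simp [hσ], fun o ho => ?_, ?_⟩
          · simp
          · rw [h2]; omega
  rintro a₂ t ⟨bu, rfl, hbu, hbub, hcost⟩
  have h15₃ : v₃ 15 = out.length := by rw [hv₃' 15 (by simp), h15]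
  have h5 : (Expr.sub (.const 5) (.reg 9)).val C v₃ = 5 - a.v 9 := by
    simp [Expr.val, h9₃]
  refine Ctx.Tr.writeE hC (l := out.map (enc d)) (by omega) (by omega) (by omega) rfl
    (by decide) ?_ ?_ ?_ ?_ ?_ ?_
  · intro w hw hw'
    simp [Expr.val, hw' 9]
  · rw [h5]; omega
  · simpa using h15₃
  · simpa using hX
  · simp only [h5]
    intro p c hp
    rw [← hW p c hp]
    simp [hbu 2 (by omega)]
  intro bw fw u hWr hcw
  simp only [h5, he3, List.length_map, View.setFl, View.setBuf, View.setV] at hWr hcw ⊢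
  refine h _ b x tl (t + u) hb hrem hmin ?_ ?_ (by simp) ?_ ?_ ?_ ?_
  -- Source and target are the files 2 and 3 in either order, so writing the output leaves the runs
  -- untouched.
  · have hne5 : a.v 9 ≠ 5 - a.v 9 := by omega
    refine ⟨fun s hs => ?_, fun s hs i y hy => ?_, fun s hs hs' o ho => ?_, fun s hs => ?_,
      fun s hs => ?_⟩
    · simp only
      rw [Function.update_of_ne (show (14 : ℕ) ≠ 15 by omega), hv₃' 14 (by simp),
        Function.update_of_ne (show (13 : ℕ) ≠ 15 by omega), hv₃' 13 (by simp),
        Function.update_of_ne (show (7 : ℕ) ≠ 15 by omega), hv₃' 7 (by simp)]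
      by_cases hsb : s = b
      · subst hsb
        simp [hhd₃]
        omega
      · rw [Function.update_of_ne hsb, hhd₃, Function.update_of_ne (by omega)]
        exact hM.len s hs
    · simp only
      rw [Function.update_of_ne (show (9 : ℕ) ≠ 15 by omega), h9₃, Function.update_of_ne hne5]
      by_cases hsb : s = b
      · subst hsb
        have := hM.data s hs (i + 1) y (by rw [hrem]; simpa using hy)
        rw [← this]
        simp [hhd₃]
        congr 1
        omega
      · rw [hhd₃, Function.update_of_ne (show 3 + s ≠ 3 + b by omega)]
        exact hM.data s hs i y (by rw [Function.update_of_ne hsb] at hy; exact hy)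
    · simp only
      rw [Function.update_of_ne (show (9 : ℕ) ≠ 15 by omega), h9₃, Function.update_of_ne hne5,
        Function.update_of_ne (by omega)]
      by_cases hsb : s = b
      · subst hsb
        simp only [hhd₃, Function.update_self]
        exact hbub o ho
      · rw [hhd₃, Function.update_of_ne (show 3 + s ≠ 3 + b by omega), hbu _ (by omega)]
        exact hM.buf s hs (by rw [Function.update_of_ne hsb] at hs'; exact hs') o ho
    · by_cases hsb : s = b
      · subst hsb
        have := hM.asc s hs
        rw [hrem] at this
        rw [Function.update_self]
        exact (List.pairwise_cons.1 this).2
      · rw [Function.update_of_ne hsb]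
        exact hM.asc s hs
    · simp only [hhd₃]
      by_cases hsb : s = b
      · subst hsb
        simpa using hn
      · rw [Function.update_of_ne (show 3 + s ≠ 3 + b by omega)]
        exact hM.blues s hs
  · simpa using hWr
  · rw [← hpot]
    have : (fun s => (hd₃ (3 + s)).2) =
        Function.update (fun s => (a.hd (3 + s)).2) b n := by
      ext s
      by_cases hsb : s = b
      · subst hsb; simp [hhd₃]
      · rw [Function.update_of_ne hsb]
        simp only [hhd₃]
        rw [Function.update_of_ne (show 3 + s ≠ 3 + b by omega)]
    simp only [this]
    simp [hv₃]
  · refine ⟨fun i hi => ?_, he, fun σ hσ => ?_, fun φ hφ => ?_⟩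
    · simp only [List.mem_cons, List.not_mem_nil, or_false, not_or] at hi
      simp [hi, hv₃' i]
    · simp only
      rw [Function.update_of_ne (by omega)]
      exact hbu _ (by omega)
    · simp only
      rw [Function.update_of_ne (by omega)]
  · simp only
    rw [Function.update_of_ne (by omega)]
  · have h1 := readPot_update C a.hd hb (pos + 1, n)
    rw [← hhd₃, ← hpos] at h1
    simp only at h1 ⊢
    rw [Nat.mul_add]
    omega

end

/-! ### Merging one group of runs -/

/-- Position the slots at the runs of a group. -/
def mergeInit : Prog :=
  .assign 16 (.const 0) ;;
  .loop (.lt (.reg 16) (.reg 31))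
    (.assign 21 (.add (.reg 14) (.mul (.reg 16) (.reg 13))) ;;
      .assign 22 (.const 0) ;;
      storeH 21 22 (runSlot 16) ;;
      .ite (.lt (.reg 21) (.reg 7)) (loadBlk (runSlot 16) (.reg 9) (.div (.reg 21) (.reg 30)))
        .skip ;;
      .assign 16 (.add (.reg 16) (.const 1)))

/-- Merge a group of runs. -/
def mergeGroup (d : Bool) : Prog :=
  .assign 18 (.add (.reg 14) (.mul (.reg 31) (.reg 13))) ;;
  mergeInit ;;
  .loop (.and (.lt (.reg 15) (.reg 18)) (.lt (.reg 15) (.reg 7))) (mergeStep d)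

section
variable {C : Ctx} {a : View} {Q : View → ℕ → Prop}

/-- Runs start at multiples of `β`, so the first block of a run begins with the run itself and
`readPot` starts at 0. A loaded run has at least `β` elements, which pay for the two transfers; the
only exception is a run cut off by the end of the file, which explains the extra `2β`. -/
theorem Ctx.Tr.mergeInit (hC : C.Good) {d : Bool} {src : List El} {P0 len : ℕ}
    (hsrc : Holds a (a.v 9) (src.map (enc d))) (h7 : a.v 7 = src.length) (h9 : a.v 9 < 4)
    (h14 : a.v 14 = P0) (h13 : a.v 13 = len) (hP0 : C.β ∣ P0) (hlen : C.β ∣ len) (hlen0 : 0 < len)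
    (hasc : ∀ s < C.f, Asc ((src.drop (P0 + s * len)).take len))
    (hP : P0 < src.length) (hX : P0 + C.f * len < C.X)
    (h : ∀ v hd b t, Frame [16, 21, 22] a.v v → (∀ σ < 3, b σ = a.buf σ) →
      Merging C d ⟨v, a.e, hd, b, a.fl⟩ (fun s => (src.drop (P0 + s * len)).take len) →
      (∀ s < C.f, (hd (3 + s)).2 = 0) → readPot C hd = 0 →
      C.β * t ≤ 2 * (min (P0 + C.f * len) src.length - P0) +
        (if P0 + C.f * len ≤ src.length then 0 else 2 * C.β) →
      Q ⟨v, a.e, hd, b, a.fl⟩ t) :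
    C.Tr mergeInit a Q := by
  have hfX := hC.fX
  have hX64 := hC.X64
  have hf := hC.f_two
  have hβ := hC.β_pos
  have hβlen := Nat.le_of_dvd hlen0 hlen
  refine Ctx.Tr.seq (Ctx.Tr.assign hC (by omega) rfl ?_ ?_)
  · simp [Expr.val]; omega
  simp only [Expr.val, Nat.zero_add]
  obtain ⟨Inv, hInv⟩ : ∃ Inv : ℕ → View → ℕ → Prop, ∀ i a₁ t, Inv i a₁ t ↔
      (∃ v hd b, a₁ = ⟨v, a.e, hd, b, a.fl⟩ ∧ Frame [16, 21, 22] a.v v ∧ i + v 16 = C.f ∧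
        (∀ σ < 3, b σ = a.buf σ) ∧ (∀ s < v 16, hd (3 + s) = (P0 + s * len, 0)) ∧
        (∀ s < v 16, P0 + s * len < src.length → ∀ o < C.β,
          b (3 + s) o = a.fl (a.v 9) ((P0 + s * len) / C.β * C.β + o)) ∧
        C.β * t ≤ 2 * (min (P0 + v 16 * len) src.length - P0) +
        (if P0 + v 16 * len ≤ src.length then 0 else 2 * C.β)) :=
    ⟨_, fun _ _ _ => Iff.rfl⟩
  refine Ctx.Tr.loop₀ hC rfl Inv C.f ((hInv _ _ _).2 ?_) (fun i a₁ t hI hc => ?_)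
    fun i a₁ t hI hc => ?_
  · refine ⟨_, _, _, rfl, ?_, by simp, fun _ _ => rfl, by simp, by simp, by simp⟩
    intro i hi
    simp only [List.mem_cons, List.not_mem_nil, or_false, not_or] at hi
    simp [hi]
  · obtain ⟨v, hd, b, rfl, hv, hi, hb, hhd, hbuf, hcost⟩ := (hInv _ _ _).1 hI
    simp [Test.val, Expr.val] at hc
    have hle : v 16 * len + len ≤ C.f * len := by
      rw [← Nat.succ_mul]
      exact Nat.mul_le_mul_right _ hc
    have e14 : v 14 = P0 := (hv 14 (by simp)).trans h14
    have e13 : v 13 = len := (hv 13 (by simp)).trans h13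
    have e9 : v 9 = a.v 9 := hv 9 (by simp)
    have e7 : v 7 = src.length := (hv 7 (by simp)).trans h7
    refine Ctx.Tr.seq (Ctx.Tr.assign hC (by omega) rfl ?_ ?_)
    · simp [Expr.val, e14, e13]; omega
    simp only [Expr.val, Nat.reduceLT, reduceIte, View.setV, e14, e13]
    refine Ctx.Tr.seq (Ctx.Tr.assign hC (by omega) rfl ?_ ?_)
    · simp [Expr.val]; omega
    simp only [Expr.val, View.setV]
    refine Ctx.Tr.seq (Ctx.Tr.storeH hC (by omega) (by omega) rfl ?_ ?_)
    · simp [Expr.val, runSlot]; omega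
    simp only [Expr.val, Nat.reduceLT, reduceIte, View.setHd, runSlot]
    simp only [ne_eq, Nat.reduceEqDiff, not_false_eq_true,
      Function.update_of_ne, Function.update_self]
    set n := v 16 with hn
    set v₁ := Function.update (Function.update v 21 (P0 + n * len)) 22 0 with hv₁
    have e21 : v₁ 21 = P0 + n * len := by simp [hv₁]
    have e16 : v₁ 16 = n := by simp [hv₁, hn]
    refine Ctx.Tr.seq (Ctx.Tr.mono (Q := fun a₂ u => ∃ b₂, a₂ = ⟨v₁, a.e, Function.update hd (3 + n)
      (P0 + n * len, 0), b₂, a.fl⟩ ∧ (∀ σ, σ ≠ 3 + n → b₂ σ = b σ) ∧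
      (P0 + n * len < src.length → ∀ o < C.β,
        b₂ (3 + n) o = a.fl (a.v 9) ((P0 + n * len) / C.β * C.β + o)) ∧
      u = if P0 + n * len < src.length then 2 else 0) ?_ ?_)
    · refine Ctx.Tr.ite hC rfl (fun hc1 => ?_) fun hc1 => ?_
      · simp [Test.val, Expr.val, e21] at hc1
        rw [show v₁ 7 = src.length by simp [hv₁, e7]] at hc1
        refine Ctx.Tr.loadBlk hC rfl rfl ?_ ?_ ?_
        · simp [Expr.val, e16]; omega
        · simp [Expr.val, hv₁, e9, h9]
        · simp only [Expr.val, Nat.reduceLT, reduceIte, View.setBuf, e16, e21]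
          rw [show v₁ 9 = a.v 9 by simp [hv₁, e9]]
          refine ⟨_, rfl, fun σ hσ => by simp [hσ], fun _ o ho => by simp, by simp [hc1]⟩
      · simp [Test.val, Expr.val, e21] at hc1
        rw [show v₁ 7 = src.length by simp [hv₁, e7]] at hc1
        refine Ctx.Tr.skip ⟨_, rfl, fun _ _ => rfl, fun h => by omega, ?_⟩
        rw [if_neg (by omega)]
    rintro a₂ u ⟨b₂, rfl, hb₂, hb₂n, hu⟩
    refine Ctx.Tr.assign hC (by omega) rfl ?_ ?_
    · simp [Expr.val, e16]; omega
    simp only [Expr.val, Nat.reduceLT, reduceIte, View.setV, e16]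
    refine ⟨i - 1, by omega, (hInv _ _ _).2 ⟨_, _, _, rfl, ?_, ?_, ?_, ?_, ?_, ?_⟩⟩
    · intro j hj
      have hj' := hj
      simp only [List.mem_cons, List.not_mem_nil, or_false, not_or] at hj'
      simp [hv₁, hj', hv j hj]
    · simp; omega
    · intro σ hσ
      rw [hb₂ σ (by omega), hb σ hσ]
    · simp only [Function.update_self]
      intro s hs
      by_cases hsn : s = n
      · subst hsn; simp
      · rw [Function.update_of_ne (by omega)]
        exact hhd s (by omega)
    · simp only [Function.update_self]
      intro s hs
      by_cases hsn : s = n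
      · subst hsn; exact hb₂n
      · rw [hb₂ _ (by omega)]
        exact hbuf s (by omega)
    · simp only [Function.update_self, Nat.add_mul, one_mul, Nat.zero_add]
      rw [Nat.mul_add]
      -- With the products as variables, the cost estimate is linear.
      generalize n * len = y at *
      generalize C.β * t = z at *
      subst hu
      split_ifs at * <;> omega
  · obtain ⟨v, hd, b, rfl, hv, hi, hb, hhd, hbuf, hcost⟩ := (hInv _ _ _).1 hI
    simp [Test.val, Expr.val] at hc
    have e16 : v 16 = C.f := by omega
    rw [e16] at hhd hbuf hcost
    refine h v hd b t hv hb ?_ (fun s hs => by rw [hhd s hs]) ?_ hcost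
    · refine ⟨fun s hs => ?_, fun s hs i x hx => ?_, fun s hs hne o ho => ?_, hasc, fun s hs => ?_⟩
      · simp only [hhd s hs, hv 14 (by simp), hv 13 (by simp), hv 7 (by simp), h14, h13, h7,
          List.length_take, List.length_drop, Nat.add_mul, one_mul]
        omega
      · simp only [hhd s hs, hv 9 (by simp)]
        refine hsrc _ _ ?_
        rw [List.getElem?_map]
        rw [List.getElem?_take] at hx
        split_ifs at hx
        rw [List.getElem?_drop] at hx
        simp [hx]
      · simp only [hhd s hs, hv 9 (by simp)]
        refine hbuf s hs ?_ o ho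
        by_contra hge
        exact hne (by rw [List.drop_eq_nil_of_le (by omega), List.take_nil])
      · simp [hhd s hs]
    · refine Finset.sum_eq_zero fun s hs => ?_
      rw [hhd s (Finset.mem_range.1 hs)]
      exact Nat.mod_eq_zero_of_dvd (hP0.add (hlen.mul_left s))

theorem sum_getD_coe {G : List (List El)} {f : ℕ} (h : G.length ≤ f) :
    ∑ s ∈ Finset.range f, ((G.getD s [] : List El) : Multiset El) = (G.flatten : Multiset El) := by
  induction G generalizing f with
  | nil => simp
  | cons r G ih =>
    obtain ⟨f, rfl⟩ : ∃ f', f = f' + 1 := ⟨f - 1, by simp at h; omega⟩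
    rw [Finset.sum_range_succ']
    simp only [List.getD_cons_succ, List.getD_cons_zero, List.flatten_cons]
    rw [ih (by simpa using h), add_comm, Multiset.coe_add]

theorem sum_update_coe {rem : ℕ → List El} {f b : ℕ} {x : El} {tl : List El} (hb : b < f)
    (hrem : rem b = x :: tl) :
    ∑ s ∈ Finset.range f, (rem s : Multiset El) =
      {x} + ∑ s ∈ Finset.range f, (Function.update rem b tl s : Multiset El) := by
  have hb' := Finset.mem_range.2 hb
  rw [← Finset.add_sum_erase _ _ hb', ← Finset.add_sum_erase _ (fun s =>
    (Function.update rem b tl s : Multiset El)) hb', hrem, ← add_assoc]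
  congr 1
  · simp
  · refine Finset.sum_congr rfl fun s hs => ?_
    rw [Function.update_of_ne (Finset.ne_of_mem_erase hs)]

theorem Written.congr {C : Ctx} {a a' : View} {σ φ : ℕ} {l : List Cell} (h : Written C a σ φ l)
    (hb : a'.buf σ = a.buf σ) (hf : a'.fl φ = a.fl φ) : Written C a' σ φ l := by
  intro p c hp
  rw [hb, hf]
  exact h p c hp

/-- The output so far is sorted and below everything that remains, and output plus remainder is a
fixed multiset. The potential starts as `Xc G` and ends as 0, so the counter receives exactly `Xc
G`. Per element, loading the first blocks costs 2 and the merge steps cost 4. -/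
theorem Ctx.Tr.mergeGroup (hC : C.Good) {d : Bool} {src out : List El} {G : List (List El)}
    {P0 len : ℕ}
    (hsrc : Holds a (a.v 9) (src.map (enc d))) (h7 : a.v 7 = src.length)
    (h9 : a.v 9 = 2 ∨ a.v 9 = 3)
    (h14 : a.v 14 = P0) (h13 : a.v 13 = len) (hP0 : C.β ∣ P0) (hlen : C.β ∣ len) (hlen0 : 0 < len)
    (hP : P0 < src.length) (hX : P0 + C.f * len < C.X)
    (hG : ∀ s < C.f, G.getD s [] = (src.drop (P0 + s * len)).take len)
    (hGasc : ∀ s < C.f, Asc (G.getD s [])) (hGf : G.length ≤ C.f)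
    (hGl : G.flatten.length = min (P0 + C.f * len) src.length - P0)
    (hW : Written C a 2 (5 - a.v 9) (out.map (enc d))) (h15 : a.v 15 = P0)
    (hout : out.length = P0) (hK : a.v 0 + Xc G < C.X)
    (h : ∀ a' r t, Asc r → r.Perm G.flatten →
      Written C a' 2 (5 - a.v 9) ((out ++ r).map (enc d)) → a'.v 15 = P0 + r.length →
      a'.v 0 = a.v 0 + Xc G → a'.v 18 = P0 + C.f * len →
      Keep [0, 15, 16, 17, 18, 21, 22] a a' → a'.fl (a.v 9) = a.fl (a.v 9) →
      C.β * t + 2 * ((P0 + r.length) % C.β) ≤ 2 * (P0 % C.β) + 6 * r.length +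
        (if P0 + C.f * len ≤ src.length then 0 else 2 * C.β) → Q a' t) :
    C.Tr (mergeGroup d) a Q := by
  refine Ctx.Tr.bound fun hvX => ?_
  have h7X := hvX 7 (by omega)
  refine Ctx.Tr.seq (Ctx.Tr.assign hC (by omega) rfl ?_ ?_)
  · simp [Expr.val, h14, h13, hX]
  simp only [Expr.val, Nat.reduceLT, reduceIte, View.setV, h14, h13]
  simp only [show ¬ 31 = 30 by omega, if_false, Nat.zero_add]
  refine Ctx.Tr.seq (Ctx.Tr.mergeInit hC (src := src) (P0 := P0) (len := len) (d := d)
    (by simp only [ne_eq, Nat.reduceEqDiff, not_false_eq_true, Function.update_of_ne]; exact hsrc) (by simpa using h7)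
    (by simp; omega) (by simpa using h14) (by simpa using h13) hP0 hlen hlen0
    (fun s hs => by rw [← hG s hs]; exact hGasc s hs) hP hX ?_)
  intro v hd b t₀ hv hb hM hhd2 hrp hcost
  have hpot0 : mergePot C.f (fun s => (src.drop (P0 + s * len)).take len)
      (fun s => (hd (3 + s)).2) = Xc G := by
    rw [← mergePot_init hGf]
    refine Finset.sum_congr rfl fun s hs => Finset.sum_congr rfl fun s' hs' => ?_
    simp only [hhd2 s' (Finset.mem_range.1 hs'), hG s (Finset.mem_range.1 hs),
      hG s' (Finset.mem_range.1 hs')]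
  have hsum0 : ∑ s ∈ Finset.range C.f, (((src.drop (P0 + s * len)).take len : List El) :
      Multiset El) = (G.flatten : Multiset El) := by
    rw [← sum_getD_coe hGf]
    exact Finset.sum_congr rfl fun s hs => by rw [hG s (Finset.mem_range.1 hs)]
  have hv' : ∀ i, i ∉ [16, 18, 21, 22] → v i = a.v i := by
    intro i hi
    simp only [List.mem_cons, List.not_mem_nil, or_false, not_or] at hi
    rw [hv i (by simp [hi])]
    simp [hi]
  have hv18 : v 18 = P0 + C.f * len := by
    rw [hv 18 (by simp)]; simp
  simp only at hb
  obtain ⟨Inv, hInv⟩ : ∃ Inv : ℕ → View → ℕ → Prop, ∀ i a₁ t, Inv i a₁ t ↔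
      (∃ rem r, Merging C d a₁ rem ∧ Asc r ∧ (∀ z ∈ r, ∀ s < C.f, ∀ y ∈ rem s, z.2 ≤ y.2) ∧
        (r : Multiset El) + ∑ s ∈ Finset.range C.f, (rem s : Multiset El) = G.flatten ∧
        Written C a₁ 2 (5 - a.v 9) ((out ++ r).map (enc d)) ∧ a₁.v 15 = P0 + r.length ∧
        a₁.v 0 + mergePot C.f rem (fun s => (a₁.hd (3 + s)).2) = a.v 0 + Xc G ∧
        a₁.v 18 = P0 + C.f * len ∧
        Keep [0, 15, 16, 17, 18, 21, 22] a a₁ ∧ a₁.fl (a.v 9) = a.fl (a.v 9) ∧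
        i + r.length = G.flatten.length ∧
        C.β * t + 2 * readPot C a₁.hd + 2 * ((P0 + r.length) % C.β) ≤
          2 * (P0 % C.β) + 2 * (min (P0 + C.f * len) src.length - P0) +
        (if P0 + C.f * len ≤ src.length then 0 else 2 * C.β) + 4 * r.length) :=
    ⟨_, fun _ _ _ => Iff.rfl⟩
  refine Ctx.Tr.loop hC rfl Inv (i := G.flatten.length) ((hInv _ _ _).2 ?_)
    (fun i a₁ t hI hc => ?_) fun i a₁ t hI hc => ?_
  · refine ⟨_, [], hM, List.Pairwise.nil, by simp, ?_, ?_, ?_, ?_, hv18, ?_, rfl, by simp, ?_⟩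
    · rw [← hsum0]; simp
    · rw [List.append_nil]
      exact hW.congr (hb 2 (by omega)) rfl
    · simp [hv', h15]
    · simp only [hpot0]; rw [hv' 0 (by simp)]
    · refine ⟨fun i hi => hv' i ?_, fun _ _ _ => rfl, fun σ hσ => hb σ (by omega), fun _ _ => rfl⟩
      simp only [List.mem_cons, List.not_mem_nil, or_false, not_or] at hi
      simp [hi]
    · simp only [hrp, List.length_nil, Nat.add_zero, Nat.mul_zero]
      omega
  · obtain ⟨rem, r, hM₁, hr, hle, hms, hW₁, h15₁, hpot, h18₁, hK₁, hfl₁, hi, hc₁⟩ :=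
      (hInv _ _ _).1 hI
    have e9 : a₁.v 9 = a.v 9 := hK₁.v 9 (by simp)
    have e7 : a₁.v 7 = src.length := (hK₁.v 7 (by simp)).trans h7
    simp [Test.val, Expr.val, h18₁, h15₁, e7] at hc
    have hlt : r.length < G.flatten.length := by omega
    refine Ctx.Tr.mergeStep hC hM₁ ?_ (by rw [e9]; exact hW₁) (by simp [h15₁, hout]) ?_ (by rw [e9]; exact h9)
      (by omega) ?_
    · by_contra hno
      push Not at hno
      have h0 : ∑ s ∈ Finset.range C.f, (rem s : Multiset El) = 0 :=
        Finset.sum_eq_zero fun s hs => by rw [hno s (Finset.mem_range.1 hs)]; rfl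
      rw [h0, add_zero, Multiset.coe_eq_coe] at hms
      have := hms.length_eq
      omega
    · simp [hout]; omega
    intro a₂ b₂ x tl u hb₂ hrem hmin hM₂ hW₂ h15₂ hpot₂ hK₂ hfl₂ hcost₂
    rw [e9] at hW₂ hfl₂
    refine ⟨i - 1, by omega, (hInv _ _ _).2 ⟨_, r ++ [x], hM₂, ?_, ?_, ?_, ?_, ?_, ?_, ?_, ?_, ?_,
      ?_, ?_⟩⟩
    · refine List.pairwise_append.2 ⟨hr, List.pairwise_singleton _ _, fun z hz y hy => ?_⟩
      simp only [List.mem_singleton] at hy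
      subst hy
      exact hle z hz b₂ hb₂ y (by simp [hrem])
    · intro z hz s hs y hy
      have hy' : y ∈ rem s := by
        by_cases hsb : s = b₂
        · subst hsb
          rw [Function.update_self] at hy
          simp [hrem, hy]
        · rwa [Function.update_of_ne hsb] at hy
      rcases List.mem_append.1 hz with hz | hz
      · exact hle z hz s hs y hy'
      · simp only [List.mem_singleton] at hz
        subst hz
        exact hmin s hs y hy'
    · rw [← hms, sum_update_coe hb₂ hrem, ← Multiset.coe_add, add_assoc]
      rfl
    · rw [← List.append_assoc]; exact hW₂
    · rw [h15₂]; simp [hout]; omega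
    · rw [hpot₂, hpot]
    · rw [hK₂.v 18 (by simp), h18₁]
    · exact hK₁.trans (hK₂.mono (by simp))
    · rw [hfl₂, hfl₁]
    · simp only [List.length_append, List.length_singleton]; omega
    · simp only [List.length_append, List.length_singleton, hout] at hcost₂ ⊢
      rw [Nat.mul_add, ← Nat.add_assoc]
      omega
  · obtain ⟨rem, r, hM₁, hr, hle, hms, hW₁, h15₁, hpot, h18₁, hK₁, hfl₁, hi, hc₁⟩ :=
      (hInv _ _ _).1 hI
    have e7 : a₁.v 7 = src.length := (hK₁.v 7 (by simp)).trans h7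
    simp [Test.val, Expr.val, h18₁, h15₁, e7] at hc
    have hcard := congrArg Multiset.card hms
    rw [Multiset.card_add, Multiset.coe_card, Multiset.coe_card] at hcard
    -- The loop ends only when the output reaches the end of the group or of the file, so by
    -- cardinality nothing remains.
    have h0 : ∑ s ∈ Finset.range C.f, (rem s : Multiset El) = 0 := by
      rw [← Multiset.card_eq_zero]
      omega
    rw [h0, add_zero, Multiset.coe_eq_coe] at hms
    have hnil : ∀ s < C.f, rem s = [] := fun s hs => by
      have := (Finset.sum_eq_zero_iff.1 h0) s (Finset.mem_range.2 hs)
      simpa using this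
    rw [mergePot_nil _ hnil] at hpot
    refine h a₁ r _ hr hms hW₁ h15₁ (by omega) h18₁ hK₁ hfl₁ ?_
    have hrl := hms.length_eq
    omega

end

/-! ### Merge passes and external sorting -/

/-- Merge all groups of runs into a new file. -/
def mergePass (d : Bool) : Prog :=
  .assign 15 (.const 0) ;;
  .assign 14 (.const 0) ;;
  .loop (.lt (.reg 14) (.reg 7)) (mergeGroup d ;; .assign 14 (.reg 18)) ;;
  flushE 2 (.sub (.const 5) (.reg 9)) 15 ;;
  .assign 9 (.sub (.const 5) (.reg 9)) ;;
  .assign 13 (.mul (.reg 31) (.reg 13))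

/-- Sort the file of runs. -/
def sortE (d : Bool) : Prog :=
  .assign 13 (.reg 30) ;; .loop (.lt (.reg 13) (.reg 7)) (mergePass d)

theorem IsRuns.eq_nil {L : ℕ} {Rs : List (List El)} (h : IsRuns L Rs)
    (h0 : Rs.flatten.length = 0) : Rs = [] := by
  cases Rs with
  | nil => rfl
  | cons r rs =>
    have := h.2.1
    simp only [List.flatten_cons, List.length_append] at h0
    omega

theorem IsRuns.single {L : ℕ} {Rs : List (List El)} (h : IsRuns L Rs)
    (h0 : Rs.flatten.length ≤ L) : Asc Rs.flatten ∧ Xc Rs = 0 := by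
  match Rs, h with
  | [], _ => exact ⟨List.Pairwise.nil, rfl⟩
  | [r], h => exact ⟨by simpa using h.1, Xc_singleton r⟩
  | r :: r' :: rs, h =>
    have h1 := h.2.2.2.1 (by simp)
    have h2 := h.2.2.2.2.2.1
    simp only [List.flatten_cons, List.length_append] at h0
    omega

section
variable {C : Ctx} {a : View} {Q : View → ℕ → Prop}

/-- Counter plus `Xc` of the new runs followed by the unmerged old ones is invariant, by `Xc_merge`.
Register 14 always advances by `f * len` and may end beyond the file, hence the minimum in the
invariant. Only the last group can be cut off, which costs at most `2β`, and the final flush costs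
at most `2β` more. -/
theorem Ctx.Tr.mergePass (hC : C.Good) {d : Bool} {Rs : List (List El)} {len : ℕ}
    (hRs : IsRuns len Rs) (hsrc : Holds a (a.v 9) (Rs.flatten.map (enc d)))
    (h7 : a.v 7 = Rs.flatten.length) (h9 : a.v 9 = 2 ∨ a.v 9 = 3) (h13 : a.v 13 = len)
    (hlen : C.β ∣ len) (hlen0 : 0 < len) (hX : Rs.flatten.length + C.f * len < C.X)
    (hK : a.v 0 + Xc Rs < C.X)
    (h : ∀ a' Rs' t, IsRuns (C.f * len) Rs' → Rs'.flatten.Perm Rs.flatten →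
      Holds a' (a'.v 9) (Rs'.flatten.map (enc d)) → a'.v 9 = 5 - a.v 9 → a'.v 13 = C.f * len →
      a'.v 0 + Xc Rs' = a.v 0 + Xc Rs → Keep [0, 9, 13, 14, 15, 16, 17, 18, 21, 22] a a' →
      C.β * t ≤ 6 * Rs.flatten.length + 4 * C.β → Q a' t) :
    C.Tr (mergePass d) a Q := by
  have hX64 := hC.X64
  have hf := hC.f_two
  have hfl0 : 0 < C.f * len := Nat.mul_pos (by omega) hlen0
  refine Ctx.Tr.seq (Ctx.Tr.assign hC (by omega) rfl ?_ ?_)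
  · simp [Expr.val]; omega
  refine Ctx.Tr.seq (Ctx.Tr.assign hC (by omega) rfl ?_ ?_)
  · simp [Expr.val]; omega
  simp only [Expr.val, View.setV, Nat.zero_add]
  obtain ⟨Inv, hInv⟩ : ∃ Inv : ℕ → View → ℕ → Prop, ∀ i a₁ t, Inv i a₁ t ↔
      (∃ Ds, IsRuns (C.f * len) Ds ∧ a₁.v 14 = Ds.length * (C.f * len) ∧
        (a₁.v 14 < Rs.flatten.length → ∀ r ∈ Ds, Asc r ∧ r.length = C.f * len) ∧
        Ds.flatten.length = min (a₁.v 14) Rs.flatten.length ∧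
        a₁.v 15 = Ds.flatten.length ∧
        (Ds.flatten ++ (Rs.drop (Ds.length * C.f)).flatten).Perm Rs.flatten ∧
        a₁.v 0 + Xc (Ds ++ Rs.drop (Ds.length * C.f)) = a.v 0 + Xc Rs ∧
        Written C a₁ 2 (5 - a.v 9) (Ds.flatten.map (enc d)) ∧
        Keep [0, 14, 15, 16, 17, 18, 21, 22] a a₁ ∧ a₁.fl (a.v 9) = a.fl (a.v 9) ∧
        i = Rs.flatten.length - a₁.v 14 ∧
        C.β * t + 2 * (Ds.flatten.length % C.β) ≤ 6 * Ds.flatten.length +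
          (if a₁.v 14 ≤ Rs.flatten.length then 0 else 2 * C.β)) :=
    ⟨_, fun _ _ _ => Iff.rfl⟩
  refine Ctx.Tr.seq (Ctx.Tr.loop₀ hC rfl Inv Rs.flatten.length ((hInv _ _ _).2 ?_)
    (fun i a₁ t hI hc => ?_) fun i a₁ t hI hc => ?_)
  · refine ⟨[], trivial, by simp, by simp, by simp, by simp, by simp, by simp, by simp [Written],
      ?_, rfl, by simp, by simp⟩
    refine ⟨fun i hi => ?_, fun _ _ _ => rfl, fun _ _ => rfl, fun _ _ => rfl⟩
    simp only [List.mem_cons, List.not_mem_nil, or_false, not_or] at hi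
    simp [hi]
  · obtain ⟨Ds, hDs, h14, hfull, hDl, h15, hperm, hpot, hW, hKe, hfl, hi, hcost⟩ :=
      (hInv _ _ _).1 hI
    have e9 : a₁.v 9 = a.v 9 := hKe.v 9 (by simp)
    have e7 : a₁.v 7 = Rs.flatten.length := (hKe.v 7 (by simp)).trans h7
    have e13 : a₁.v 13 = len := (hKe.v 13 (by simp)).trans h13
    simp [Test.val, Expr.val] at hc
    rw [e7] at hc
    replace hDl : Ds.flatten.length = a₁.v 14 := by omega
    set j := Ds.length * C.f with hj
    have hP : a₁.v 14 = j * len := by rw [h14, hj]; ring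
    have hrun := hRs.drop j
    set R := Rs.drop j with hR
    have hRl : a₁.v 14 + R.flatten.length = Rs.flatten.length := by
      have := hperm.length_eq
      rw [List.length_append] at this
      omega
    have hsplit : R.flatten.length = (R.take C.f).flatten.length + (R.drop C.f).flatten.length := by
      rw [← List.length_append, ← List.flatten_append, List.take_append_drop]
    have hGl : (R.take C.f).flatten.length =
        min (a₁.v 14 + C.f * len) Rs.flatten.length - a₁.v 14 := by
      have h1 := hrun.take_length_le C.f
      by_cases hn : R.drop C.f = []
      · rw [hn] at hsplit
        simp only [List.flatten_nil, List.length_nil] at hsplit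
        omega
      · have h2 := hrun.take_length hn
        omega
    have hgetD : ∀ s < C.f, (R.take C.f).getD s [] =
        (Rs.flatten.drop (a₁.v 14 + s * len)).take len := by
      intro s hs
      rw [hP, ← Nat.add_mul, ← hRs.getD, hR]
      simp [List.getD_eq_getElem?_getD, hs, List.getElem?_drop]
    -- Only the multiset of the merged run enters, so the identity can be used before the merge, to
    -- exclude overflow, as well as after it.
    have hXm : ∀ r : List El, r.Perm (R.take C.f).flatten →
        Xc (Ds ++ R) = Xc (Ds ++ [r] ++ R.drop C.f) + Xc (R.take C.f) := by
      intro r hr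
      rw [← Xc_merge _ _ _ hr, List.take_append_drop]
    refine Ctx.Tr.seq (Ctx.Tr.mergeGroup hC (src := Rs.flatten) (out := Ds.flatten)
      (G := R.take C.f) (P0 := a₁.v 14) (len := len) (d := d) ?_ e7 (by rw [e9]; exact h9) rfl e13
      ?_ hlen hlen0 hc (by omega) hgetD ?_ (by simp) hGl (by rw [e9]; exact hW) (by omega) hDl
      (by have := hXm _ (List.Perm.refl _); omega) ?_)
    · rw [e9]; intro p c hp; rw [hfl]; exact hsrc p c hp
    · rw [hP]; exact hlen.mul_left j
    · intro s hs
      rw [List.getD_eq_getElem?_getD]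
      cases hg : (R.take C.f)[s]? with
      | none => exact List.Pairwise.nil
      | some r =>
        exact (hrun.asc (List.mem_of_mem_take (List.mem_of_getElem? hg))).1
    intro a₂ r u hr hrp hW₂ h15₂ h0₂ h18₂ hK₂ hfl₂ hcost₂
    rw [e9] at hW₂ hfl₂
    refine Ctx.Tr.bound fun hvX => ?_
    have h18X := hvX 18 (by omega)
    refine Ctx.Tr.assign hC (by omega) rfl ?_ ?_
    · simpa [Expr.val] using h18X
    simp only [Expr.val, Nat.reduceLT, reduceIte, View.setV, h18₂, Nat.add_zero]
    have hrl := hrp.length_eq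
    have hrasc : IsRuns (C.f * len) (Ds ++ [r]) :=
      IsRuns.concat (hfull hc) hfl0 hr (by omega) (by omega)
    have hjs : (Ds ++ [r]).length * C.f = j + C.f := by
      simp [hj, Nat.add_mul]
    have hdrop : Rs.drop (j + C.f) = R.drop C.f := by rw [hR, List.drop_drop]
    refine ⟨Rs.flatten.length - (a₁.v 14 + C.f * len), by omega, (hInv _ _ _).2 ⟨Ds ++ [r], hrasc,
      ?_, ?_, ?_, ?_, ?_, ?_, ?_, ?_, ?_, ?_, ?_⟩⟩
    · simp [h14, Nat.add_mul]
    · simp only [Function.update_self]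
      intro hlt z hz
      rcases List.mem_append.1 hz with hz | hz
      · exact hfull hc z hz
      · simp only [List.mem_singleton] at hz
        subst hz
        exact ⟨hr, by omega⟩
    · simp only [Function.update_self, List.flatten_append, List.flatten_singleton,
        List.length_append]
      omega
    · simp only [List.flatten_append, List.flatten_singleton, List.length_append, hDl]
      simpa using h15₂
    · rw [hjs, hdrop]
      simp only [List.flatten_append, List.flatten_singleton, List.append_assoc]
      refine List.Perm.trans ?_ hperm
      refine List.Perm.append_left _ ?_
      refine (List.Perm.append_right _ hrp).trans ?_
      rw [← List.flatten_append, List.take_append_drop]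
    · rw [hjs, hdrop]
      have := hXm r hrp
      simp only
      rw [Function.update_of_ne (by omega), h0₂]
      omega
    · rw [List.flatten_append, List.flatten_singleton]
      exact hW₂.congr rfl rfl
    · refine hKe.trans ⟨fun i hi => ?_, hK₂.e, hK₂.buf, hK₂.fl⟩
      have hi' := hi
      simp only [List.mem_cons, List.not_mem_nil, or_false, not_or] at hi'
      simp only
      rw [Function.update_of_ne (by omega)]
      exact hK₂.v i (by simp [hi'])
    · simp only; rw [hfl₂, hfl]
    · simp
    · simp only [Function.update_self, List.flatten_append, List.flatten_singleton,
        List.length_append, Nat.mul_add, hDl] at hcost ⊢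
      rw [if_pos hc.le] at hcost
      omega
  · obtain ⟨Ds, hDs, h14, hfull, hDl, h15, hperm, hpot, hW, hKe, hfl, hi, hcost⟩ :=
      (hInv _ _ _).1 hI
    have e9 : a₁.v 9 = a.v 9 := hKe.v 9 (by simp)
    have e7 : a₁.v 7 = Rs.flatten.length := (hKe.v 7 (by simp)).trans h7
    have e13 : a₁.v 13 = len := (hKe.v 13 (by simp)).trans h13
    simp [Test.val, Expr.val] at hc
    rw [e7] at hc
    have hlen' : Ds.flatten.length = Rs.flatten.length := by omega
    have hR : Rs.drop (Ds.length * C.f) = [] := by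
      refine (hRs.drop _).eq_nil ?_
      have := hperm.length_eq
      rw [List.length_append] at this
      omega
    rw [hR, List.append_nil] at hpot
    rw [hR, List.flatten_nil, List.append_nil] at hperm
    have h5 : (Expr.sub (.const 5) (.reg 9)).val C a₁.v = 5 - a.v 9 := by
      simp [Expr.val, e9]
    refine Ctx.Tr.seq (Ctx.Tr.flushE hC (l := Ds.flatten.map (enc d)) (by omega) (by omega) rfl
      (by decide) (by rw [h5]; omega) (by rw [List.length_map, h15]) (by rw [h5]; exact hW) ?_)
    intro fw u hH hu _
    simp only [h5] at hH ⊢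
    refine Ctx.Tr.seq (Ctx.Tr.assign hC (by omega) rfl ?_ ?_)
    · simp [Expr.val]; omega
    refine Ctx.Tr.assign hC (by omega) rfl ?_ ?_
    · simp [Expr.val, e13]; omega
    simp only [Expr.val, Nat.reduceLT, reduceIte, View.setV, View.setFl, e9, Nat.add_zero]
    have e13' : C.f * Function.update a₁.v 9 (5 - a.v 9) 13 = C.f * len := by
      simp [e13]
    refine h _ Ds _ hDs hperm ?_ (by simp) ?_ ?_ ?_ ?_
    · simp only [ne_eq, Nat.reduceEqDiff, not_false_eq_true, Function.update_of_ne,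
        Function.update_self]
      exact hH
    · simpa using e13'
    · simpa using hpot
    · refine ⟨fun i hi => ?_, hKe.e, hKe.buf, fun φ hφ => ?_⟩
      · simp only [List.mem_cons, List.not_mem_nil, or_false, not_or] at hi
        simp [hi, hKe.v i]
      · simp only
        rw [Function.update_of_ne (by omega)]
        exact hKe.fl φ hφ
    · rw [Nat.mul_add]
      have : C.β * u ≤ 2 * C.β := by rw [mul_comm]; exact Nat.mul_le_mul_right _ hu
      split_ifs at hcost <;> omega

/-- Each pass multiplies the run length by `f`, so at most `L` passes suffice. In the end there is
at most one run; it has no pairs across runs, hence the whole of `Xc Rs` has moved into the counter.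
-/
theorem Ctx.Tr.sortE (hC : C.Good) {d : Bool} {Rs : List (List El)} {L : ℕ}
    (hRs : IsRuns C.β Rs) (hsrc : Holds a (a.v 9) (Rs.flatten.map (enc d)))
    (h7 : a.v 7 = Rs.flatten.length) (h9 : a.v 9 = 2 ∨ a.v 9 = 3)
    (hX : Rs.flatten.length + C.f * Rs.flatten.length < C.X) (hK : a.v 0 + Xc Rs < C.X)
    (hL : Rs.flatten.length ≤ C.β * C.f ^ L)
    (h : ∀ a' S t, Asc S → S.Perm Rs.flatten → Holds a' (a'.v 9) (S.map (enc d)) →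
      (a'.v 9 = 2 ∨ a'.v 9 = 3) → a'.v 0 = a.v 0 + Xc Rs →
      Keep [0, 9, 13, 14, 15, 16, 17, 18, 21, 22] a a' →
      C.β * t ≤ 10 * Rs.flatten.length * L → Q a' t) :
    C.Tr (sortE d) a Q := by
  have hβX := hC.βX
  have hf := hC.f_two
  have hβ := hC.β_pos
  refine Ctx.Tr.seq (Ctx.Tr.assign hC (by omega) rfl ?_ ?_)
  · simpa [Expr.val] using hβX
  simp only [Expr.val, View.setV, Nat.zero_add]
  obtain ⟨Inv, hInv⟩ : ∃ Inv : ℕ → View → ℕ → Prop, ∀ i a₁ t, Inv i a₁ t ↔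
      (∃ Rs' j, IsRuns (a₁.v 13) Rs' ∧ Rs'.flatten.Perm Rs.flatten ∧ a₁.v 13 = C.β * C.f ^ j ∧
        j ≤ L ∧
        Holds a₁ (a₁.v 9) (Rs'.flatten.map (enc d)) ∧ (a₁.v 9 = 2 ∨ a₁.v 9 = 3) ∧
        a₁.v 0 + Xc Rs' = a.v 0 + Xc Rs ∧ Keep [0, 9, 13, 14, 15, 16, 17, 18, 21, 22] a a₁ ∧
        i = Rs.flatten.length - a₁.v 13 ∧ C.β * t ≤ 10 * Rs.flatten.length * j) :=
    ⟨_, fun _ _ _ => Iff.rfl⟩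
  refine Ctx.Tr.loop₀ hC rfl Inv (Rs.flatten.length - C.β) ((hInv _ _ _).2 ?_)
    (fun i a₁ t hI hc => ?_) fun i a₁ t hI hc => ?_
  · refine ⟨Rs, 0, by simpa using hRs, List.Perm.refl _, by simp, by omega, ?_, by simpa using h9,
      by simp, ?_, by simp, by simp⟩
    · simp only [ne_eq, Nat.reduceEqDiff, not_false_eq_true, Function.update_of_ne]; exact hsrc
    · refine ⟨fun i hi => ?_, fun _ _ _ => rfl, fun _ _ => rfl, fun _ _ => rfl⟩
      simp only [List.mem_cons, List.not_mem_nil, or_false, not_or] at hi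
      simp [hi]
  · obtain ⟨Rs', j, hRs', hp, h13, hj, hH, h9', hpot, hKe, hi, hcost⟩ := (hInv _ _ _).1 hI
    have hpl := hp.length_eq
    have e7 : a₁.v 7 = Rs'.flatten.length := ((hKe.v 7 (by simp)).trans h7).trans hpl.symm
    simp [Test.val, Expr.val] at hc
    rw [e7] at hc
    have hpos : 0 < C.f ^ j := Nat.pow_pos (by omega)
    have hβle : C.β ≤ a₁.v 13 := by
      rw [h13]; exact Nat.le_mul_of_pos_right _ hpos
    have hmul : C.f * a₁.v 13 ≤ C.f * Rs.flatten.length := Nat.mul_le_mul_left _ (by omega)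
    refine Ctx.Tr.mergePass hC (len := a₁.v 13) hRs' hH e7 h9' rfl (by rw [h13]; exact Dvd.intro _ rfl)
      (by omega) (by omega) (by omega) ?_
    intro a₂ Rs₂ u hRs₂ hp₂ hH₂ h9₂ h13₂ hpot₂ hK₂ hcost₂
    have h2 : 2 * a₁.v 13 ≤ C.f * a₁.v 13 := Nat.mul_le_mul_right _ hf
    refine ⟨Rs.flatten.length - a₂.v 13, by omega, (hInv _ _ _).2 ⟨Rs₂, j + 1, ?_, hp₂.trans hp, ?_, ?_, hH₂, by omega,
      hpot₂.trans hpot, hKe.trans hK₂, rfl, ?_⟩⟩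
    · rw [h13₂]; exact hRs₂
    · rw [h13₂, h13]; ring
    -- Pass `j` takes place only while `β f^j` is below the length of the file, which is at most `β
    -- f^L`.
    · by_contra hjL
      have hjL' : j = L := by omega
      subst hjL'
      omega
    -- The file is longer than a run, hence longer than `β`, so a pass costs at most `6n + 4β ≤
    -- 10n`.
    · rw [Nat.mul_add, Nat.mul_add]
      omega
  · obtain ⟨Rs', j, hRs', hp, h13, hj, hH, h9', hpot, hKe, hi, hcost⟩ := (hInv _ _ _).1 hI
    have hpl := hp.length_eq
    have e7 : a₁.v 7 = Rs'.flatten.length := ((hKe.v 7 (by simp)).trans h7).trans hpl.symm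
    simp [Test.val, Expr.val] at hc
    rw [e7] at hc
    obtain ⟨h1, h2⟩ := hRs'.single hc
    exact h a₁ _ t h1 hp hH h9' (by omega) hKe (hcost.trans (Nat.mul_le_mul_left _ hj))

end

/-! ### One scan: logical state

`E` are the runs of kept elements, `out` is the output, and `seen` are the elements read so far.
With a threshold `V`, at least `k` red elements are not below `V`, and the red elements above `V`
are kept. -/

structure Split (k K₀ K : ℕ) (V : Option El) (E : List (List El)) (out seen : List El) : Prop where
  count : K + Xc E + cnt out = K₀ + cnt seen
  reds : reds out = reds seen
  above : ∀ z, above z out = above z seen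
  sub : out.Sublist seen
  kept : ∀ z, (∀ y ∈ V, y.2 ≤ z) → ExtMem.above z E.flatten = ExtMem.above z seen
  deep : ∀ y ∈ V, k ≤ seen.countP fun x => x.1 && decide (y.2 ≤ x.2)
  blues : k * blues out ≤ cnt out
  floor : ∀ y ∈ V, ∀ x ∈ E.flatten, x.1 = true → y.2 ≤ x.2
  subperm : E.flatten.Subperm seen

section
variable {k K₀ K K' : ℕ} {V : Option El} {E E' : List (List El)} {out seen : List El} {x : El}

theorem Split.nil (k K₀ : ℕ) : Split k K₀ K₀ none [[]] [] [] :=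
  ⟨by simp [Xc], rfl, fun _ => rfl, List.Sublist.refl _, fun _ _ => rfl, by simp,
    by simp [ExtMem.blues], by simp, by simp⟩

theorem reds_singleton (x : El) : reds [x] = if x.1 then 1 else 0 := by
  simp [reds, List.countP_cons]

theorem blues_singleton (x : El) : blues [x] = if x.1 then 0 else 1 := by
  cases h : x.1 <;> simp [blues, h]

theorem above_singleton_blue (z : ℝ) (hx : x.1 = false) : above z [x] = 0 := by
  simp [above, hx]

theorem above_singleton_le {z : ℝ} (hx : x.2 ≤ z) : above z [x] = 0 := by
  simp [above, hx]

theorem Split.deep_concat (h : Split k K₀ K V E out seen) (x : El) :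
    ∀ y ∈ V, k ≤ (seen ++ [x]).countP fun x => x.1 && decide (y.2 ≤ x.2) := by
  intro y hy
  rw [List.countP_append]
  exact (h.deep y hy).trans (Nat.le_add_right _ _)

/-- The red element goes both to the output and to the kept elements. No pair is counted twice: a
blue element lies in only one of the two places, and its place decides where its pairs are counted.
-/
theorem Split.red_keep (h : Split k K₀ K V E out seen) (hx : x.1 = true)
    (hV : ∀ y ∈ V, y.2 < x.2) (hE : E'.flatten.Perm (x :: E.flatten))
    (hK : K' + Xc E' = K + Xc E + crs E.flatten [x]) :
    Split k K₀ K' V E' (out ++ [x]) (seen ++ [x]) := by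
  refine ⟨?_, ?_, fun z => ?_, h.sub.append (List.Sublist.refl _), fun z hz => ?_,
    h.deep_concat x, ?_, fun y hy z hz hz1 => ?_, ?_⟩
  · rw [cnt_concat, cnt_concat, hK, crs_red _ hx, crs_red _ hx, crs_red _ hx]
    have := h.count
    omega
  · rw [reds_append, reds_append, h.reds]
  · rw [above_append, above_append, h.above]
  · rw [above_perm z hE, above_append, ← h.kept z hz, ← List.singleton_append, above_append,
      add_comm]
  · rw [blues_append, cnt_concat, crs_red _ hx, blues_singleton, hx]
    simpa using h.blues
  · rcases List.mem_cons.1 (hE.mem_iff.1 hz) with rfl | hz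
    · exact (hV y hy).le
    · exact h.floor y hy z hz hz1
  · exact (hE.trans (List.perm_append_singleton x E.flatten).symm).subperm_right.2
      ((List.subperm_append_right _).2 h.subperm)

/-- A red element not above the threshold `y` is not above any `z ≥ y`, so `kept` is unaffected. Its
later partners are below the threshold, too, and will be found in the output. -/
theorem Split.red_skip (h : Split k K₀ K V E out seen) (hx : x.1 = true) {y : El} (hy : y ∈ V)
    (hyx : x.2 ≤ y.2) : Split k K₀ K V E (out ++ [x]) (seen ++ [x]) := by
  refine ⟨?_, ?_, fun z => ?_, h.sub.append (List.Sublist.refl _), fun z hz => ?_,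
    h.deep_concat x, ?_, h.floor, h.subperm.trans (List.sublist_append_left _ _).subperm⟩
  · rw [cnt_concat, cnt_concat, crs_red _ hx, crs_red _ hx]
    have := h.count
    omega
  · rw [reds_append, reds_append, h.reds]
  · rw [above_append, above_append, h.above]
  · rw [above_append, ← h.kept z hz, above_singleton_le (hyx.trans (hz y hy)), add_zero]
  · rw [blues_append, cnt_concat, crs_red _ hx, blues_singleton, hx]
    simpa using h.blues

/-- By `kept`, all red elements above `x` seen so far are among the kept ones, so the pairs of `x`
can be counted there and `x` can be left out of the output. -/
theorem Split.blue_keep (h : Split k K₀ K V E out seen) (hx : x.1 = false)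
    (hV : ∀ y ∈ V, y.2 ≤ x.2) (hE : E'.flatten.Perm (x :: E.flatten))
    (hK : K' + Xc E' = K + Xc E + crs E.flatten [x]) :
    Split k K₀ K' V E' out (seen ++ [x]) := by
  refine ⟨?_, ?_, fun z => ?_, h.sub.trans (List.sublist_append_left _ _), fun z hz => ?_,
    h.deep_concat x, h.blues, fun y hy z hz hz1 => ?_, ?_⟩
  · rw [cnt_concat, hK, crs_blue _ hx, crs_blue _ hx, h.kept _ hV]
    have := h.count
    omega
  · rw [reds_append, h.reds, reds_singleton, hx]
    simp
  · rw [above_append, h.above, above_singleton_blue z hx, add_zero]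
  · rw [above_perm z hE, above_append, ← h.kept z hz, ← List.singleton_append, above_append,
      add_comm]
  · rcases List.mem_cons.1 (hE.mem_iff.1 hz) with rfl | hz
    · simp [hx] at hz1
    · exact h.floor y hy z hz hz1
  · exact (hE.trans (List.perm_append_singleton x E.flatten).symm).subperm_right.2
      ((List.subperm_append_right _).2 h.subperm)

/-- By `deep`, at least `k` red elements read so far are not below the threshold and therefore above
`x`. All of them are in the output, so `x` brings at least `k` pairs into it, and `blues` is
preserved. -/
theorem Split.blue_deep (h : Split k K₀ K V E out seen) (hx : x.1 = false) {y : El} (hy : y ∈ V)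
    (hyx : x.2 < y.2) : Split k K₀ K V E (out ++ [x]) (seen ++ [x]) := by
  have hk : k ≤ ExtMem.above x.2 seen := by
    refine (h.deep y hy).trans (List.countP_mono_left fun z _ hz => ?_)
    simp only [Bool.and_eq_true, decide_eq_true_eq] at hz ⊢
    exact ⟨hz.1, hyx.trans_le hz.2⟩
  refine ⟨?_, ?_, fun z => ?_, h.sub.append (List.Sublist.refl _), fun z hz => ?_,
    h.deep_concat x, ?_, h.floor, h.subperm.trans (List.sublist_append_left _ _).subperm⟩
  · rw [cnt_concat, cnt_concat, crs_blue _ hx, crs_blue _ hx, h.above]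
    have := h.count
    omega
  · rw [reds_append, reds_append, h.reds]
  · rw [above_append, above_append, h.above]
  · rw [above_append, ← h.kept z hz, above_singleton_blue z hx, add_zero]
  · rw [blues_append, cnt_concat, crs_blue _ hx, blues_singleton, hx, h.above]
    have := h.blues
    simp [Nat.mul_add]
    omega

theorem above_filter (z : ℝ) (l : List El) : above z (l.filter fun x => x.1) = above z l := by
  unfold above
  rw [List.countP_filter]
  refine List.countP_congr fun x _ => ?_
  simp +contextual

/-- After sorting, the pairs inside `E` are counted and its blue elements are done, as they cannot
have partners further on. The red elements in `P` are not above the new threshold and may be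
dropped, too. Either nothing is cut off and the threshold stays, or `y` is the least element of `T`,
which has at least `k` red elements. -/
theorem Split.epoch (h : Split k K₀ K V E out seen) {V' : Option El} {P T : List El}
    (hPT : (P ++ T).Perm E.flatten) (hE : E'.flatten.Perm (T.filter fun x => x.1))
    (hK : K' = K + Xc E) (hV : (P = [] ∧ V' = V) ∨ ∃ y, V' = some y ∧ y ∈ T ∧ y.1 = true ∧
      (∀ z ∈ P, z.2 ≤ y.2) ∧ (∀ z ∈ T, y.2 ≤ z.2) ∧ k ≤ ExtMem.reds T) :
    Split k K₀ K' V' E' out seen ∧ Xc E' = 0 := by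
  have hX : Xc E' = 0 := by
    refine Xc_eq_zero ?_
    rw [blues_perm hE, ExtMem.blues, List.countP_filter, List.countP_eq_zero]
    simp
  have hsubT : (T.filter fun x => x.1).Subperm E.flatten :=
    (List.filter_sublist.trans (List.sublist_append_right P T)).subperm.trans hPT.subperm
  have hsub : E'.flatten.Subperm seen := (hE.subperm.trans hsubT).trans h.subperm
  have hab : ∀ z, ExtMem.above z E.flatten = ExtMem.above z P + ExtMem.above z E'.flatten := by
    intro z
    rw [← above_perm z hPT, above_append, above_perm z hE, above_filter]
  have hc : K' + Xc E' + cnt out = K₀ + cnt seen := by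
    rw [hX, hK]
    exact h.count
  rcases hV with ⟨rfl, rfl⟩ | ⟨y, rfl, hyT, hy1, hP, hT, hk⟩
  · refine ⟨⟨hc, h.reds, h.above, h.sub, fun z hz => ?_, h.deep, h.blues, fun y hy z hz hz1 => ?_,
      hsub⟩, hX⟩
    · rw [← h.kept z hz, hab z]
      simp [ExtMem.above]
    · exact h.floor y hy z (hsubT.subset (hE.subset hz)) hz1
  · refine ⟨⟨hc, h.reds, h.above, h.sub, fun z hz => ?_, fun y' hy' => ?_, h.blues,
      fun y' hy' z hz hz1 => ?_, hsub⟩, hX⟩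
    · have hyz := hz y rfl
      -- The old `kept` applies to `z` because the threshold never decreases: `y` is a red element
      -- of `E`, hence by `floor` not below the old threshold.
      rw [← h.kept z fun y' hy' => ?_, hab z]
      · have : ExtMem.above z P = 0 := by
          unfold ExtMem.above
          rw [List.countP_eq_zero]
          intro w hw
          have := (hP w hw).trans hyz
          simp [this]
        omega
      · exact (h.floor y' hy' y (hPT.subset (by simp [hyT])) hy1).trans hyz
    · obtain rfl : y = y' := by simpa using hy'
      refine hk.trans ?_
      refine le_trans ?_ (List.Subperm.countP_le _ (hsubT.trans h.subperm))
      rw [List.countP_filter]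
      refine List.countP_mono_left fun z hz hz1 => ?_
      have := hT z hz
      simp [this, hz1]
    · obtain rfl : y = y' := by simpa using hy'
      exact hT z (List.mem_of_mem_filter (hE.subset hz))

end

/-! ### Extraction of the largest red elements -/

/-- Build a new file from the `k` largest red elements of the sorted file. -/
def extractE (d : Bool) : Prog :=
  .assign 19 (.reg 7) ;;
  .assign 7 (.const 0) ;;
  .assign 20 (.const 0) ;;
  loadBlk (.const 3) (.reg 9) (.div (.sub (.reg 19) (.const 1)) (.reg 30)) ;;
  .assign 9 (.sub (.const 5) (.reg 9)) ;;
  .loop (.and (.lt (.const 0) (.reg 19)) (.lt (.reg 20) (.reg 6)))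
    (.ite (.lt (.const 0) (.mod (.reg 19) (.reg 30))) .skip
        (loadBlk (.const 3) (.sub (.const 5) (.reg 9))
          (.div (.sub (.reg 19) (.const 1)) (.reg 30))) ;;
      .assign 19 (.sub (.reg 19) (.const 1)) ;;
      loadE 0 (.const 3) (.mod (.reg 19) (.reg 30)) ;;
      .ite (redT d 0)
        (insertE d ;;
          .assign 20 (.add (.reg 20) (.const 1)) ;;
          .ite (.lt (.reg 20) (.reg 6)) .skip (copyE 2 0 ;; .assign 8 (.const 1)))
        .skip)


/-- The state of the scan outside of the file of kept elements is unchanged. -/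
structure Outer (a a' : View) : Prop where
  v : ∀ i ∈ [1, 2, 3, 5, 6, 23], a'.v i = a.v i
  buf : ∀ σ < 2, a'.buf σ = a.buf σ
  fl : ∀ φ < 2, a'.fl φ = a.fl φ

theorem Outer.trans {a b c : View} (h : Outer a b) (h' : Outer b c) : Outer a c :=
  ⟨fun i hi => (h'.v i hi).trans (h.v i hi), fun σ hσ => (h'.buf σ hσ).trans (h.buf σ hσ),
    fun φ hφ => (h'.fl φ hφ).trans (h.fl φ hφ)⟩

section
variable {C : Ctx} {a : View} {Q : View → ℕ → Prop}

/-- The sorted file is `P ++ T` with `T` already scanned from the top. The `k`-th red element met is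
the new threshold, and the order of the file bounds `P` and `T` by it. If the file is exhausted
before, all red elements are kept and the old threshold stays in force. -/
theorem Ctx.Tr.extractE (hC : C.Good) {d : Bool} {S : List El} (hS : Asc S)
    (hsrc : Holds a (a.v 9) (S.map (enc d))) (h7 : a.v 7 = S.length)
    (h9 : a.v 9 = 2 ∨ a.v 9 = 3) (hk : 0 < a.v 6)
    (h : ∀ a' full part P T t, Building C d a' full part → P ++ T = S →
      (full.flatten ++ part).Perm (T.filter fun x => x.1) → reds T ≤ a.v 6 →
      a'.v 9 = 5 - a.v 9 → a'.v 0 = a.v 0 → Outer a a' →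
      ((P = [] ∧ a'.v 8 = a.v 8 ∧ a'.e 2 = a.e 2) ∨ (a'.v 8 = 1 ∧ ∃ y, a'.e 2 = enc d y ∧ y ∈ T ∧
        y.1 = true ∧ (∀ z ∈ P, z.2 ≤ y.2) ∧ (∀ z ∈ T, y.2 ≤ z.2) ∧ a.v 6 ≤ reds T)) →
      C.β * t + 2 * part.length ≤ 4 * S.length + 4 * C.β → Q a' t) :
    C.Tr (extractE d) a Q := by
  refine Ctx.Tr.bound fun hvX => ?_
  have h7X := hvX 7 (by omega)
  have h0X := hvX 0 (by omega)
  have hX64 := hC.X64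
  have hβ := hC.β_pos
  have hf := hC.f_two
  refine Ctx.Tr.seq (Ctx.Tr.assign hC (by omega) rfl ?_ ?_)
  · simpa [Expr.val] using h7X
  refine Ctx.Tr.seq (Ctx.Tr.assign hC (by omega) rfl ?_ ?_)
  · simp [Expr.val]; omega
  refine Ctx.Tr.seq (Ctx.Tr.assign hC (by omega) rfl ?_ ?_)
  · simp [Expr.val]; omega
  simp only [Expr.val, Nat.reduceLT, reduceIte, View.setV, Nat.zero_add, h7]
  refine Ctx.Tr.seq (Ctx.Tr.loadBlk hC rfl rfl ?_ ?_ ?_)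
  · simp [Expr.val]; omega
  · simp [Expr.val]; omega
  simp only [Expr.val, Nat.reduceLT, reduceIte, View.setBuf]
  refine Ctx.Tr.seq (Ctx.Tr.assign hC (by omega) rfl ?_ ?_)
  · simp [Expr.val]; omega
  simp only [Expr.val, Nat.reduceLT, reduceIte, View.setV, Nat.zero_add]
  obtain ⟨Inv, hInv⟩ : ∃ Inv : ℕ → View → ℕ → Prop, ∀ i a₁ t, Inv i a₁ t ↔
      (∃ full part P T, Building C d a₁ full part ∧ P ++ T = S ∧
        (full.flatten ++ part).Perm (T.filter fun x => x.1) ∧ reds T ≤ a.v 6 ∧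
        a₁.v 9 = 5 - a.v 9 ∧ a₁.v 0 = a.v 0 ∧ a₁.v 19 = P.length ∧ a₁.v 20 = reds T ∧ i = P.length ∧
        Outer a a₁ ∧ a₁.fl (a.v 9) = a.fl (a.v 9) ∧
        (P.length % C.β ≠ 0 → ∀ o < C.β,
          a₁.buf 3 o = a.fl (a.v 9) (P.length / C.β * C.β + o)) ∧
        ((reds T < a.v 6 ∧ a₁.v 8 = a.v 8 ∧ a₁.e 2 = a.e 2) ∨ (a₁.v 8 = 1 ∧ ∃ y, a₁.e 2 = enc d y ∧
          y ∈ T ∧ y.1 = true ∧ (∀ z ∈ P, z.2 ≤ y.2) ∧ (∀ z ∈ T, y.2 ≤ z.2) ∧ a.v 6 ≤ reds T)) ∧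
        C.β * t + 2 * part.length + 2 * (C.β - P.length % C.β) ≤ 4 * T.length + 4 * C.β) :=
    ⟨_, fun _ _ _ => Iff.rfl⟩
  refine Ctx.Tr.loop hC rfl Inv (i := S.length) ((hInv _ _ _).2 ?_)
    (fun i a₁ t hI hc => ?_) fun i a₁ t hI hc => ?_
  · refine ⟨[], [], S, [], ?_, by simp, by simp, by simp [reds], by simp, by simp, by simp,
      by simp [reds], rfl, ?_, rfl, ?_, Or.inl ⟨by simpa [reds] using hk, by simp, rfl⟩, ?_⟩
    · exact ⟨by simp, List.Pairwise.nil, hβ, by simp; omega, by simp, by simp, by simp⟩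
    · refine ⟨fun i hi => ?_, fun σ hσ => ?_, fun _ _ => rfl⟩
      · simp only [List.mem_cons, List.not_mem_nil, or_false] at hi
        rcases hi with rfl | rfl | rfl | rfl | rfl | rfl <;> simp
      · simp only
        rw [Function.update_of_ne (by omega)]
    -- The block fetched in advance has number `(S.length - 1) / β`, which is the last, incomplete
    -- one. If the length is a multiple of `β`, nothing is claimed about the buffer, since the loop
    -- fetches the block itself.
    · intro h0 o ho
      have : (S.length - 1) / C.β = S.length / C.β := by
        have h1 := Nat.div_add_mod S.length C.β
        have h2 := Nat.mod_lt S.length hβ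
        have := div_mod_of_lt (β := C.β) (j := S.length / C.β) (o := S.length % C.β - 1) (by omega)
        rw [← this.1]
        congr 1
        rw [mul_comm]
        omega
      simp [this]
    · simp; omega
  · obtain ⟨full, part, P, T, hB, hPT, hE, hTk, h9₁, h0₁, h19, h20, hi, hO, hfl, hbuf, hV, hcost⟩ :=
      (hInv _ _ _).1 hI
    simp [Test.val, Expr.val, h19, h20, hO.v 6] at hc
    obtain ⟨P', x, rfl⟩ : ∃ P' x, P = P' ++ [x] := by
      refine ⟨P.dropLast, P.getLast ?_, (List.dropLast_append_getLast _).symm⟩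
      rintro rfl
      simp at hc
    have hlen : P'.length + 1 + T.length = S.length := by rw [← hPT]; simp; omega
    simp only [List.length_append, List.length_singleton] at h19 hi hbuf hcost
    have hx : a.fl (a.v 9) P'.length = enc d x := hsrc _ _ (by rw [← hPT]; simp)
    have hVn : reds T < a.v 6 ∧ a₁.v 8 = a.v 8 ∧ a₁.e 2 = a.e 2 := by
      rcases hV with hV | ⟨-, y, -, -, -, -, -, hV⟩
      · exact hV
      · omega
    have hxle : (∀ z ∈ P', z.2 ≤ x.2) ∧ ∀ z ∈ T, x.2 ≤ z.2 := by
      rw [← hPT, List.append_assoc] at hS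
      have h1 := List.pairwise_append.1 hS
      exact ⟨fun z hz => h1.2.2 z hz x (by simp), (List.pairwise_cons.1 h1.2.1).1⟩
    refine Ctx.Tr.seq (Ctx.Tr.mono (Q := fun a₂ u => ∃ b, a₂ = ⟨a₁.v, a₁.e, a₁.hd, b, a₁.fl⟩ ∧
      (∀ σ, σ ≠ 3 → b σ = a₁.buf σ) ∧
      (∀ o < C.β, b 3 o = a.fl (a.v 9) (P'.length / C.β * C.β + o)) ∧
      C.β * u + 2 * (C.β - P'.length % C.β) = 2 * (C.β - (P'.length + 1) % C.β) + 2) ?_ ?_)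
    · rcases succ_div_mod hβ P'.length with ⟨h1, h2, h3⟩ | ⟨h1, h2, h3⟩
      · refine Ctx.Tr.ite hC rfl (fun hc1 => Ctx.Tr.skip ?_) fun hc1 => ?_
        · refine ⟨_, rfl, fun _ _ => rfl, ?_, by omega⟩
          rw [← h3]
          exact hbuf (by omega)
        · simp [Test.val, Expr.val, h19, h2] at hc1
      · refine Ctx.Tr.ite hC rfl (fun hc1 => ?_) fun hc1 => ?_
        · simp [Test.val, Expr.val, h19, h2] at hc1
        · refine Ctx.Tr.loadBlk hC rfl rfl ?_ ?_ ?_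
          · simp [Expr.val]; omega
          · simp [Expr.val, h9₁]; omega
          · simp only [Expr.val, Nat.reduceLT, reduceIte, View.setBuf, h9₁, h19]
            refine ⟨_, rfl, fun σ hσ => by simp [hσ], fun o ho => ?_, ?_⟩
            · rw [show 5 - (5 - a.v 9) = a.v 9 by omega, hfl]
              simp
            · omega
    rintro a₂ u ⟨b, rfl, hb, hb3, hu⟩
    refine Ctx.Tr.seq (Ctx.Tr.assign hC (by omega) rfl ?_ ?_)
    · simp [Expr.val, h19]; omega
    simp only [Expr.val, Nat.reduceLT, reduceIte, View.setV, h19, Nat.add_sub_cancel]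
    refine Ctx.Tr.seq (Ctx.Tr.loadE hC (by omega) rfl rfl ?_ ?_ ?_)
    · simp [Expr.val]; omega
    · simp [Expr.val]; exact Nat.mod_lt _ hβ
    simp only [Expr.val, Nat.reduceLT, reduceIte, View.setE]
    simp only [Function.update_self]
    rw [hb3 _ (Nat.mod_lt _ hβ), Nat.div_add_mod', hx]
    have hredsT : reds (x :: T) = reds T + if x.1 then 1 else 0 := by
      simp [reds, List.countP_cons]
    have hbuf' : P'.length % C.β ≠ 0 → ∀ o < C.β,
        b 3 o = a.fl (a.v 9) (P'.length / C.β * C.β + o) := fun _ => hb3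
    have hlenE : a₁.v 7 = reds T := by
      rw [hB.len, ← flatten_length_of_full hB.runs, ← List.length_append, hE.length_eq]
      rw [reds, List.countP_eq_length_filter]
    have hredle : reds T ≤ T.length := List.countP_le_length
    have hmul : C.β * (t + (u + 0)) = C.β * t + C.β * u := by ring
    refine Ctx.Tr.iteRed hC (x := x) (by omega) (by simp) (fun hx1 => ?_) fun hx1 => ?_
    · rw [hx1, if_pos rfl] at hredsT
      have hB' : Building C d ⟨Function.update a₁.v 19 P'.length,
          Function.update a₁.e 0 (enc d x), a₁.hd, b, a₁.fl⟩ full part := by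
        refine ⟨hB.runs, hB.asc, hB.lt, ?_, ?_, ?_, ?_⟩
        · simpa using hB.file
        · simpa using hB.len
        · simpa using hB.disk
        · simp only [hb 2 (by omega)]
          exact hB.buf
      refine Ctx.Tr.seq (Ctx.Tr.insertE hC (x := x) hB' (by simp) ?_ ?_ ?_)
      · simp [hlenE]; omega
      · rw [crs_red _ hx1]
        simp [h0₁]; omega
      intro v y b' f' w full' part' hv hB₂ hv7 hv0 hp hcw
      have hE' : (full'.flatten ++ part').Perm ((x :: T).filter fun x => x.1) := by
        rw [List.filter_cons_of_pos hx1]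
        exact hp.trans (List.Perm.cons x hE)
      -- Only red elements are inserted, so there are no pairs and the counter stays constant.
      have hX0 : ∀ (A : List (List El)) (r : List El) (l : List El),
          (A.flatten ++ r).Perm (l.filter fun x => x.1) → Xc (A ++ [r]) = 0 := by
        intro A r l hp
        refine Xc_eq_zero ?_
        rw [List.flatten_append, List.flatten_singleton, blues_perm hp, blues, List.countP_filter,
          List.countP_eq_zero]
        simp
      rw [hX0 _ _ _ hE, hX0 _ _ _ hE', crs_red _ hx1] at hv0
      simp only at hv0 hv7 hB₂
      rw [Function.update_of_ne (show (0 : ℕ) ≠ 19 by omega), h0₁] at hv0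
      have hv20 : v 20 = reds T := by rw [hv 20 (by simp)]; simp [h20]
      have hv6 : v 6 = a.v 6 := by rw [hv 6 (by simp)]; simp [hO.v 6]
      have hv9 : v 9 = 5 - a.v 9 := by rw [hv 9 (by simp)]; simp [h9₁]
      simp only [ne_eq, Nat.reduceEqDiff, not_false_eq_true, Function.update_of_ne, h9₁] at hB₂ ⊢
      refine Ctx.Tr.seq (Ctx.Tr.assign hC (by omega) rfl ?_ ?_)
      · simp [Expr.val, hv20]; omega
      simp only [Expr.val, Nat.reduceLT, reduceIte, View.setV, hv20]
      have hfin : ∀ v' e', (∀ i, i ≠ 8 → i ≠ 20 → v' i = v i) → v' 20 = reds T + 1 →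
          ((reds T + 1 < a.v 6 ∧ v' 8 = a.v 8 ∧ e' 2 = a.e 2) ∨
            (reds T + 1 = a.v 6 ∧ v' 8 = 1 ∧ e' 2 = enc d x)) →
          Inv P'.length ⟨v', e', a₁.hd, Function.update b 2 b',
            Function.update a₁.fl (5 - a.v 9) f'⟩ (t + (u + w)) := by
        intro v' e' h1 h2 h3
        refine (hInv _ _ _).2 ⟨full', part', P', x :: T, ?_, by rw [← hPT]; simp, hE',
          by omega, ?_, ?_, ?_, ?_, rfl, ?_, ?_, ?_, ?_, ?_⟩
        · refine ⟨hB₂.runs, hB₂.asc, hB₂.lt, ?_, ?_, ?_, hB₂.buf⟩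
          · simpa [h1 9] using hB₂.file
          · simpa [h1 7] using hB₂.len
          · simpa [h1 9] using hB₂.disk
        · simp [h1 9, hv9]
        · simp only; rw [h1 0 (by omega) (by omega)]; omega
        · simp only; rw [h1 19 (by omega) (by omega), hv 19 (by simp)]; simp
        · simp [h2, hredsT]
        · refine ⟨fun i hi => ?_, fun σ hσ => ?_, fun φ hφ => ?_⟩
          · have := hO.v i hi
            simp only [List.mem_cons, List.not_mem_nil, or_false] at hi
            rw [← this]
            rcases hi with rfl | rfl | rfl | rfl | rfl | rfl <;>
              simp [h1, hv 1 (by simp), hv 2 (by simp), hv 3 (by simp), hv 5 (by simp), hv 6 (by simp), hv 23 (by simp)]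
          · simp only
            rw [Function.update_of_ne (by omega), hb σ (by omega), hO.buf σ hσ]
          · simp only
            rw [Function.update_of_ne (by omega), hO.fl φ hφ]
        · simp only
          rw [Function.update_of_ne (by omega), hfl]
        · simpa using hbuf'
        · rcases h3 with ⟨h4, h5, h6⟩ | ⟨h4, h5, h6⟩
          · exact Or.inl ⟨by omega, h5, h6⟩
          · refine Or.inr ⟨h5, x, h6, by simp, hx1, hxle.1, ?_, by omega⟩
            intro z hz
            rcases List.mem_cons.1 hz with rfl | hz
            · exact le_rfl
            · exact hxle.2 z hz
        · rw [Nat.mul_add, Nat.mul_add, List.length_cons]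
          omega
      refine Ctx.Tr.ite hC rfl (fun hc2 => Ctx.Tr.skip ?_) fun hc2 => ?_
      · simp [Test.val, Expr.val, hv6] at hc2
        refine ⟨P'.length, by omega, ?_⟩
        have := hfin (Function.update v 20 (reds T + 1)) (Function.update (Function.update a₁.e 0 (enc d x)) 1 y)
          (fun i h8 h20 => by simp [h20]) (by simp) (Or.inl ⟨hc2, ?_, ?_⟩)
        · simpa using this
        · rw [Function.update_of_ne (by omega), hv 8 (by simp)]
          simp [hVn]
        · simp [hVn]
      · simp [Test.val, Expr.val, hv6] at hc2
        refine Ctx.Tr.seq (Ctx.Tr.copyE (by omega) (by omega) ?_)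
        refine Ctx.Tr.assign hC (by omega) rfl ?_ ?_
        · simp [Expr.val]; omega
        simp only [Expr.val, View.setE, View.setV]
        refine ⟨P'.length, by omega, ?_⟩
        have := hfin (Function.update (Function.update v 20 (reds T + 1)) 8 1) (Function.update (Function.update
          (Function.update a₁.e 0 (enc d x)) 1 y) 2 (enc d x))
          (fun i h8 h20 => by simp [h20, h8]) (by simp) (Or.inr ⟨by omega, by simp, by simp⟩)
        simpa using this
    · refine Ctx.Tr.skip ⟨P'.length, by omega, (hInv _ _ _).2 ⟨full, part, P', x :: T, ?_,
        by rw [← hPT]; simp, ?_, ?_, ?_, ?_, by simp, ?_, rfl, ?_, hfl, hbuf', Or.inl ?_, ?_⟩⟩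
      · refine ⟨hB.runs, hB.asc, hB.lt, ?_, ?_, ?_, ?_⟩
        · simpa using hB.file
        · simpa using hB.len
        · simpa using hB.disk
        · simp only [hb 2 (by omega)]
          exact hB.buf
      · rw [List.filter_cons_of_neg (by simp [hx1])]
        exact hE
      · simp [hredsT, hx1, hTk]
      · simp [h9₁]
      · simp [h0₁]
      · simp [h20, hredsT, hx1]
      · refine ⟨fun i hi => ?_, fun σ hσ => ?_, fun φ hφ => hO.fl φ hφ⟩
        · have := hO.v i hi
          simp only [List.mem_cons, List.not_mem_nil, or_false] at hi
          rw [← this]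
          rcases hi with rfl | rfl | rfl | rfl | rfl | rfl <;> simp
        · simp only
          rw [hb σ (by omega), hO.buf σ hσ]
      · simp only [ne_eq, Nat.reduceEqDiff, not_false_eq_true, Function.update_of_ne]
        refine ⟨by simp [hredsT, hx1]; omega, hVn.2.1, ?_⟩
        simp [hVn.2.2]
      · simp only [Nat.add_zero, Nat.mul_add, List.length_cons]
        omega
  · obtain ⟨full, part, P, T, hB, hPT, hE, hTk, h9₁, h0₁, h19, h20, hi, hO, hfl, hbuf, hV, hcost⟩ :=
      (hInv _ _ _).1 hI
    simp [Test.val, Expr.val, h19, h20, hO.v 6] at hc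
    have hTl : P.length + T.length = S.length := by rw [← hPT]; simp
    have hPm := Nat.mod_lt P.length hβ
    refine h a₁ full part P T _ hB hPT hE hTk h9₁ h0₁ hO ?_ ?_
    · rcases hV with ⟨h1, h2, h3⟩ | hV
      · refine Or.inl ⟨?_, h2, h3⟩
        by_contra hne
        have := hc (List.length_pos_iff.2 hne)
        omega
      · exact Or.inr hV
    · omega

end

/-! ### One scan: program

Registers: 1 length of the input file, 2 length of the output file, 3 number of unread elements,
6 number of red elements above the threshold, 8 whether there is a threshold, 23 capacity. Element
registers: 0 current element, 2 threshold. -/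

/-- The file that is read in direction `d`. -/
def inFile (d : Bool) : ℕ := if d then 0 else 1

/-- The file that is written in direction `d`. -/
def outFile (d : Bool) : ℕ := if d then 1 else 0

/-- Sort the kept elements and reduce them to the largest red ones. -/
def epochE (d : Bool) : Prog := flushE 2 (.reg 9) 7 ;; sortE d ;; extractE d

/-- Read the last unread element. -/
def readE (d : Bool) : Prog :=
  .ite (.lt (.const 0) (.mod (.reg 3) (.reg 30))) .skip
    (loadBlk (.const 0) (.const (inFile d)) (.div (.sub (.reg 3) (.const 1)) (.reg 30))) ;;
  .assign 3 (.sub (.reg 3) (.const 1)) ;;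
  loadE 0 (.const 0) (.mod (.reg 3) (.reg 30))

/-- Output or keep the current element. -/
def classifyE (d : Bool) : Prog :=
  .ite (redT d 0)
    (writeE 1 (.const (outFile d)) 2 0 ;;
      .ite (.lt (.reg 8) (.const 1)) (insertE d) (.ite (ltT d 2 0) (insertE d) .skip))
    (.ite (.lt (.reg 8) (.const 1)) (insertE d)
      (.ite (ltT d 0 2) (writeE 1 (.const (outFile d)) 2 0) (insertE d)))

/-- One scan of the input file. -/
def passE (d : Bool) : Prog :=
  .assign 3 (.reg 1) ;;
  .assign 2 (.const 0) ;;
  .assign 7 (.const 0) ;;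
  .assign 8 (.const 0) ;;
  .assign 9 (.const 2) ;;
  .assign 23 (.mul (.const 3) (.reg 6)) ;;
  loadBlk (.const 0) (.const (inFile d)) (.div (.sub (.reg 3) (.const 1)) (.reg 30)) ;;
  .loop (.lt (.const 0) (.reg 3))
    (readE d ;; classifyE d ;;
      .ite (.and (.lt (.reg 7) (.reg 23)) (.lt (.const 0) (.reg 3))) .skip (epochE d)) ;;
  flushE 1 (.const (outFile d)) 2 ;;
  .assign 1 (.reg 2)

/-- The state of the file of kept elements, the threshold, and the output. -/
structure Scanning (C : Ctx) (d : Bool) (a : View) (V : Option El) (full : List (List El))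
    (part out : List El) : Prop where
  building : Building C d a full part
  file : a.v 9 = 2 ∨ a.v 9 = 3
  flag : a.v 8 = if V.isSome then 1 else 0
  thr : ∀ y ∈ V, a.e 2 = enc d y
  len : a.v 2 = out.length
  written : Written C a 1 (outFile d) (out.map (enc d))

/-- The state of the input is unchanged. -/
structure Rest (d : Bool) (a a' : View) : Prop where
  v : ∀ i ∈ [1, 3, 5, 6, 23], a'.v i = a.v i
  buf : a'.buf 0 = a.buf 0
  fl : a'.fl (inFile d) = a.fl (inFile d)

theorem Rest.trans {d : Bool} {a b c : View} (h : Rest d a b) (h' : Rest d b c) : Rest d a c :=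
  ⟨fun i hi => (h'.v i hi).trans (h.v i hi), h'.buf.trans h.buf, h'.fl.trans h.fl⟩

theorem Rest.refl (d : Bool) (a : View) : Rest d a a := ⟨fun _ _ => rfl, rfl, rfl⟩

theorem inFile_lt (d : Bool) : inFile d < 2 := by cases d <;> simp [inFile]

theorem outFile_lt (d : Bool) : outFile d < 2 := by cases d <;> simp [outFile]

theorem inFile_ne (d : Bool) : inFile d ≠ outFile d := by cases d <;> simp [inFile, outFile]

section
variable {C : Ctx} {a : View} {Q : View → ℕ → Prop} {d : Bool} {V : Option El}
  {full : List (List El)} {part out : List El}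

/-- With the block in slot 2 flushed, the full blocks and the sorted part are runs of length `β`,
with which `Ctx.Tr.sortE` can start. An epoch costs `10 m L` for sorting `m` elements, `4 m + 4β`
for the extraction and `2β` for the flush. -/
theorem Ctx.Tr.epochE (hC : C.Good) {L : ℕ} (hB : Building C d a full part)
    (h9 : a.v 9 = 2 ∨ a.v 9 = 3) (hk : 0 < a.v 6)
    (hX : (full.flatten ++ part).length + C.f * (full.flatten ++ part).length < C.X)
    (hK : a.v 0 + Xc (full ++ [part]) < C.X)
    (hL : (full.flatten ++ part).length ≤ C.β * C.f ^ L)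
    (h : ∀ a' full' part' P T t, Building C d a' full' part' →
      (P ++ T).Perm (full.flatten ++ part) →
      (full'.flatten ++ part').Perm (T.filter fun x => x.1) → reds T ≤ a.v 6 →
      (a'.v 9 = 2 ∨ a'.v 9 = 3) → a'.v 0 = a.v 0 + Xc (full ++ [part]) → Outer a a' →
      ((P = [] ∧ a'.v 8 = a.v 8 ∧ a'.e 2 = a.e 2) ∨ (a'.v 8 = 1 ∧ ∃ y, a'.e 2 = enc d y ∧ y ∈ T ∧
        y.1 = true ∧ (∀ z ∈ P, z.2 ≤ y.2) ∧ (∀ z ∈ T, y.2 ≤ z.2) ∧ a.v 6 ≤ reds T)) →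
      C.β * t + 2 * part'.length ≤ 10 * (full.flatten ++ part).length * L +
        4 * (full.flatten ++ part).length + 6 * C.β → Q a' t) :
    C.Tr (epochE d) a Q := by
  have hβ := hC.β_pos
  have hflen := flatten_length_of_full hB.runs
  have h7 : a.v 7 = (full.flatten ++ part).length := by
    rw [hB.len, List.length_append, hflen]
  set m := (full.flatten ++ part).length with hm
  obtain ⟨Rs, hRs, hRf, hRX⟩ : ∃ Rs, IsRuns C.β Rs ∧ Rs.flatten = full.flatten ++ part ∧
      Xc Rs = Xc (full ++ [part]) := by
    -- Runs are nonempty by definition, so an empty last part has to be left out; this does not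
    -- change `Xc`.
    rcases List.eq_nil_or_concat part with rfl | hne
    · refine ⟨full, IsRuns.of_full hB.runs hβ, by simp, ?_⟩
      simp [Xc_append, Xc]
    · refine ⟨full ++ [part], IsRuns.concat hB.runs hβ hB.asc ?_ hB.lt.le, by simp, rfl⟩
      obtain ⟨l, x, rfl⟩ := hne
      simp
  have hval : (Expr.reg 9).val C a.v = a.v 9 := by simp [Expr.val]
  have hW : Written C a 2 (a.v 9) ((full.flatten ++ part).map (enc d)) := by
    intro p c hp
    rw [List.getElem?_map] at hp
    cases hx : (full.flatten ++ part)[p]? with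
    | none => simp [hx] at hp
    | some x =>
      simp only [hx, Option.map_some, Option.some.injEq] at hp
      rw [← hp, List.length_map, ← hm, ← h7, hB.len, (div_mod_of_lt hB.lt).1]
      have hpm : p < m := by
        by_contra hge
        rw [List.getElem?_eq_none (by omega)] at hx
        simp at hx
      have hdm := Nat.div_add_mod p C.β
      by_cases hpl : p < full.flatten.length
      · rw [if_neg]
        · exact hB.disk p x (by rw [← hx, List.getElem?_append_left hpl])
        · intro h'
          rw [h', mul_comm] at hdm
          omega
      · rw [List.getElem?_append_right (by omega)] at hx
        have hp2 : p = full.length * C.β + (p - full.flatten.length) := by omega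
        have hlt : p - full.flatten.length < C.β := by
          have := hB.lt
          rw [hm, List.length_append] at hpm
          omega
        have := div_mod_of_lt (j := full.length) hlt
        rw [← hp2] at this
        rw [if_pos this.1, this.2]
        exact hB.buf _ x hx
  refine Ctx.Tr.seq (Ctx.Tr.flushE hC (l := (full.flatten ++ part).map (enc d)) (by omega)
    (by omega) rfl (by decide) (by rw [hval]; omega) (by rw [List.length_map, h7]) (by rw [hval]; exact hW) ?_)
  intro f t₁ hH ht₁ _
  rw [hval] at hH ⊢
  refine Ctx.Tr.seq (Ctx.Tr.sortE hC (Rs := Rs) (L := L) (d := d) hRs ?_ ?_ h9 ?_ ?_ ?_ ?_)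
  · rw [hRf]; exact hH
  · rw [hRf]; exact h7
  · rw [hRf]; exact hX
  · rw [hRX]; exact hK
  · rw [hRf]; exact hL
  intro a₂ S t₂ hS hSp hSH h9₂ h0₂ hK₂ hc₂
  rw [hRf] at hSp hc₂
  have hSl := hSp.length_eq
  have e6 : a₂.v 6 = a.v 6 := hK₂.v 6 (by simp)
  have e7 : a₂.v 7 = S.length := by
    rw [hK₂.v 7 (by simp), hSl, ← hm, ← h7]; rfl
  refine Ctx.Tr.extractE hC hS hSH e7 h9₂ (by omega) ?_
  intro a₃ full' part' P T t₃ hB₃ hPT hE hTk h9₃ h0₃ hO hV hc₃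
  have hO₂ : Outer a a₂ := by
    refine ⟨fun i hi => ?_, hK₂.buf, fun φ hφ => ?_⟩
    · simp only [List.mem_cons, List.not_mem_nil, or_false] at hi
      exact hK₂.v i (by rcases hi with rfl | rfl | rfl | rfl | rfl | rfl <;> simp)
    · rw [hK₂.fl φ hφ]
      simp only [View.setFl_fl]
      rw [Function.update_of_ne (by omega)]
  refine h a₃ full' part' P T _ hB₃ (by rw [hPT]; exact hSp) hE (by omega) (by omega) ?_
    (hO₂.trans hO) ?_ ?_
  · rw [h0₃, h0₂, hRX]
    rfl
  · rcases hV with ⟨h1, h2, h3⟩ | ⟨h1, y, h2, h3, h4, h5, h6, h7⟩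
    · refine Or.inl ⟨h1, ?_, ?_⟩
      · rw [h2, hK₂.v 8 (by simp)]; rfl
      · rw [h3, hK₂.e 2 (by omega) (by omega)]; rfl
    · exact Or.inr ⟨h1, y, h2, h3, h4, h5, h6, by omega⟩
  · have : C.β * t₁ ≤ 2 * C.β := by rw [mul_comm]; exact Nat.mul_le_mul_right _ ht₁
    rw [Nat.mul_add, Nat.mul_add]
    rw [hSl, ← hm] at hc₃
    rw [← hm] at hc₂
    omega

theorem Ctx.Tr.scan_write (hC : C.Good) {x : El} (hS : Scanning C d a V full part out)
    (he : a.e 0 = enc d x) (hX : out.length + 1 < C.X)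
    (h : ∀ a' t, Scanning C d a' V full part (out ++ [x]) → Rest d a a' → a'.v 0 = a.v 0 →
      a'.e 0 = a.e 0 → a'.v 7 = a.v 7 →
      C.β * t + 2 * ((out ++ [x]).length % C.β) = 2 * (out.length % C.β) + 2 → Q a' t) :
    C.Tr (ExtMem.writeE 1 (.const (outFile d)) 2 0) a Q := by
  have hval : ∀ v, (Expr.const (outFile d)).val C v = outFile d := fun v => rfl
  have hlt := outFile_lt d
  have h9 := hS.file
  refine Ctx.Tr.writeE hC (l := out.map (enc d)) (by omega) (by omega) (by omega) ?_ ?_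
    (fun _ _ _ => rfl) (by rw [hval]; omega) (by rw [hS.len, List.length_map]) (by simpa using hX)
    (by rw [hval]; exact hS.written) ?_
  · simp [Expr.plain]; omega
  · simp [Expr.size]
  intro b f t hW hc
  simp only [hval, List.length_map, he, View.setFl, View.setBuf, View.setV] at hW hc ⊢
  refine h _ t ⟨?_, ?_, ?_, ?_, ?_, ?_⟩ ⟨fun i hi => ?_, ?_, ?_⟩ ?_ rfl ?_ (by simpa using hc)
  · have hB := hS.building
    refine ⟨hB.runs, hB.asc, hB.lt, ?_, ?_, ?_, ?_⟩
    · simpa using hB.file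
    · simpa using hB.len
    · intro p z hz
      simp only [ne_eq, Nat.reduceEqDiff, not_false_eq_true, Function.update_of_ne]
      rw [Function.update_of_ne (by omega)]
      exact hB.disk p z hz
    · simpa using hB.buf
  · simpa using h9
  · simpa using hS.flag
  · exact hS.thr
  · simp
  · simpa using hW
  · simp only [List.mem_cons, List.not_mem_nil, or_false] at hi
    rcases hi with rfl | rfl | rfl | rfl | rfl <;> simp
  · simp
  · simp only
    rw [Function.update_of_ne (inFile_ne d)]
  · simp
  · simp

theorem Ctx.Tr.scan_insert (hC : C.Good) {x : El} (hS : Scanning C d a V full part out)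
    (he : a.e 0 = enc d x) (hlen : (full.flatten ++ part).length + 1 < C.X)
    (hK : a.v 0 + crs (full.flatten ++ part) [x] < C.X)
    (h : ∀ a' full' part' t, Scanning C d a' V full' part' out → Rest d a a' →
      a'.v 0 + Xc (full' ++ [part']) =
        a.v 0 + Xc (full ++ [part]) + crs (full ++ [part]).flatten [x] →
      (full' ++ [part']).flatten.Perm (x :: (full ++ [part]).flatten) →
      C.β * t + 2 * part'.length = 2 * part.length + 2 → Q a' t) :
    C.Tr (ExtMem.insertE d) a Q := by
  have hlt := outFile_lt d
  have hlt' := inFile_lt d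
  have h9 := hS.file
  have h7 : a.v 7 = (full.flatten ++ part).length := by
    rw [hS.building.len, List.length_append, flatten_length_of_full hS.building.runs]
  refine Ctx.Tr.insertE hC hS.building he (by omega) hK ?_
  intro v y b f t full' part' hv hB h7' hXc hp hc
  refine h _ full' part' t ⟨hB, ?_, ?_, ?_, ?_, ?_⟩ ⟨fun i hi => ?_, ?_, ?_⟩ ?_ ?_ hc
  · simpa [hv 9] using h9
  · simpa [hv 8] using hS.flag
  · simpa using hS.thr
  · simpa [hv 2] using hS.len
  · refine hS.written.congr ?_ ?_
    · simp
    · simp only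
      rw [Function.update_of_ne (by omega)]
  · simp only [List.mem_cons, List.not_mem_nil, or_false] at hi
    exact hv i (by rcases hi with rfl | rfl | rfl | rfl | rfl <;> simp)
  · simp
  · simp only
    rw [Function.update_of_ne (by omega)]
  · simpa using hXc
  · simpa using hp

/-- The branches of the program are the four cases of `Split`; without a threshold every element is
kept. A red element may be both output and inserted, hence the cost 4. -/
theorem Ctx.Tr.classifyE (hC : C.Good) {x : El} {k K₀ : ℕ} {seen : List El}
    (hS : Scanning C d a V full part out)
    (hsp : Split k K₀ (a.v 0) V (full ++ [part]) out seen) (he : a.e 0 = enc d x)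
    (hX : seen.length + 1 < C.X) (hK : K₀ + cnt (seen ++ [x]) < C.X)
    (h : ∀ a' full' part' out' t, Scanning C d a' V full' part' out' →
      Split k K₀ (a'.v 0) V (full' ++ [part']) out' (seen ++ [x]) → Rest d a a' →
      (full' ++ [part']).flatten.length ≤ (full ++ [part]).flatten.length + 1 →
      C.β * t + 2 * part'.length + 2 * (out'.length % C.β) ≤
        2 * part.length + 2 * (out.length % C.β) + 4 → Q a' t) :
    C.Tr (ExtMem.classifyE d) a Q := by
  have hflat : (full ++ [part]).flatten = full.flatten ++ part := by simp
  have hEl := hsp.subperm.length_le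
  have hol := hsp.sub.length_le
  have hk : ∀ y ∈ V, V = some y := fun y hy => hy
  have hcnt : a.v 0 + cnt out + crs seen [x] < C.X := by
    have := hsp.count
    rw [cnt_concat] at hK
    omega
  -- The kept elements are among those seen, so pairs counted at insertion are also pairs of the
  -- input; this keeps the counter below `X`.
  have hcrs : crs (full.flatten ++ part) [x] ≤ crs seen [x] := by
    rw [crs_singleton, crs_singleton, ← hflat]
    exact hsp.subperm.countP_le _
  have hXd : ∀ n, n ≤ seen.length → n + 1 < C.X := fun n hn => by omega
  refine Ctx.Tr.iteRed hC (x := x) (by omega) he (fun hx => ?_) fun hx => ?_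
  · refine Ctx.Tr.seq (Ctx.Tr.scan_write hC hS he (hXd _ hol) ?_)
    intro a₁ t hS₁ hR₁ h0₁ he₁ h7₁ hc₁
    have hins : (∀ y ∈ V, y.2 < x.2) → C.Tr (ExtMem.insertE d) a₁ fun a'' u => Q a'' (t + u) := by
      intro hV
      refine Ctx.Tr.scan_insert hC hS₁ (he₁.trans he) (by rw [← hflat]; exact hXd _ hEl) (by omega) ?_
      intro a₂ full' part' u hS₂ hR₂ hXc hp hc₂
      refine h a₂ full' part' (out ++ [x]) (t + u) hS₂ ?_ (hR₁.trans hR₂) ?_ ?_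
      · exact hsp.red_keep hx hV hp (by rw [hXc, h0₁])
      · rw [hp.length_eq, List.length_cons]
      · rw [Nat.mul_add]; omega
    refine Ctx.Tr.ite hC rfl (fun hc => ?_) fun hc => ?_
    · simp [Test.val, Expr.val, hS₁.flag] at hc
      exact hins (by simp [hc])
    · simp [Test.val, Expr.val, hS₁.flag] at hc
      obtain ⟨y, rfl⟩ := Option.isSome_iff_exists.1 (Option.isSome_iff_ne_none.2 hc)
      refine Ctx.Tr.iteLt (x := y) (y := x) (by omega) (by omega) (hS₁.thr y rfl) (he₁.trans he)
        (fun hyx => hins ?_) fun hxy => Ctx.Tr.skip ?_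
      · rintro y' hy'
        obtain rfl : y = y' := by simpa using hy'
        exact hyx
      · refine h a₁ full part (out ++ [x]) _ hS₁ ?_ hR₁ (by omega) (by rw [Nat.add_zero]; omega)
        rw [h0₁]
        exact hsp.red_skip hx rfl hxy
  · have hins : (∀ y ∈ V, y.2 ≤ x.2) → C.Tr (ExtMem.insertE d) a Q := by
      intro hV
      refine Ctx.Tr.scan_insert hC hS he (by rw [← hflat]; exact hXd _ hEl) (by omega) ?_
      intro a₂ full' part' u hS₂ hR₂ hXc hp hc₂
      refine h a₂ full' part' out u hS₂ ?_ hR₂ ?_ ?_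
      · exact hsp.blue_keep hx hV hp hXc
      · rw [hp.length_eq, List.length_cons]
      · omega
    refine Ctx.Tr.ite hC rfl (fun hc => ?_) fun hc => ?_
    · simp [Test.val, Expr.val, hS.flag] at hc
      exact hins (by simp [hc])
    · simp [Test.val, Expr.val, hS.flag] at hc
      obtain ⟨y, rfl⟩ := Option.isSome_iff_exists.1 (Option.isSome_iff_ne_none.2 hc)
      refine Ctx.Tr.iteLt (x := x) (y := y) (by omega) (by omega) he (hS.thr y rfl)
        (fun hxy => ?_) fun hyx => hins ?_
      · refine Ctx.Tr.scan_write hC hS he (hXd _ hol) ?_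
        intro a₁ t hS₁ hR₁ h0₁ he₁ h7₁ hc₁
        refine h a₁ full part (out ++ [x]) _ hS₁ ?_ hR₁ (by omega) (by omega)
        rw [h0₁]
        exact hsp.blue_deep hx rfl hxy
      · rintro y' hy'
        obtain rfl : y = y' := by simpa using hy'
        exact hyx

/-- A file is read from its end, so it stores the scanned sequence in reverse. The potential `β -
rest.length % β` measures how far the current block is consumed; each element prepays `2/β` for the
next one. -/
theorem Ctx.Tr.readE (hC : C.Good) {rest : List El} {x : El}
    (hin : ∀ p z, ((x :: rest).reverse)[p]? = some z → a.fl (inFile d) p = enc d z)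
    (h3 : a.v 3 = rest.length + 1)
    (hbuf : (rest.length + 1) % C.β ≠ 0 → ∀ o < C.β,
      a.buf 0 o = a.fl (inFile d) ((rest.length + 1) / C.β * C.β + o))
    (h : ∀ b t, (∀ o < C.β, b o = a.fl (inFile d) (rest.length / C.β * C.β + o)) →
      C.β * t + 2 * (C.β - rest.length % C.β) = 2 * (C.β - (rest.length + 1) % C.β) + 2 →
      Q ⟨Function.update a.v 3 rest.length, Function.update a.e 0 (enc d x), a.hd,
        Function.update a.buf 0 b, a.fl⟩ t) :
    C.Tr (ExtMem.readE d) a Q := by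
  refine Ctx.Tr.bound fun hvX => ?_
  have h3X := hvX 3 (by omega)
  have hβ := hC.β_pos
  have hf := hC.f_two
  have hlt := inFile_lt d
  have hx : a.fl (inFile d) rest.length = enc d x := hin _ _ (by simp)
  refine Ctx.Tr.seq (Ctx.Tr.mono (Q := fun a₂ u => ∃ b, a₂ = ⟨a.v, a.e, a.hd, Function.update a.buf 0 b, a.fl⟩ ∧
      (∀ o < C.β, b o = a.fl (inFile d) (rest.length / C.β * C.β + o)) ∧
      C.β * u + 2 * (C.β - rest.length % C.β) = 2 * (C.β - (rest.length + 1) % C.β) + 2) ?_ ?_)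
  · rcases succ_div_mod hβ rest.length with ⟨h1, h2, h4⟩ | ⟨h1, h2, h4⟩
    · refine Ctx.Tr.ite hC rfl (fun hc1 => Ctx.Tr.skip ?_) fun hc1 => ?_
      · refine ⟨a.buf 0, by simp, ?_, by omega⟩
        rw [← h4]
        exact hbuf (by omega)
      · simp [Test.val, Expr.val, h3, h2] at hc1
    · refine Ctx.Tr.ite hC rfl (fun hc1 => ?_) fun hc1 => ?_
      · simp [Test.val, Expr.val, h3, h2] at hc1
      · refine Ctx.Tr.loadBlk hC rfl (by cases d <;> rfl) ?_ ?_ ?_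
        · simp [Expr.val]
        · simp [Expr.val]; omega
        · simp only [Expr.val, Nat.reduceLT, reduceIte, View.setBuf, h3]
          refine ⟨_, rfl, fun o ho => by simp, by omega⟩
  rintro a₂ u ⟨b, rfl, hb, hu⟩
  refine Ctx.Tr.seq (Ctx.Tr.assign hC (by omega) rfl ?_ ?_)
  · simp [Expr.val, h3]; omega
  simp only [Expr.val, Nat.reduceLT, reduceIte, View.setV, h3, Nat.add_sub_cancel]
  refine Ctx.Tr.loadE hC (by omega) rfl rfl ?_ ?_ ?_
  · simp [Expr.val]
  · simp [Expr.val]; exact Nat.mod_lt _ hβ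
  simp only [Expr.val, Nat.reduceLT, reduceIte, View.setE]
  simp only [Function.update_self]
  rw [hb _ (Nat.mod_lt _ hβ), Nat.div_add_mod', hx]
  exact h b _ hb (by simpa using hu)

end
section
variable {C : Ctx} {a : View} {Q : View → ℕ → Prop} {d : Bool}

theorem Rest.of_outer {a' : View} (h : Outer a a') : Rest d a a' :=
  ⟨fun i hi => by
    simp only [List.mem_cons, List.not_mem_nil, or_false] at hi
    exact h.v i (by rcases hi with rfl | rfl | rfl | rfl | rfl <;> simp),
    h.buf 0 (by omega), h.fl _ (inFile_lt d)⟩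

/-- Combines the machine form of an epoch with `Split.epoch`; the threshold as an option is
recovered from the flag in register 8 and element register 2. -/
theorem Ctx.Tr.scan_epoch (hC : C.Good) {L k K₀ : ℕ} {V : Option El}
    {full : List (List El)} {part out seen : List El} (hS : Scanning C d a V full part out)
    (hsp : Split k K₀ (a.v 0) V (full ++ [part]) out seen) (h6 : a.v 6 = k) (hk : 0 < k)
    (hX : (full ++ [part]).flatten.length + C.f * (full ++ [part]).flatten.length < C.X)
    (hK : K₀ + cnt seen < C.X) (hL : (full ++ [part]).flatten.length ≤ C.β * C.f ^ L)
    (h : ∀ a' V' full' part' t, Scanning C d a' V' full' part' out →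
      Split k K₀ (a'.v 0) V' (full' ++ [part']) out seen → Xc (full' ++ [part']) = 0 →
      Rest d a a' → (full' ++ [part']).flatten.length ≤ k →
      C.β * t + 2 * part'.length ≤ 10 * (full ++ [part]).flatten.length * L +
        4 * (full ++ [part]).flatten.length + 6 * C.β → Q a' t) :
    C.Tr (ExtMem.epochE d) a Q := by
  have hflat : ∀ (A : List (List El)) (r : List El), (A ++ [r]).flatten = A.flatten ++ r :=
    fun A r => by simp
  have hcnt := hsp.count
  rw [hflat] at hX hL h
  refine Ctx.Tr.epochE hC (L := L) hS.building hS.file (by omega) hX (by omega) hL ?_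
  intro a' full' part' P T t hB hPT hE hTk h9 h0 hO hV hc
  have hE' : (full' ++ [part']).flatten.Perm (T.filter fun x => x.1) := by
    rw [hflat]; exact hE
  have hlen : (full' ++ [part']).flatten.length ≤ k := by
    rw [hE'.length_eq, ← List.countP_eq_length_filter]
    exact hTk.trans h6.le
  have hPT' : (P ++ T).Perm (full ++ [part]).flatten := by rw [hflat]; exact hPT
  obtain ⟨V', hV', hfl, hth⟩ : ∃ V' : Option El, ((P = [] ∧ V' = V) ∨ ∃ y, V' = some y ∧ y ∈ T ∧
      y.1 = true ∧ (∀ z ∈ P, z.2 ≤ y.2) ∧ (∀ z ∈ T, y.2 ≤ z.2) ∧ k ≤ reds T) ∧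
      (a'.v 8 = if V'.isSome then 1 else 0) ∧ ∀ y ∈ V', a'.e 2 = enc d y := by
    rcases hV with ⟨h1, h2, h3⟩ | ⟨h1, y, h2, h3, h4, h5, h6', h7⟩
    · refine ⟨V, Or.inl ⟨h1, rfl⟩, h2.trans hS.flag, ?_⟩
      rw [h3]
      exact hS.thr
    · refine ⟨some y, Or.inr ⟨y, rfl, h3, h4, h5, h6', by omega⟩, by simp [h1], ?_⟩
      intro y' hy'
      obtain rfl : y = y' := by simpa using hy'
      exact h2
  obtain ⟨hsp', hX'⟩ := hsp.epoch hPT' hE' h0 hV'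
  refine h a' V' full' part' t ⟨hB, h9, hfl, hth, ?_, ?_⟩ hsp' hX' (Rest.of_outer hO) hlen hc
  · rw [hO.v 2 (by simp), hS.len]
  · exact hS.written.congr (hO.buf 1 (by omega)) (hO.fl _ (outFile_lt d))

/-- An epoch leaves at most `k` kept elements and the next one starts at `3k`, so at least `2k`
insertions pay for it through the potential `D * (|E| - k)`. The end of the input triggers a last
epoch whatever the size of `E`, so that no pair across runs stays uncounted; it is paid separately.
-/
theorem Ctx.Tr.passE (hC : C.Good) {l : List El} {k L : ℕ}
    (hin : Holds a (inFile d) (l.reverse.map (enc d))) (h1 : a.v 1 = l.length) (h6 : a.v 6 = k)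
    (hβk : C.β ≤ k) (hX : l.length + 1 < C.X) (hkX : 3 * k + C.f * (3 * k) < C.X)
    (hK : a.v 0 + cnt l < C.X) (hL : 3 * k ≤ C.β * C.f ^ L)
    (h : ∀ a' out t, Holds a' (outFile d) (out.map (enc d)) → a'.v 1 = out.length →
      a'.v 0 + cnt out = a.v 0 + cnt l → reds out = reds l → k * blues out ≤ cnt out →
      out.Sublist l → a'.v 5 = a.v 5 → a'.v 6 = a.v 6 →
      C.β * t ≤ (30 * L + 24) * l.length + 12 * C.β → Q a' t) :
    C.Tr (passE d) a Q := by
  have hX64 := hC.X64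
  have hβ := hC.β_pos
  have hf := hC.f_two
  have hlt := inFile_lt d
  have hlt' := outFile_lt d
  refine Ctx.Tr.seq (Ctx.Tr.assign hC (by omega) rfl ?_ ?_)
  · simp [Expr.val, h1]; omega
  refine Ctx.Tr.seq (Ctx.Tr.assign hC (by omega) rfl ?_ ?_)
  · simp [Expr.val]; omega
  refine Ctx.Tr.seq (Ctx.Tr.assign hC (by omega) rfl ?_ ?_)
  · simp [Expr.val]; omega
  refine Ctx.Tr.seq (Ctx.Tr.assign hC (by omega) rfl ?_ ?_)
  · simp [Expr.val]; omega
  refine Ctx.Tr.seq (Ctx.Tr.assign hC (by omega) rfl ?_ ?_)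
  · simp [Expr.val]; omega
  refine Ctx.Tr.seq (Ctx.Tr.assign hC (by omega) rfl ?_ ?_)
  · simp [Expr.val, h6]; omega
  simp only [Expr.val, Nat.reduceLT, reduceIte, View.setV, Nat.zero_add, h1]
  have e6 : (Function.update (Function.update (Function.update (Function.update (Function.update a.v
      3 l.length) 2 0) 7 0) 8 0) 9 2) 6 = k := by simp [h6]
  simp only [e6]
  refine Ctx.Tr.seq (Ctx.Tr.loadBlk hC rfl (by cases d <;> rfl) ?_ ?_ ?_)
  · simp [Expr.val]
  · simp [Expr.val]; omega
  simp only [Expr.val, Nat.reduceLT, reduceIte, View.setBuf]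
  set v₀ := Function.update (Function.update (Function.update (Function.update (Function.update
    (Function.update a.v 3 l.length) 2 0) 7 0) 8 0) 9 2) 23 (3 * k) with hv₀
  have e3 : v₀ 3 = l.length := by simp [hv₀]
  rw [e3]
  -- A full epoch costs at most `30 k L + 12 k + 6 β`, which by `β ≤ k` is at most `D * 2k`. Per
  -- element this gives `6 + D` for the scan and `D` for the last epoch, in total `30 L + 24`.
  set D := 15 * L + 9 with hD
  obtain ⟨Inv, hInv⟩ : ∃ Inv : ℕ → View → ℕ → Prop, ∀ i a₁ t, Inv i a₁ t ↔
      (∃ V full part out seen rest, l = seen ++ rest ∧ Scanning C d a₁ V full part out ∧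
        Split k (a.v 0) (a₁.v 0) V (full ++ [part]) out seen ∧ a₁.v 3 = rest.length ∧
        i = rest.length ∧ a₁.v 5 = a.v 5 ∧ a₁.v 6 = k ∧ a₁.v 23 = 3 * k ∧
        a₁.fl (inFile d) = a.fl (inFile d) ∧
        (rest.length % C.β ≠ 0 → ∀ o < C.β,
          a₁.buf 0 o = a.fl (inFile d) (rest.length / C.β * C.β + o)) ∧
        (rest ≠ [] → (full ++ [part]).flatten.length < 3 * k) ∧
        (rest = [] → Xc (full ++ [part]) = 0) ∧
        C.β * t + 2 * (C.β - rest.length % C.β) + 2 * (out.length % C.β) + 2 * part.length +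
          D * ((full ++ [part]).flatten.length - k) ≤ 2 * C.β + (6 + D) * seen.length +
          (if rest = [] then D * l.length + 6 * C.β else 0)) :=
    ⟨_, fun _ _ _ => Iff.rfl⟩
  refine Ctx.Tr.seq (Ctx.Tr.loop₀ hC rfl Inv l.length ((hInv _ _ _).2 ?_)
    (fun i a₁ t hI hc => ?_) fun i a₁ t hI hc => ?_)
  · refine ⟨none, [], [], [], [], l, rfl, ⟨⟨by simp, List.Pairwise.nil, hβ, by simp [hv₀],
      by simp [hv₀], by simp, by simp⟩, by simp [hv₀], by simp [hv₀], by simp, by simp [hv₀],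
      by simp [Written]⟩, ?_, e3, rfl, by simp [hv₀], by simp [hv₀, h6], by simp [hv₀], rfl, ?_,
      fun _ => by simp; omega, fun _ => by simp [Xc], ?_⟩
    · have : v₀ 0 = a.v 0 := by simp [hv₀]
      simp only [this]
      exact Split.nil k _
    · intro h0 o ho
      have : (l.length - 1) / C.β = l.length / C.β := by
        have h1 := Nat.div_add_mod l.length C.β
        have h2 := Nat.mod_lt l.length hβ
        have := div_mod_of_lt (β := C.β) (j := l.length / C.β) (o := l.length % C.β - 1) (by omega)
        rw [← this.1]
        congr 1
        rw [mul_comm]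
        omega
      simp [this]
    · simp; omega
  · obtain ⟨V, full, part, out, seen, rest, hl, hS, hsp, h3, hi, h5₁, h6₁, h23, hfl, hbuf, hlt3,
      hXc, hcost⟩ := (hInv _ _ _).1 hI
    simp [Test.val, Expr.val, h3] at hc
    obtain ⟨x, rest, rfl⟩ := List.exists_cons_of_ne_nil (List.length_pos_iff.1 hc)
    have hm3 := hlt3 (by simp)
    rw [if_neg (by simp)] at hcost
    simp only [List.length_cons] at h3 hbuf hcost hi
    refine Ctx.Tr.seq (Ctx.Tr.readE hC (x := x) (rest := rest) ?_ h3 (by rw [hfl]; exact hbuf) ?_)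
    · intro p z hz
      rw [hfl]
      refine hin p _ ?_
      rw [List.getElem?_map, hl, List.reverse_append, List.getElem?_append_left, hz]
      · rfl
      · by_contra hge
        rw [List.getElem?_eq_none (by omega)] at hz
        simp at hz
    intro b u hb hu
    rw [hfl] at hb
    have hl' : l = (seen ++ [x]) ++ rest := by rw [hl]; simp
    have hll : seen.length + 1 + rest.length = l.length := by rw [hl]; simp; omega
    have hcl : cnt (seen ++ [x]) ≤ cnt l := by
      rw [hl', cnt_append (seen ++ [x])]; omega
    set a₂ : View := ⟨Function.update a₁.v 3 rest.length, Function.update a₁.e 0 (enc d x), a₁.hd,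
        Function.update a₁.buf 0 b, a₁.fl⟩ with ha₂
    have hS₂ : Scanning C d a₂ V full part out := by
      have hB := hS.building
      refine ⟨⟨hB.runs, hB.asc, hB.lt, ?_, ?_, ?_, ?_⟩, ?_, ?_, ?_, ?_, ?_⟩
      · simpa [ha₂] using hB.file
      · simpa [ha₂] using hB.len
      · simpa [ha₂] using hB.disk
      · simpa [ha₂] using hB.buf
      · simpa [ha₂] using hS.file
      · simpa [ha₂] using hS.flag
      · simpa [ha₂] using hS.thr
      · simpa [ha₂] using hS.len
      · exact hS.written.congr (by simp [ha₂]) rfl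
    have h0₂ : a₂.v 0 = a₁.v 0 := by simp [ha₂]
    refine Ctx.Tr.seq (Ctx.Tr.classifyE hC (x := x) (k := k) (K₀ := a.v 0) (seen := seen) hS₂
      (by rw [h0₂]; exact hsp) (by simp [ha₂]) (by omega) (by omega) ?_)
    intro a₃ full' part' out' w hS₃ hsp₃ hR₃ hm' hw
    have e3₃ : a₃.v 3 = rest.length := by rw [hR₃.v 3 (by simp)]; simp [ha₂]
    have e5₃ : a₃.v 5 = a.v 5 := by rw [hR₃.v 5 (by simp)]; simp [ha₂, h5₁]
    have e6₃ : a₃.v 6 = k := by rw [hR₃.v 6 (by simp)]; simp [ha₂, h6₁]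
    have e23₃ : a₃.v 23 = 3 * k := by rw [hR₃.v 23 (by simp)]; simp [ha₂, h23]
    have e7₃ : a₃.v 7 = (full' ++ [part']).flatten.length := by
      rw [hS₃.building.len, List.flatten_append, List.length_append,
        flatten_length_of_full hS₃.building.runs]
      simp
    have hfl₃ : a₃.fl (inFile d) = a.fl (inFile d) := by rw [hR₃.fl]; exact hfl
    have hbuf₃ : a₃.buf 0 = b := by rw [hR₃.buf]; simp [ha₂]
    have hDm : D * ((full' ++ [part']).flatten.length - k) ≤
        D * ((full ++ [part]).flatten.length - k) + D := by
      rw [← Nat.mul_succ]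
      exact Nat.mul_le_mul_left _ (by omega)
    have hDs : (6 + D) * (seen ++ [x]).length = (6 + D) * seen.length + 6 + D := by
      rw [List.length_append, List.length_singleton]; ring
    have hmul : ∀ y, C.β * (t + (u + (w + y))) = C.β * t + C.β * u + C.β * w + C.β * y := by
      intro y; ring
    have hfin : ∀ a₄ V₄ full₄ part₄ y, Scanning C d a₄ V₄ full₄ part₄ out' →
        Split k (a.v 0) (a₄.v 0) V₄ (full₄ ++ [part₄]) out' (seen ++ [x]) → Rest d a₃ a₄ →
        (rest ≠ [] → (full₄ ++ [part₄]).flatten.length < 3 * k) →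
        (rest = [] → Xc (full₄ ++ [part₄]) = 0) →
        C.β * y + 2 * part₄.length + D * ((full₄ ++ [part₄]).flatten.length - k) ≤
          2 * part'.length + D * ((full' ++ [part']).flatten.length - k) +
          (if rest = [] then D * l.length + 6 * C.β else 0) →
        ∃ j < i, Inv j a₄ (t + (u + (w + y))) := by
      intro a₄ V₄ full₄ part₄ y hS₄ hsp₄ hR₄ hm₄ hX₄ hy
      refine ⟨rest.length, by omega, (hInv _ _ _).2 ⟨V₄, full₄, part₄, out', seen ++ [x], rest, hl',
        hS₄, hsp₄, ?_, rfl, ?_, ?_, ?_, ?_, ?_, hm₄, hX₄, ?_⟩⟩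
      · rw [hR₄.v 3 (by simp), e3₃]
      · rw [hR₄.v 5 (by simp), e5₃]
      · rw [hR₄.v 6 (by simp), e6₃]
      · rw [hR₄.v 23 (by simp), e23₃]
      · rw [hR₄.fl, hfl₃]
      · rw [hR₄.buf, hbuf₃]
        exact fun _ => hb
      · rw [hmul, hDs]
        omega
    refine Ctx.Tr.ite hC rfl (fun hc => Ctx.Tr.skip ?_) fun hc => ?_
    · simp only [Test.val, Expr.val, Nat.reduceLT, reduceIte, e7₃, e23₃, e3₃] at hc
      refine hfin a₃ V full' part' 0 hS₃ hsp₃ (Rest.refl d a₃) (fun _ => hc.1) (fun h0 => ?_)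
        (by omega)
      subst h0
      simp at hc
    · simp only [Test.val, Expr.val, Nat.reduceLT, reduceIte, e7₃, e23₃, e3₃] at hc
      set m' := (full' ++ [part']).flatten.length with hm'def
      have hfm : C.f * m' ≤ C.f * (3 * k) := Nat.mul_le_mul_left _ (by omega)
      refine Ctx.Tr.scan_epoch hC (L := L) hS₃ hsp₃ e6₃ (by omega) ?_ (by omega) ?_ ?_
      · rw [← hm'def]; omega
      · rw [← hm'def]; omega
      intro a₄ V₄ full₄ part₄ y hS₄ hsp₄ hX₄ hR₄ hm₄ hy
      refine hfin a₄ V₄ full₄ part₄ y hS₄ hsp₄ hR₄ (fun _ => by omega) (fun _ => hX₄) ?_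
      rw [← hm'def] at hy
      rw [show (full₄ ++ [part₄]).flatten.length - k = 0 by omega, Nat.mul_zero]
      have hml : m' ≤ (seen ++ [x]).length := hsp₃.subperm.length_le
      rw [List.length_append, List.length_singleton] at hml
      -- At the end of the input, the extra term `D * l.length + 6β` pays for the epoch. Otherwise
      -- the capacity `3k` is reached exactly, and the drop of the potential by `2k * D` pays.
      split_ifs with h0
      · have : D * m' ≤ D * l.length := Nat.mul_le_mul_left _ (by omega)
        have h2 : D * m' = 10 * m' * L + 4 * m' + (5 * (m' * L) + 5 * m') := by rw [hD]; ring
        omega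
      · have hr : 0 < rest.length := List.length_pos_iff.2 h0
        have hm3k : m' = 3 * k := by omega
        rw [hm3k] at hy ⊢
        have h2 : D * (3 * k - k) = 10 * (3 * k) * L + 18 * k := by
          rw [show 3 * k - k = 2 * k by omega, hD]; ring
        omega
  · obtain ⟨V, full, part, out, seen, rest, hl, hS, hsp, h3, hi, h5₁, h6₁, h23, hfl, hbuf, hlt3,
      hXc, hcost⟩ := (hInv _ _ _).1 hI
    simp [Test.val, Expr.val, h3] at hc
    subst hc
    rw [List.append_nil] at hl
    subst hl
    have hval : ∀ v, (Expr.const (outFile d)).val C v = outFile d := fun v => rfl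
    refine Ctx.Tr.seq (Ctx.Tr.flushE hC (l := out.map (enc d)) (by omega) (by omega) ?_
      (by simp [Expr.size]) (by rw [hval]; omega) (by rw [List.length_map, hS.len])
      (by rw [hval]; exact hS.written) ?_)
    · simp [Expr.plain]; omega
    intro fw u hH hu _
    rw [hval] at hH ⊢
    have hol := hsp.sub.length_le
    refine Ctx.Tr.assign hC (by omega) rfl ?_ ?_
    · simp [Expr.val, View.setFl, hS.len]; omega
    simp only [Expr.val, Nat.reduceLT, reduceIte, View.setV, View.setFl, hS.len]
    have hcount := hsp.count
    rw [hXc rfl] at hcount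
    refine h _ out _ hH (by simp) (by simpa using hcount) hsp.reds hsp.blues hsp.sub
      (by simpa using h5₁) (by simp [h6₁, h6]) ?_
    have hu2 : C.β * u ≤ 2 * C.β := by rw [mul_comm]; exact Nat.mul_le_mul_right _ hu
    rw [if_pos rfl] at hcost
    have h2 : (30 * L + 24) * l.length = (6 + D) * l.length + D * l.length := by
      rw [hD]; ring
    simp only [Nat.add_zero, Nat.mul_add, List.length_nil, Nat.zero_mod, Nat.sub_zero] at hcost ⊢
    omega

end

/-! ### Rounds of two scans with squared parameters -/

theorem crs_le (l₁ l₂ : List El) : crs l₁ l₂ ≤ reds l₁ * blues l₂ := by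
  induction l₁ with
  | nil => simp
  | cons x l ih =>
    rw [crs_cons_left]
    have h1 : l₂.countP (inv x) ≤ if x.1 then blues l₂ else 0 := by
      split_ifs with hx
      · refine List.countP_mono_left fun y _ hy => ?_
        simp only [inv, Bool.and_eq_true] at hy
        exact hy.1.2
      · rw [Nat.le_zero, List.countP_eq_zero]
        intro y _
        simp [inv, hx]
    have h2 : reds (x :: l) = reds l + if x.1 then 1 else 0 := by simp [reds, List.countP_cons]
    rw [h2, Nat.add_mul]
    split_ifs at * <;> omega

/-- Together with `k * blues ≤ cnt` this gives `k ≤ reds` as soon as a blue element survives, which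
is what makes the rounds stop. -/
theorem cnt_le (l : List El) : cnt l ≤ reds l * blues l := by
  induction l with
  | nil => simp [cnt]
  | cons x l ih =>
    have h1 := crs_le [x] l
    rw [crs_cons_left, crs_nil_left, Nat.add_zero] at h1
    have h2 : reds (x :: l) = reds [x] + reds l := reds_append [x] l
    have h3 : blues (x :: l) = blues [x] + blues l := blues_append [x] l
    rw [cnt, h2, h3]
    nlinarith [Nat.zero_le (reds [x] * blues [x]), Nat.zero_le (reds l * blues [x])]

/-- Scan in both directions. -/
def roundE : Prog := passE true ;; passE false

/-- Scan with growing parameters until no element is left. -/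
def mainLoop : Prog :=
  .assign 5 (.reg 31) ;;
  .loop (.lt (.const 0) (.reg 1))
    (.assign 6 (.mul (.reg 30) (.reg 5)) ;; roundE ;; .assign 5 (.mul (.reg 5) (.reg 5)))

/-- Bound for the number of elements at the start of round `j`. -/
def remBound (β f n T : ℕ) : ℕ → ℕ
  | 0 => n
  | j + 1 => min n (2 * T / (β * f ^ 2 ^ j))

/-- Bound for the cost of `r` rounds. -/
def mainCost (β f n T r : ℕ) : ℕ :=
  ∑ j ∈ Finset.range r, (remBound β f n T j * (60 * (2 ^ j + 2) + 48) + 24 * β)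

section
variable {C : Ctx} {a : View} {Q : View → ℕ → Prop}

/-- The first scan works on the negated image and thins out the red elements of `w`, the second one
the blue elements. Since a scan preserves the elements of its own red color, each color of the
result has at most `T/k` elements, where `T` is the counter plus the pairs of `w`. -/
theorem Ctx.Tr.roundE (hC : C.Good) {w : List El} {k L : ℕ}
    (hin : Holds a 0 (w.map (enc false))) (h1 : a.v 1 = w.length) (h6 : a.v 6 = k)
    (hβk : C.β ≤ k) (hX : w.length + 1 < C.X) (hkX : 3 * k + C.f * (3 * k) < C.X)
    (hK : a.v 0 + cnt w < C.X) (hL : 3 * k ≤ C.β * C.f ^ L)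
    (h : ∀ a' w' t, Holds a' 0 (w'.map (enc false)) → a'.v 1 = w'.length →
      a'.v 0 + cnt w' = a.v 0 + cnt w → w'.length ≤ w.length →
      k * w'.length ≤ 2 * (a.v 0 + cnt w) → (w' ≠ [] → k ≤ w.length) → a'.v 5 = a.v 5 →
      C.β * t ≤ w.length * (60 * L + 48) + 24 * C.β → Q a' t) :
    C.Tr roundE a Q := by
  have hβ := hC.β_pos
  have henc : ∀ (d : Bool) (l : List El), (l.map El.neg).map (enc (!d)) = l.map (enc d) := by
    intro d l
    rw [List.map_map]
    exact List.map_congr_left fun x _ => enc_neg d x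
  refine Ctx.Tr.seq (Ctx.Tr.passE hC (d := true) (l := (w.map El.neg).reverse) (L := L) ?_ ?_ h6 hβk
    ?_ hkX ?_ hL ?_)
  · rw [List.reverse_reverse]
    exact (henc false w).symm ▸ hin
  · simpa using h1
  · simpa using hX
  · rw [cnt_reverse_neg]; exact hK
  intro a₁ o₁ t₁ hH₁ h1₁ h0₁ hr₁ hb₁ hs₁ h5₁ h6₁ hc₁
  rw [cnt_reverse_neg] at h0₁
  have hl₁ := hs₁.length_le
  simp only [List.length_reverse, List.length_map] at hl₁ hc₁
  refine Ctx.Tr.passE hC (d := false) (l := (o₁.map El.neg).reverse) (k := k) (L := L) ?_ ?_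
    (by omega) hβk ?_ hkX ?_ hL ?_
  · rw [List.reverse_reverse]
    exact (henc true o₁).symm ▸ hH₁
  · simpa using h1₁
  · simp; omega
  · rw [cnt_reverse_neg]; omega
  intro a₂ o₂ t₂ hH₂ h1₂ h0₂ hr₂ hb₂ hs₂ h5₂ h6₂ hc₂
  rw [cnt_reverse_neg] at h0₂
  rw [reds_reverse_neg] at hr₂
  have hl₂ := hs₂.length_le
  simp only [List.length_reverse, List.length_map] at hl₂ hc₂
  have hrb := reds_add_blues o₂
  refine h a₂ o₂ _ hH₂ h1₂ (by omega) (by omega) ?_ (fun hne => ?_) (by omega) ?_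
  · rw [← hrb, Nat.mul_add, hr₂]
    omega
  -- An element that survives is blue in the output of the second scan, or comes from a blue one in
  -- the output of the first. In that output there are then at least `k` elements of the other
  -- color.
  · have hpos := List.length_pos_iff.2 hne
    by_cases hb : 0 < blues o₂
    · have := hb₂.trans (cnt_le o₂)
      have := Nat.le_of_mul_le_mul_right this hb
      omega
    · have hb' : 0 < blues o₁ := by omega
      have := hb₁.trans (cnt_le o₁)
      have := Nat.le_of_mul_le_mul_right this hb'
      have := reds_add_blues o₁
      omega
  · have h2 : (30 * L + 24) * o₁.length ≤ (30 * L + 24) * w.length := Nat.mul_le_mul_left _ hl₁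
    have h3 : w.length * (60 * L + 48) = (30 * L + 24) * w.length + (30 * L + 24) * w.length := by
      ring
    rw [Nat.mul_add]
    omega

/-- Squaring register 5 doubles the exponent `2^i` of `f`, so `k` grows doubly exponentially until
it exceeds the number of elements. The invariant remembers that an earlier parameter was at most
`n`, which bounds both the numbers and the number of rounds. -/
theorem Ctx.Tr.mainLoop (hC : C.Good) {w : List El} (hin : Holds a 0 (w.map (enc false)))
    (h1 : a.v 1 = w.length) (hX : (w.length + C.f + C.β + 2) ^ 6 < C.X)
    (hK : a.v 0 + cnt w < C.X)
    (h : ∀ a' r t, a'.v 0 = a.v 0 + cnt w →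
      (r ≤ 1 ∨ C.β * C.f ^ 2 ^ (r - 2) ≤ w.length) →
      C.β * t ≤ mainCost C.β C.f w.length (a.v 0 + cnt w) r → Q a' t) :
    C.Tr mainLoop a Q := by
  have hβ := hC.β_pos
  have hf := hC.f_two
  have hfX := hC.fX
  refine Ctx.Tr.seq (Ctx.Tr.assign hC (by omega) rfl ?_ ?_)
  · simpa [Expr.val] using hfX
  simp only [Expr.val, Nat.reduceLT, reduceIte, View.setV, Nat.zero_add]
  set n := w.length with hn
  set T := a.v 0 + cnt w with hT
  -- All numbers of the loop are bounded by powers of `Y` up to the sixth; the variant is `Y^2 + 1`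
  -- minus the current power of `f`.
  set Y := n + C.f + C.β + 2 with hY
  have hY5 : 5 ≤ Y := by omega
  have hYn : n ≤ Y := by omega
  have hYf : C.f ≤ Y := by omega
  have hYβ : C.β ≤ Y := by omega
  have hY4 : Y ^ 4 ≤ Y ^ 6 := Nat.pow_le_pow_right (by omega) (by omega)
  have hY1 : Y ≤ Y ^ 6 := Nat.le_self_pow (by omega) Y
  obtain ⟨Inv, hInv⟩ : ∃ Inv : ℕ → View → ℕ → Prop, ∀ j a₁ t, Inv j a₁ t ↔
      (∃ w' i, Holds a₁ 0 (w'.map (enc false)) ∧ a₁.v 1 = w'.length ∧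
        a₁.v 5 = C.f ^ 2 ^ i ∧ a₁.v 0 + cnt w' = T ∧ w'.length ≤ remBound C.β C.f n T i ∧
        w'.length ≤ n ∧
        (i = 0 ∨ w' = [] ∨ C.β * C.f ^ 2 ^ (i - 1) ≤ n) ∧
        (i ≤ 1 ∨ C.β * C.f ^ 2 ^ (i - 2) ≤ n) ∧
        C.β * t ≤ mainCost C.β C.f n T i ∧
        j = if w' = [] then 0 else Y ^ 2 + 1 - C.f ^ 2 ^ i) :=
    ⟨_, fun _ _ _ => Iff.rfl⟩
  refine Ctx.Tr.loop₀ hC rfl Inv (if w = [] then 0 else Y ^ 2 + 1 - C.f ^ 2 ^ 0) ((hInv _ _ _).2 ?_)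
    (fun j a₁ t hI hc => ?_) fun i a₁ t hI hc => ?_
  · refine ⟨w, 0, hin, by simpa using h1, by simp, by simp [hT], ?_, le_rfl, Or.inl rfl,
      Or.inl (by omega), by simp, rfl⟩
    simp [remBound, hn]
  · obtain ⟨w', i, hH, h1', h5, h0, hnb, hwn, hi, hi2, hcost, hj⟩ := (hInv _ _ _).1 hI
    simp [Test.val, Expr.val, h1'] at hc
    have hne : w' ≠ [] := List.length_pos_iff.1 hc
    rw [if_neg hne] at hj
    set g := C.f ^ 2 ^ i with hg
    have hgsq : C.f ^ 2 ^ (i + 1) = g * g := by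
      rw [hg, ← pow_add]
      congr 1
      ring
    have hg2 : 2 ≤ g := hf.trans (Nat.le_self_pow (by positivity) _)
    -- The current power is the square of the previous one, and `β` times the previous one was at
    -- most `n`, so `β g ≤ n^2`. In round 0 it is just `f`.
    have hkY : g ≤ Y ^ 2 ∧ C.β * g ≤ Y ^ 2 := by
      rcases hi with rfl | hi | hi
      · have : g = C.f := by simp [hg]
        rw [this, pow_two]
        exact ⟨hYf.trans (Nat.le_mul_of_pos_left _ (by omega)), Nat.mul_le_mul hYβ hYf⟩
      · exact absurd hi hne
      · by_cases hi0 : i = 0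
        · subst hi0
          have : g = C.f := by simp [hg]
          rw [this, pow_two]
          exact ⟨hYf.trans (Nat.le_mul_of_pos_left _ (by omega)), Nat.mul_le_mul hYβ hYf⟩
        · have hgs : g = C.f ^ 2 ^ (i - 1) * C.f ^ 2 ^ (i - 1) := by
            rw [hg, ← pow_add]
            congr 1
            obtain ⟨i', rfl⟩ := Nat.exists_eq_succ_of_ne_zero hi0
            simp [pow_succ]
            ring
          set g' := C.f ^ 2 ^ (i - 1)
          have h2 : C.β * g ≤ Y ^ 2 := by
            rw [hgs, pow_two]
            calc C.β * (g' * g') ≤ (C.β * g') * (C.β * g') := by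
                  rw [← Nat.mul_assoc]
                  exact Nat.mul_le_mul_left _ (Nat.le_mul_of_pos_left _ hβ)
              _ ≤ Y * Y := Nat.mul_le_mul (hi.trans hYn) (hi.trans hYn)
          exact ⟨(Nat.le_mul_of_pos_left _ hβ).trans h2, h2⟩
    have hY2 : Y ^ 2 ≤ Y ^ 6 := Nat.pow_le_pow_right (by omega) (by omega)
    refine Ctx.Tr.seq (Ctx.Tr.assign hC (by omega) rfl ?_ ?_)
    · simp [Expr.val, h5]; omega
    simp only [Expr.val, Nat.reduceLT, reduceIte, View.setV, h5]
    refine Ctx.Tr.seq (Ctx.Tr.roundE hC (w := w') (k := C.β * g) (L := 2 ^ i + 2) hH (by simpa using h1')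
      (by simp) (Nat.le_mul_of_pos_right _ (by omega)) ?_ ?_ ?_ ?_ ?_)
    · omega
    · have h3 : 3 * (C.β * g) + C.f * (3 * (C.β * g)) = (C.β * g) * (3 * (1 + C.f)) := by ring
      have h4 : 3 * (1 + C.f) ≤ Y * Y := Nat.mul_le_mul (by omega) (by omega)
      have h5' : (C.β * g) * (3 * (1 + C.f)) ≤ Y ^ 2 * (Y * Y) := Nat.mul_le_mul hkY.2 h4
      have h6 : Y ^ 2 * (Y * Y) = Y ^ 4 := by ring
      omega
    · simp; omega
    -- The summand 2 in `L = 2^i + 2` absorbs the factor 3 of the capacity `3k`.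
    · have h3 : 3 ≤ C.f ^ 2 := le_trans (by omega) (Nat.pow_le_pow_left hf 2)
      rw [pow_add, ← hg]
      calc 3 * (C.β * g) = C.β * g * 3 := by ring
        _ ≤ C.β * g * C.f ^ 2 := Nat.mul_le_mul_left _ h3
        _ = _ := by ring
    intro a₂ w₂ u hH₂ h1₂ h0₂ hl₂ hk₂ hne₂ h5₂ hc₂
    simp only [ne_eq, Nat.reduceEqDiff, not_false_eq_true, Function.update_of_ne, h5, h0] at h0₂ hk₂ h5₂
    have hg4 : g * g ≤ Y ^ 4 := by
      rw [show Y ^ 4 = Y ^ 2 * Y ^ 2 by ring]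
      exact Nat.mul_le_mul hkY.1 hkY.1
    have hgg : g < g * g := lt_of_lt_of_le (by omega) (Nat.mul_le_mul_right g hg2)
    refine Ctx.Tr.assign hC (by omega) rfl ?_ ?_
    · simp [Expr.val, h5₂]; omega
    simp only [Expr.val, Nat.reduceLT, reduceIte, View.setV, h5₂]
    refine ⟨if w₂ = [] then 0 else Y ^ 2 + 1 - C.f ^ 2 ^ (i + 1), ?_, (hInv _ _ _).2 ⟨w₂, i + 1, hH₂,
      by simpa using h1₂, by simp [hgsq], ?_, ?_, by omega, ?_, ?_, ?_, rfl⟩⟩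
    · rw [hgsq]
      split_ifs <;> omega
    · simpa using h0₂
    · simp only [remBound, ← hg]
      refine le_min (by omega) ?_
      rw [Nat.le_div_iff_mul_le (Nat.mul_pos hβ (by omega)), mul_comm]
      exact hk₂
    · by_cases hw : w₂ = []
      · exact Or.inr (Or.inl hw)
      · exact Or.inr (Or.inr (by simpa [← hg] using (hne₂ hw).trans hwn))
    · rcases hi with rfl | hi | hi
      · exact Or.inl le_rfl
      · exact absurd hi hne
      · by_cases hi0 : i = 0
        · left; omega
        · right
          rwa [show i + 1 - 2 = i - 1 by omega]
    · have h3 : w'.length * (60 * (2 ^ i + 2) + 48) ≤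
          remBound C.β C.f n T i * (60 * (2 ^ i + 2) + 48) := Nat.mul_le_mul_right _ hnb
      simp only [mainCost, Finset.sum_range_succ, Nat.mul_add, Nat.zero_add,
        Nat.add_zero] at hcost hc₂ h3 ⊢
      omega
  · obtain ⟨w', i, hH, h1', h5, h0, hnb, hwn, hi, hi2, hcost, hj⟩ := (hInv _ _ _).1 hI
    simp [Test.val, Expr.val, h1'] at hc
    subst hc
    exact h a₁ i t (by simpa [cnt] using h0) hi2 hcost

end

/-! ### Reading the input -/

/-- Copy input words, from the word with number `reg 24` behind block `b` on, into slot `σ`, with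
first component `k`. -/
def loadRaw (σ k : ℕ) (b : Expr) : Prog :=
  .assign 25 (.const 0) ;;
  .loop (.and (.lt (.reg 25) (.reg 30)) (.lt (.add (.reg 24) (.reg 25)) .inputSize))
    (.ite (.and (.lt (.const 0) (.reg 25))
        (.lt (.const 0) (.mod (.add (.reg 24) (.reg 25)) .blockSize))) .skip
      (.readBlock (.add b (.div (.add (.reg 24) (.reg 25)) .blockSize)) (.const 0)) ;;
    .assign 36 (.const k) ;;
    .assign 37 (.mem (.mod (.add (.reg 24) (.reg 25)) .blockSize)) ;;
    cellStore 36 37 (bufAddr (.const σ) (.reg 25)) ;;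
    .assign 25 (.add (.reg 25) (.const 1)))

/-- Interleave two sequences. -/
noncomputable def mix (R S : ℕ → ℝ) : ℕ → List El
  | 0 => []
  | n + 1 => (mix R S n ++ [(false, S n)]) ++ [(true, R n)]

theorem mix_length (R S : ℕ → ℝ) (n : ℕ) : (mix R S n).length = 2 * n := by
  induction n with
  | zero => rfl
  | succ n ih => simp only [mix, List.length_append, ih, List.length_singleton]; omega

/-- Write the interleaved input to file 0, and its length to register 1. -/
def convert : Prog :=
  .assign 24 (.const 0) ;; .assign 2 (.const 0) ;;
  .loop (.lt (.reg 24) .inputSize)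
    (.ite (.lt (.const 0) (.mod (.reg 24) (.reg 30))) .skip
      (loadRaw 3 0 (.div (.reg 33) (.const 2)) ;; loadRaw 4 1 (.const 0)) ;;
    loadE 0 (.const 3) (.mod (.reg 24) (.reg 30)) ;; writeE 1 (.const 0) 2 0 ;;
    loadE 0 (.const 4) (.mod (.reg 24) (.reg 30)) ;; writeE 1 (.const 0) 2 0 ;;
    .assign 24 (.add (.reg 24) (.const 1))) ;;
  flushE 1 (.const 0) 2 ;; .assign 1 (.reg 2)

section
variable {C : Ctx} {a : View} {Q : View → ℕ → Prop}

theorem Ctx.Rel.readBlock {s : State} (h : C.Rel s a) (j : ℕ) :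
    C.Rel (s.readBlock C.P j 0) a :=
  h.congr (fun _ _ => rfl) (fun i hi => by simp [State.readBlock]; omega) rfl

/-- A window of `β ≤ B` consecutive words meets at most two disk blocks. The scratch block survives
from one word to the next, so a block is read only for the first word and at block boundaries. This
is argued on machine states, as virtual states do not show the scratch block. -/
theorem Ctx.Tr.loadRaw (hC : C.Good) {σ k nb : ℕ} {b : Expr} (hσ : σ < 5) (hk : k < 2)
    (hb : b.plain = true) (hbs : b.size ≤ 2) (hbv : ∀ v, b.val C v = nb)
    (hin : nb + (C.P.N - 1) / C.P.B < C.base)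
    (h : ∀ o g u, (∀ x < C.β, a.v 24 + x < C.P.N → g x =
        (.num k, C.inp (nb + (a.v 24 + x) / C.P.B) ((a.v 24 + x) % C.P.B))) → u ≤ 2 →
      Q ((a.setV 25 o).setBuf σ g) u) :
    C.Tr (loadRaw σ k b) a Q := by
  intro s hs
  have hX := hC.X64
  have hXW := hC.X_le
  have hβ := hC.βX
  have hβ0 := hC.β_pos
  have hM := hC.memory
  have hBβ := hC.β_le
  have hf := hC.f_two
  set i := a.v 24 with hi
  set g : ℕ → ℕ → Cell := fun o x => if x < o then
    (.num k, C.inp (nb + (i + x) / C.P.B) ((i + x) % C.P.B)) else a.buf σ x with hg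
  have hB : 0 < C.P.B := by omega
  refine Wp.seq (Wp.assign (Expr.eval_const (by omega)) ?_)
  simp only [zero_add]
  rw [← funext₂ fun s' u => congrArg (fun n => ∃ a', C.Rel s' a' ∧ Q a' n) (Nat.zero_add u)]
  -- The reads so far are at most the disk blocks met so far. The scratch block holds the block of
  -- the next word, except at the start and when that word begins a new block.
  refine Wp.loop (Q := fun s' u => ∃ a', C.Rel s' a' ∧ Q a' u)
    (fun j s' t => ∃ o, j + o = C.β ∧ C.Rel s' ((a.setV 25 o).setBuf σ (g o)) ∧
      ((o = 0 ∧ t = 0) ∨ (0 < o ∧ t + i / C.P.B ≤ 1 + (i + o - 1) / C.P.B)) ∧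
      (o = 0 ∨ (i + o) % C.P.B = 0 ∨
        ∀ x < C.P.B, s'.mem x = C.inp (nb + (i + o) / C.P.B) x)) ?_ (i := C.β)
    ⟨0, by omega, ?_, Or.inl ⟨rfl, rfl⟩, Or.inl rfl⟩
  · rintro j s₁ t ⟨o, hj, hs₁, ht, hmem⟩
    obtain ⟨c, hc1, hc2⟩ := Test.eval_ok hC hs₁
      (c := .and (.lt (.reg 25) (.reg 30)) (.lt (.add (.reg 24) (.reg 25)) .inputSize)) rfl
    simp only [Test.val, Expr.val, Nat.reduceLT, reduceIte, View.setBuf_v, View.setV_v,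
      Function.update_self, ne_eq, Nat.reduceEqDiff, not_false_eq_true, Function.update_of_ne,
      ← hi] at hc2
    rw [hc1]
    cases c with
    | false =>
      refine Or.inl ⟨rfl, _, hs₁, h o (g o) t ?_ ?_⟩
      · intro x hx hxN
        have : x < o := by
          by_contra hxo
          have : ¬ (o < C.β ∧ i + o < C.P.N) := fun h' => by simpa using hc2.2 h'
          omega
        simp [hg, this]
      · have : (i + o - 1) / C.P.B ≤ i / C.P.B + 1 := by
          rw [← Nat.add_div_right _ hB]
          exact Nat.div_le_div_right (by omega)
        omega
    | true =>
      obtain ⟨ho, hoN⟩ := hc2.1 rfl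
      refine Or.inr ⟨rfl, ?_⟩
      have hblk : (i + o) / C.P.B ≤ (C.P.N - 1) / C.P.B := Nat.div_le_div_right (by omega)
      have hmodlt := Nat.mod_lt (i + o) hB
      have hv24 : ((a.setV 25 o).setBuf σ (g o)).v 24 = i := by simp [hi]
      have hv25 : ((a.setV 25 o).setBuf σ (g o)).v 25 = o := by simp
      have hfirst : Wp C.P (.ite (.and (.lt (.const 0) (.reg 25))
          (.lt (.const 0) (.mod (.add (.reg 24) (.reg 25)) .blockSize))) .skip
          (.readBlock (.add b (.div (.add (.reg 24) (.reg 25)) .blockSize)) (.const 0))) s₁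
          fun s₂ u => C.Rel s₂ ((a.setV 25 o).setBuf σ (g o)) ∧
            t + u + i / C.P.B ≤ 1 + (i + o) / C.P.B ∧
            ∀ x < C.P.B, s₂.mem x = C.inp (nb + (i + o) / C.P.B) x := by
        obtain ⟨c, hc1, hc2⟩ := Test.eval_ok hC hs₁ (c := .and (.lt (.const 0) (.reg 25))
          (.lt (.const 0) (.mod (.add (.reg 24) (.reg 25)) .blockSize))) rfl
        simp only [Test.val, Expr.val, Nat.reduceLT, reduceIte, hv24, hv25] at hc2
        refine Wp.ite hc1 (fun hc => ?_) (fun hc => ?_)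
        · obtain ⟨h1, h2⟩ := hc2.1 hc
          refine Wp.skip ⟨hs₁, ?_, ?_⟩
          · have : (i + o - 1) / C.P.B ≤ (i + o) / C.P.B := Nat.div_le_div_right (by omega)
            omega
          · rcases hmem with h' | h' | h'
            · omega
            · omega
            · exact h'
        · have hval : (Expr.add b (.div (.add (.reg 24) (.reg 25)) .blockSize)).val C
              ((a.setV 25 o).setBuf σ (g o)).v = nb + (i + o) / C.P.B := by
            simp only [Expr.val, Nat.reduceLT, reduceIte, hv24, hv25, hbv]
          have hread := Expr.eval_ok hC hs₁
            (e := .add b (.div (.add (.reg 24) (.reg 25)) .blockSize))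
            (by simp [Expr.ok, Expr.plain, Expr.size, hb]; omega)
          rw [hval] at hread
          refine ⟨1, _, Exec.readBlock hread (Expr.eval_const (by omega)) (by omega),
            hs₁.readBlock _, ?_, ?_⟩
          · rcases ht with ⟨rfl, rfl⟩ | ⟨h1, h2⟩
            · simp
            · have h3 : ¬ (0 < o ∧ 0 < (i + o) % C.P.B) := fun h' => by
                rw [hc2.2 h'] at hc; exact Bool.noConfusion hc
              have h4 : (i + o) % C.P.B = 0 := by omega
              rcases succ_div_mod hB (i + o - 1) with ⟨h5, h6, h7⟩ | ⟨h5, h6, h7⟩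
              · rw [show i + o - 1 + 1 = i + o by omega] at h6
                omega
              · rw [show i + o - 1 + 1 = i + o by omega] at h7
                omega
          · intro x hx
            simp only [State.readBlock, Nat.zero_le, true_and, Nat.zero_add, hx, if_true,
              Nat.sub_zero]
            rw [hs₁.inp _ (by omega)]
      refine Wp.seq (hfirst.mono fun s₂ u ⟨hs₂, hu, hmem₂⟩ => ?_)
      refine Wp.seq (Wp.assign (Expr.eval_const (n := k) (by omega)) ?_)
      have hs₃ := hs₂.temp (r := 36) (.num k) (by omega)
      have haddr := Expr.eval_ok hC hs₃
        (e := .mod (.add (.reg 24) (.reg 25)) .blockSize) rfl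
      simp only [Expr.val, Nat.reduceLT, reduceIte, hv24, hv25] at haddr
      refine Wp.seq (Wp.assign (Expr.eval_mem haddr (by omega) (hmem₂ _ hmodlt)) ?_)
      have hs₄ := hs₃.temp (r := 37) (C.inp (nb + (i + o) / C.P.B) ((i + o) % C.P.B)) (by omega)
      set s₄ : State :=
        { s₂ with
          reg := Function.update (Function.update s₂.reg 36 (.num k)) 37
            (C.inp (nb + (i + o) / C.P.B) ((i + o) % C.P.B)) } with hs₄d
      change C.Rel s₄ _ at hs₄
      have ho' := Expr.eval_ok hC hs₄ (e := .reg 25) rfl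
      simp only [Expr.val, Nat.reduceLT, reduceIte, hv25] at ho'
      refine Wp.seq (cellStore_wp hC (hC.slot_lt (σ := σ) (by omega) ho) (eval_bufAddr hC hs₄
        (Expr.eval_const (by omega)) ho' (by omega) ho) hs₄.cH (by omega) (by omega) ?_)
      have hput : (s₄.reg 36, s₄.reg 37) =
          (Word.num k, C.inp (nb + (i + o) / C.P.B) ((i + o) % C.P.B)) := by
        simp [hs₄d]
      rw [hput]
      have hs₅ := (hs₄.temp (r := 34) (.num (σ * (C.β + 1) + (o + 1))) (by omega)).setBuf
        (σ := σ) ho (Word.num k, C.inp (nb + (i + o) / C.P.B) ((i + o) % C.P.B))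
      have ho₅ := Expr.eval_ok hC hs₅ (e := .add (.reg 25) (.const 1)) rfl
      simp only [Expr.val, Nat.reduceLT, reduceIte, hv25] at ho₅
      refine Wp.assign ho₅ ⟨j - 1, by omega, o + 1, by omega, ?_, Or.inr ⟨by omega, ?_⟩, ?_⟩
      · have hs₆ := (hs₅.setV (r := 25) (x := o + 1) (by omega) (by omega)).buf_ext
          (b := Function.update a.buf σ (g (o + 1))) ?_
        · convert hs₆ using 1
          simp [View.setBuf, View.setV]
        · intro σ' x hx
          by_cases hσ' : σ' = σ
          · subst hσ'
            simp only [View.setBuf_buf, Function.update_self, Function.update_apply, hg]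
            by_cases hxo : x = o
            · simp [hxo]
            · simp only [hxo, if_false]
              congr 1
              simp only [eq_iff_iff]
              omega
          · simp [hσ']
      · simp only [Nat.add_zero]
        rw [show i + (o + 1) - 1 = i + o by omega]
        exact hu
      · rcases succ_div_mod hB (i + o) with ⟨h5, h6, h7⟩ | ⟨h5, h6, h7⟩
        · refine Or.inr (Or.inr fun x hx => ?_)
          rw [show i + (o + 1) = i + o + 1 by omega, h7, ← hmem₂ x hx]
          simp only
          rw [C.setCell_mem _ _ _ hx]
        · exact Or.inr (Or.inl h6)
  · have hs₁ := (hs.setV (r := 25) (x := 0) (by omega) (by omega)).buf_ext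
      (b := Function.update a.buf σ (g 0)) ?_
    · exact hs₁
    · intro σ' x hx
      by_cases hσ' : σ' = σ
      · subst hσ'; simp [hg]
      · simp [hσ']

/-- The blue list starts at block `base / 2`. For `β` indices there are at most 4 reads, and each
index yields two output elements at `2/β` transfers each: 8 in total per index in units of `1/β`.
The extra `6β` is for the last incomplete group and the flush. -/
theorem Ctx.Tr.convert (hC : C.Good) {R S : ℕ → ℝ} (hX : 2 * C.P.N + 1 < C.X)
    (hin : C.base / 2 + (C.P.N - 1) / C.P.B < C.base)
    (hR : ∀ i < C.P.N, C.inp (i / C.P.B) (i % C.P.B) = .key (R i))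
    (hS : ∀ i < C.P.N, C.inp (C.base / 2 + i / C.P.B) (i % C.P.B) = .key (S i))
    (h : ∀ a' t, a'.v 0 = a.v 0 → a'.v 1 = 2 * C.P.N →
      Holds a' 0 ((mix R S C.P.N).map (enc false)) → C.β * t ≤ 8 * C.P.N + 6 * C.β → Q a' t) :
    C.Tr convert a Q := by
  have hβ := hC.β_pos
  have hf := hC.f_two
  have hX64 := hC.X64
  refine Ctx.Tr.seq (Ctx.Tr.assign hC (by omega) rfl (by simp [Expr.val]; omega) ?_)
  refine Ctx.Tr.seq (Ctx.Tr.assign hC (by omega) rfl (by simp [Expr.val]; omega) ?_)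
  simp only [Expr.val, View.setV, Nat.zero_add]
  obtain ⟨Inv, hInv⟩ : ∃ Inv : ℕ → View → ℕ → Prop, ∀ j a₁ t, Inv j a₁ t ↔
      (∃ k, j + k = C.P.N ∧ a₁.v 24 = k ∧ a₁.v 2 = 2 * k ∧ a₁.v 0 = a.v 0 ∧
        Written C a₁ 1 0 ((mix R S k).map (enc false)) ∧
        (k % C.β = 0 ∨ ∀ x < C.β, k - k % C.β + x < C.P.N →
          a₁.buf 3 x = enc false (false, S (k - k % C.β + x)) ∧
          a₁.buf 4 x = enc false (true, R (k - k % C.β + x))) ∧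
        C.β * t + 2 * (2 * k % C.β) ≤ 8 * k + (if k % C.β = 0 then 0 else 4 * (C.β - k % C.β))) :=
    ⟨_, fun _ _ _ => Iff.rfl⟩
  refine Ctx.Tr.seq (Ctx.Tr.loop₀ hC rfl Inv C.P.N ((hInv _ _ _).2 ?_)
    (fun j a₁ t hI hc => ?_) fun j a₁ t hI hc => ?_)
  · exact ⟨0, by simp, by simp, by simp, by simp, Written.nil _ _ _ _, by simp, by simp⟩
  · obtain ⟨k, hj, h24, h2, h0, hw, hbuf, ht⟩ := (hInv _ _ _).1 hI
    simp [Test.val, Expr.val, h24] at hc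
    have hmod := Nat.mod_lt k hβ
    have hkk := Nat.mod_le k C.β
    set m := k - k % C.β with hm
    have hfirst : C.Tr (.ite (.lt (.const 0) (.mod (.reg 24) (.reg 30))) .skip
        (ExtMem.loadRaw 3 0 (.div (.reg 33) (.const 2)) ;; ExtMem.loadRaw 4 1 (.const 0))) a₁
        fun a₂ u => a₂.v 24 = k ∧ a₂.v 2 = 2 * k ∧ a₂.v 0 = a.v 0 ∧
          Written C a₂ 1 0 ((mix R S k).map (enc false)) ∧
          (∀ x < C.β, m + x < C.P.N → a₂.buf 3 x = enc false (false, S (m + x)) ∧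
            a₂.buf 4 x = enc false (true, R (m + x))) ∧
          u ≤ if k % C.β = 0 then 4 else 0 := by
      refine Ctx.Tr.ite hC rfl (fun hc' => ?_) fun hc' => ?_
      · simp [Test.val, Expr.val, h24] at hc'
        refine Ctx.Tr.skip ⟨h24, h2, h0, hw, ?_, by omega⟩
        exact hbuf.resolve_left (by omega)
      · simp [Test.val, Expr.val, h24] at hc'
        have hmk : m = k := by omega
        refine Ctx.Tr.seq (Ctx.Tr.loadRaw hC (nb := C.base / 2) (by omega) (by omega) rfl
          (by simp [Expr.size]) (fun v => by simp [Expr.val]) hin fun o₁ g₁ u₁ hg₁ hu₁ => ?_)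
        refine Ctx.Tr.loadRaw hC (nb := 0) (by omega) (by omega) rfl
          (by simp [Expr.size]) (fun v => by simp [Expr.val]) (by omega) fun o₂ g₂ u₂ hg₂ hu₂ => ?_
        simp only [View.setBuf_v, View.setV_v, ne_eq, Nat.reduceEqDiff, not_false_eq_true,
          Function.update_of_ne, h24] at hg₁ hg₂
        refine ⟨by simpa using h24, by simpa using h2, by simpa using h0, hw.congr (by simp) rfl,
          fun x hx hxN => ?_, by rw [if_pos hc']; omega⟩
        rw [hmk] at hxN ⊢
        refine ⟨?_, ?_⟩
        · simp [hg₁ x hx hxN, enc, hS _ hxN]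
        · simp only [View.setBuf_buf, Function.update_self, hg₂ x hx hxN, Nat.zero_add,
            hR _ hxN]
          simp [enc]
    refine Ctx.Tr.seq (hfirst.mono fun a₂ u ⟨h24₂, h2₂, h0₂, hw₂, hbuf₂, hu⟩ => ?_)
    obtain ⟨hb3, hb4⟩ := hbuf₂ (k % C.β) hmod (by omega)
    rw [show m + k % C.β = k by omega] at hb3 hb4
    have hval : ∀ {v : ℕ → ℕ}, v 24 = k →
        (Expr.mod (.reg 24) (.reg 30)).val C v = k % C.β := fun hv => by simp [Expr.val, hv]
    refine Ctx.Tr.seq (Ctx.Tr.loadE hC (by omega) rfl rfl (by simp [Expr.val]; omega)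
      (by rw [hval h24₂]; exact hmod) ?_)
    rw [hval h24₂]
    simp only [Expr.val, hb3]
    refine Ctx.Tr.seq (Ctx.Tr.writeE hC (l := (mix R S k).map (enc false)) (by omega) (by omega)
      (by omega) rfl (by simp [Expr.size]) (fun _ _ _ => rfl) (by simp [Expr.val]) ?_ ?_
      (hw₂.congr rfl rfl) fun b₁ f₁ t₁ hw₃ ht₁ => ?_)
    · simpa [mix_length] using h2₂
    · simp only [List.length_map, mix_length]; omega
    simp only [Expr.val, View.setE_e, Function.update_self, List.length_map, mix_length]
      at hw₃ ht₁ ⊢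
    refine Ctx.Tr.seq (Ctx.Tr.loadE hC (by omega) rfl rfl (by simp [Expr.val]; omega)
      (by rw [hval (by simpa using h24₂)]; exact hmod) ?_)
    rw [hval (by simpa using h24₂)]
    simp only [Expr.val, View.setFl_buf, View.setBuf_buf, ne_eq, Nat.reduceEqDiff,
      not_false_eq_true, Function.update_of_ne, View.setV_buf, View.setE_buf, hb4]
    refine Ctx.Tr.seq (Ctx.Tr.writeE hC
      (l := (mix R S k).map (enc false) ++ [enc false (false, S k)]) (by omega) (by omega)
      (by omega) rfl (by simp [Expr.size]) (fun _ _ _ => rfl) (by simp [Expr.val]) ?_ ?_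
      (hw₃.congr rfl rfl) fun b₂ f₂ t₂ hw₄ ht₂ => ?_)
    · simp [mix_length]
    · simp only [List.length_append, List.length_map, mix_length, List.length_singleton]; omega
    simp only [Expr.val, View.setE_e, Function.update_self, List.length_append, List.length_map,
      mix_length, List.length_singleton] at hw₄ ht₂ ⊢
    refine Ctx.Tr.assign hC (by omega) rfl ?_ ?_
    · simp [Expr.val, h24₂]; omega
    refine ⟨j - 1, by omega, (hInv _ _ _).2 ⟨k + 1, by omega, ?_, ?_, ?_, ?_, ?_, ?_⟩⟩
    · simp [Expr.val, h24₂]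
    · simp; omega
    · simpa using h0₂
    · simp only [mix, List.map_append, List.map_cons, List.map_nil]
      exact hw₄.congr rfl rfl
    · rcases succ_div_mod hβ k with ⟨h3, h4, h5⟩ | ⟨h3, h4, h5⟩
      · right
        rw [h4, show k + 1 - (k % C.β + 1) = m by omega]
        simpa using hbuf₂
      · exact Or.inl h4
    · have e1 : 2 * (k + 1) = 2 * k + 1 + 1 := by omega
      rw [e1]
      have e2 : C.β * (t + (u + (0 + (t₁ + (0 + (t₂ + 0)))))) =
        C.β * t + C.β * u + C.β * t₁ + C.β * t₂ := by ring
      rw [e2]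
      have hu' : C.β * u ≤ if k % C.β = 0 then 4 * C.β else 0 := by
        refine (Nat.mul_le_mul_left _ hu).trans ?_
        split_ifs
        · rw [Nat.mul_comm]
        · simp
      rcases succ_div_mod hβ k with ⟨h3, h4, h5⟩ | ⟨h3, h4, h5⟩
      · rw [h4, if_neg (by omega)]
        split_ifs at ht hu' <;> omega
      · rw [h4, if_pos rfl]
        split_ifs at ht hu' <;> omega
  · obtain ⟨k, hj, h24, h2, h0, hw, hbuf, ht⟩ := (hInv _ _ _).1 hI
    simp [Test.val, Expr.val, h24] at hc
    obtain rfl : k = C.P.N := by omega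
    refine Ctx.Tr.seq (Ctx.Tr.flushE hC (l := (mix R S C.P.N).map (enc false)) (by omega) (by omega)
      rfl (by simp [Expr.size]) (by simp [Expr.val]) (by simpa [mix_length] using h2) hw
      fun f u hH hu _ => ?_)
    refine Ctx.Tr.assign hC (by omega) rfl ?_ (h _ _ ?_ ?_ ?_ ?_)
    · simp [Expr.val, h2]; omega
    · simpa using h0
    · simp [Expr.val, h2]
    · exact hH
    · have hmod := Nat.mod_lt C.P.N hβ
      have hu' : C.β * u ≤ C.β * 2 := Nat.mul_le_mul_left _ hu
      have e2 : C.β * (t + (u + 0)) = C.β * t + C.β * u := by ring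
      rw [e2]
      split_ifs at ht <;> omega

end

/-! ### The whole program -/

/-- Compute the constants of the virtual machine. -/
def setup : Prog :=
  .assign 32 (.div (.sub .memSize .blockSize) (.const 2)) ;;
  .assign 34 (.add (.reg 32) (.const 10)) ;;
  .assign 30 (.sub (.div (.reg 34) (.const 5)) (.const 1)) ;;
  .ite (.lt .blockSize (.reg 30)) (.assign 30 .blockSize) .skip ;;
  .assign 31 (.sub (.div (.reg 34) (.add (.reg 30) (.const 1))) (.const 3)) ;;
  .assign 33 (.mul (.const 2) (.div (.sub (.add .inputSize .blockSize) (.const 1)) .blockSize))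

/-- Count the domination pairs. -/
def countPairs : Prog :=
  .ite (.lt (.const 0) .inputSize) (setup ;; convert ;; mainLoop) .skip

/-- There are `V = (M - B)/2 + 10` cells. The block size `β` is the largest value up to `B` that
leaves room for five slots, hence `f ≥ 2` and `B ≤ 10 β`; then `f` is as large as the cells allow.
-/
theorem setup_wp {M B N : ℕ} (red blue : Fin N → ℝ) (hB : 1 ≤ B) (hM : 2 * B ≤ M) (hN : 0 < N) :
    ∃ C : Ctx, C.P = ⟨M, B, N, (N + M) ^ 240⟩ ∧ C.X = (N + M) ^ 20 ∧
      C.base = 2 * ((N + B - 1) / B) ∧ C.inp = initDisk B red blue ∧ C.Good ∧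
      B ≤ 10 * C.β ∧ M ≤ B * C.f ^ 5 ∧ C.f + C.β ≤ 2 * M + 2 ∧
      ∀ Q : State → ℕ → Prop, (∀ s a, C.Rel s a → a.v 0 = 0 → Q s 0) →
        Wp C.P setup (initState B red blue) Q := by
  set Y := N + M with hY
  have hY3 : 3 ≤ Y := by omega
  have hX : 100 * Y + 100 ≤ Y ^ 20 := by
    have h1 : 3 ^ 19 ≤ Y ^ 19 := Nat.pow_le_pow_left hY3 _
    have h2 : 200 ≤ Y ^ 19 := le_trans (by norm_num) h1
    have h3 : 200 * Y ≤ Y ^ 19 * Y := Nat.mul_le_mul_right _ h2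
    rw [pow_succ]
    omega
  have hXW : Y ^ 20 ≤ Y ^ 240 := Nat.pow_le_pow_right (by omega) (by norm_num)
  obtain ⟨H, hH⟩ : ∃ H, H = (M - B) / 2 := ⟨_, rfl⟩
  obtain ⟨V, hV⟩ : ∃ V, V = H + 10 := ⟨_, rfl⟩
  obtain ⟨β, hβ⟩ : ∃ β, β = if B < V / 5 - 1 then B else V / 5 - 1 := ⟨_, rfl⟩
  obtain ⟨f, hf⟩ : ∃ f, f = V / (β + 1) - 3 := ⟨_, rfl⟩
  obtain ⟨base, hbase⟩ : ∃ base, base = 2 * ((N + B - 1) / B) := ⟨_, rfl⟩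
  have hβ1 : 1 ≤ β := by split_ifs at hβ <;> omega
  have hβB : β ≤ B := by split_ifs at hβ <;> omega
  have hβV : (β + 1) * 5 ≤ V := by split_ifs at hβ <;> omega
  have hB10 : B ≤ 10 * β := by split_ifs at hβ <;> omega
  have h5 : 5 ≤ V / (β + 1) := (Nat.le_div_iff_mul_le (by omega)).2 (by rw [Nat.mul_comm]; exact hβV)
  have hslots : (f + 3) * (β + 1) ≤ V := by
    rw [show f + 3 = V / (β + 1) by omega]
    exact Nat.div_mul_le_self _ _
  have hfV : V < (β + 1) * (f + 4) := by
    rw [show f + 4 = V / (β + 1) + 1 by omega]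
    exact Nat.lt_mul_div_succ V (by omega)
  have hf2 : f * 2 ≤ V := le_trans (Nat.mul_le_mul (by omega) (by omega)) hslots
  have hbase2 : (N + B - 1) / B ≤ N := by
    refine Nat.div_le_of_le_mul ?_
    have : (N - 1) * 1 ≤ (N - 1) * B := Nat.mul_le_mul_left _ hB
    have h6 : B * N = (N - 1) * B + B := by
      obtain ⟨n, rfl⟩ : ∃ n, N = n + 1 := ⟨N - 1, by omega⟩
      rw [Nat.add_sub_cancel]; ring
    omega
  -- Maximality of `f` gives `V < (β + 1)(f + 4)`, so `M/B` is at most `4 f + 17`, a linear function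
  -- of `f`. The fifth power dominates it for all `f ≥ 2` and costs only a factor 5 in the
  -- logarithm.
  have hMf : M ≤ B * f ^ 5 := by
    have h6 : (β + 1) * (f + 4) ≤ 2 * B * (f + 4) := Nat.mul_le_mul_right _ (by omega)
    have h7 : 2 * B * (f + 4) = 2 * (B * f) + 8 * B := by ring
    have h8 : M ≤ B * (4 * f + 17) := by
      have : B * (4 * f + 17) = 4 * (B * f) + 17 * B := by ring
      omega
    refine h8.trans (Nat.mul_le_mul_left _ ?_)
    have h9 : 2 ^ 4 ≤ f ^ 4 := Nat.pow_le_pow_left (by omega) _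
    have h10 : 2 ^ 4 * f ≤ f ^ 4 * f := Nat.mul_le_mul_right _ h9
    rw [pow_succ]
    omega
  set C : Ctx := ⟨⟨M, B, N, Y ^ 240⟩, β, f, H, base, Y ^ 20, initDisk B red blue⟩ with hC
  refine ⟨C, rfl, rfl, hbase, rfl, ?_, hB10, hMf, ?_, fun Q hQ => ?_⟩
  · refine ⟨hβ1, hβB, ?_, ?_, ?_, ?_, ?_, ?_, ?_, ?_, ?_, ?_, ?_, ?_⟩ <;> simp only [hC]
    · omega
    · omega
    · omega
    · omega
    · rw [← pow_mul]
    all_goals omega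
  · simp only [hC]; omega
  · have hP : C.P = ⟨M, B, N, Y ^ 240⟩ := rfl
    have hc : ∀ {s : State} {n : ℕ}, n ≤ 10 → (Expr.const n).eval C.P s = some (.num n) :=
      fun hn => Expr.eval_const (by rw [hP]; simp only; omega)
    have hm : ∀ {s : State}, Expr.memSize.eval C.P s = some (.num M) :=
      fun {s} => Expr.eval_memSize (P := C.P) (by rw [hP]; simp only; omega)
    have hb : ∀ {s : State}, Expr.blockSize.eval C.P s = some (.num B) :=
      fun {s} => Expr.eval_blockSize (P := C.P) (by rw [hP]; simp only; omega)
    have hi : ∀ {s : State}, Expr.inputSize.eval C.P s = some (.num N) :=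
      fun {s} => Expr.eval_inputSize (P := C.P) (by rw [hP]; simp only; omega)
    have hW : ∀ {n : ℕ}, n ≤ 100 * Y → n < C.P.W := fun h => by rw [hP]; simp only; omega
    refine Wp.seq (Wp.assign (w := .num H) ?_ ?_)
    · rw [hH]
      exact Expr.eval_div (Expr.eval_sub hm hb (hW (by omega))) (hc (by omega)) (hW (by omega))
    refine Wp.seq (Wp.assign (w := .num V) ?_ ?_)
    · rw [hV]
      exact Expr.eval_add (Expr.eval_reg (by simp)) (hc (by omega)) (hW (by omega))
    refine Wp.seq (Wp.assign (w := .num (V / 5 - 1)) ?_ ?_)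
    · exact Expr.eval_sub (Expr.eval_div (Expr.eval_reg (by simp)) (hc (by omega))
        (hW (by omega))) (hc (by omega)) (hW (by omega))
    set s₃ : State := ⟨Function.update (Function.update (Function.update (fun _ => .num 0) 32
      (.num H)) 34 (.num V)) 30 (.num (V / 5 - 1)), fun _ => .num 0, initDisk B red blue⟩ with hs₃
    change Wp C.P _ s₃ _
    have h30 : s₃.reg 30 = .num (V / 5 - 1) := by simp [s₃]
    have hchoose : Wp C.P (.ite (.lt .blockSize (.reg 30)) (.assign 30 .blockSize) .skip) s₃
        fun s t => t = 0 ∧ s.mem = s₃.mem ∧ s.disk = s₃.disk ∧ s.reg 30 = .num β ∧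
          ∀ r, r ≠ 30 → s.reg r = s₃.reg r := by
      refine Wp.ite (Test.eval_lt hb (Expr.eval_reg h30)) (fun h => Wp.assign hb ?_)
        fun h => Wp.skip ?_
      · rw [decide_eq_true_eq] at h
        rw [if_pos h] at hβ
        exact ⟨rfl, rfl, rfl, by simp [hβ], fun r hr => Function.update_of_ne hr _ _⟩
      · rw [decide_eq_false_iff_not] at h
        rw [if_neg h] at hβ
        exact ⟨rfl, rfl, rfl, by rw [h30, hβ], fun r hr => rfl⟩
    refine Wp.seq (hchoose.mono fun s₄ t ⟨ht, hmem, hdisk, hr30, hreg⟩ => ?_)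
    subst ht
    have h34 : s₄.reg 34 = .num V := by rw [hreg _ (by omega)]; simp [s₃]
    refine Wp.seq (Wp.assign (w := .num f) ?_ ?_)
    · rw [hf]
      have : V / (β + 1) ≤ V := Nat.div_le_self _ _
      exact Expr.eval_sub (Expr.eval_div (Expr.eval_reg h34) (Expr.eval_add (Expr.eval_reg hr30)
        (hc (by omega)) (hW (by omega))) (hW (by omega))) (hc (by omega)) (hW (by omega))
    refine Wp.assign (w := .num base) ?_ ?_
    · rw [hbase]
      exact Expr.eval_mul (hc (by omega)) (Expr.eval_div (Expr.eval_sub (Expr.eval_add hi hb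
        (hW (by omega))) (hc (by omega)) (hW (by omega))) hb (hW (by omega))) (hW (by omega))
    have hreg' : ∀ r, ¬ (30 ≤ r ∧ r < 35) → s₄.reg r = .num 0 := by
      intro r hr
      rw [hreg _ (by omega)]
      simp only [s₃]
      rw [Function.update_of_ne (by omega), Function.update_of_ne (by omega),
        Function.update_of_ne (by omega)]
    set s₆ : State := ⟨Function.update (Function.update s₄.reg 31 (.num f)) 33 (.num base),
      s₄.mem, s₄.disk⟩ with hs₆
    change Q s₆ 0
    have hreg₆ : ∀ r, ¬ (30 ≤ r ∧ r < 35) → s₆.reg r = .num 0 := by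
      intro r hr
      simp only [s₆]
      rw [Function.update_of_ne (by omega), Function.update_of_ne (by omega), hreg' _ hr]
    have hcell : ∀ c, C.cell s₆ c = (.num 0, .num 0) := by
      intro c
      unfold Ctx.cell
      split_ifs
      · simp only [s₆, hmem]; rfl
      · rw [hreg₆ _ (by omega), hreg₆ _ (by omega)]
    -- The initial contents of the four files are whatever the disk holds behind the input.
    refine hQ s₆ ⟨fun _ => 0, fun _ => (.num 0, .num 0), fun _ => (0, 0),
      fun _ _ => (.num 0, .num 0), fun φ p =>
        (s₆.disk (C.base + 2 * (4 * (p / C.β) + φ)) (p % C.β),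
          s₆.disk (C.base + 2 * (4 * (p / C.β) + φ) + 1) (p % C.β))⟩ ?_ rfl
    have hXpos : 0 < C.X := by simp only [hC]; omega
    refine ⟨fun i hi => hreg₆ _ (by omega), fun _ _ => hXpos, ?_, ?_, ?_, ?_, ?_, ?_, ?_, ?_, ?_, ?_⟩
    · simp [s₆, hr30, hC]
    · simp [s₆, hC]
    · simp only [s₆, hC]
      rw [Function.update_of_ne (by omega), Function.update_of_ne (by omega), hreg _ (by omega)]
      simp [s₃]
    · simp [s₆, hC]
    · intro r hr
      rw [hreg₆ _ (by omega), hreg₆ _ (by omega)]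
      exact ⟨rfl, rfl⟩
    · intro σ _
      exact hcell _
    · exact fun _ _ => ⟨hXpos, hXpos⟩
    · exact fun σ _ o _ => hcell _
    · exact fun φ _ p => ⟨rfl, rfl⟩
    · intro j _
      simp only [s₆, hdisk]
      rfl


/-! ### Estimates -/

theorem remBound_le {β f n T : ℕ} (j : ℕ) : remBound β f n T j ≤ n := by
  cases j with
  | zero => exact le_rfl
  | succ j => exact min_le_left _ _

theorem two_mul_le_two_pow_add_one (l : ℕ) : 2 * l ≤ 2 ^ l + 1 := by
  induction l with
  | zero => simp
  | succ l ih =>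
    have := Nat.one_le_two_pow (n := l)
    rcases Nat.eq_zero_or_pos l with rfl | hl
    · simp
    · have : 2 ^ 1 ≤ 2 ^ l := Nat.pow_le_pow_right (by omega) hl
      rw [pow_succ]
      omega

/-- Put `q = f^(2^l)`. The parameter of round `l + 1` is `β q^2`, while `T` is at most `5 n β q`;
hence at most `10 n / q` elements remain, and `q ≥ 2^(2^l)` exceeds half of `4^l`. -/
theorem remBound_add_two_le {β f n T i l : ℕ} (hβ : 0 < β) (hf : 2 ≤ f) (hil : i ≤ l)
    (hT : T ≤ 5 * n * (β * f ^ 2 ^ i)) : remBound β f n T (l + 2) * 4 ^ l ≤ 20 * n := by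
  set q := f ^ 2 ^ l with hq
  have hq0 : 0 < q := by positivity
  have hiq : f ^ 2 ^ i ≤ q :=
    Nat.pow_le_pow_right (by omega) (Nat.pow_le_pow_right (by omega) hil)
  have hqq : f ^ 2 ^ (l + 1) = q * q := by rw [hq, ← pow_add, pow_succ]; ring_nf
  have h1 : remBound β f n T (l + 2) * (β * (q * q)) ≤ 2 * T := by
    rw [← hqq]
    exact (Nat.mul_le_mul_right _ (min_le_right _ _)).trans (Nat.div_mul_le_self _ _)
  have h2 : 2 * T ≤ 10 * n * (β * q) := by
    have : 5 * n * (β * f ^ 2 ^ i) ≤ 5 * n * (β * q) :=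
      Nat.mul_le_mul_left _ (Nat.mul_le_mul_left _ hiq)
    have h3 : 10 * n * (β * q) = 2 * (5 * n * (β * q)) := by ring
    omega
  have h3 : remBound β f n T (l + 2) * q ≤ 10 * n := by
    refine Nat.le_of_mul_le_mul_right ?_ (Nat.mul_pos hβ hq0)
    refine le_trans (le_of_eq ?_) (h1.trans h2)
    ring
  have h4 : 4 ^ l ≤ 2 * q := by
    have h5 : 2 ^ 2 ^ l ≤ q := Nat.pow_le_pow_left hf _
    have h6 : 2 ^ (2 * l) ≤ 2 ^ (2 ^ l + 1) :=
      Nat.pow_le_pow_right (by omega) (two_mul_le_two_pow_add_one l)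
    rw [pow_mul, pow_succ] at h6
    norm_num at h6
    omega
  calc remBound β f n T (l + 2) * 4 ^ l ≤ remBound β f n T (l + 2) * (2 * q) :=
        Nat.mul_le_mul_left _ h4
    _ = 2 * (remBound β f n T (l + 2) * q) := by ring
    _ ≤ 2 * (10 * n) := Nat.mul_le_mul_left _ h3
    _ = 20 * n := by ring

theorem sum_ite_two_pow_le (m r : ℕ) :
    ∑ j ∈ Finset.range r, (if j < m then (2 : ℝ) ^ j else 0) ≤ 2 ^ m := by
  rw [← Finset.sum_filter]
  have h1 : ∑ j ∈ Finset.range m, (2 : ℝ) ^ j ≤ 2 ^ m := by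
    rw [geom_sum_eq (by norm_num)]
    norm_num
  refine le_trans (Finset.sum_le_sum_of_subset_of_nonneg ?_ fun _ _ _ => by positivity) h1
  intro j hj
  simp only [Finset.mem_filter] at hj
  exact Finset.mem_range.2 hj.2

/-- Rounds before `i + 2` are estimated by `n` elements each and sum to a geometric series dominated
by `2^(i+2)`. From then on the decay `4^(-l)` beats the growth `2^j` of the cost per element. -/
theorem sum_remBound_le {β f n T i : ℕ} (hβ : 0 < β) (hf : 2 ≤ f)
    (hT : T ≤ 5 * n * (β * f ^ 2 ^ i)) (r : ℕ) :
    ∑ j ∈ Finset.range r, (remBound β f n T j : ℝ) * 2 ^ j ≤ n * (4 * 2 ^ i + 640) := by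
  -- For `j = l + 2` the term is at most `20 n * 4 / 2^l = 320 n (1/2)^j`; the second series sums to
  -- at most `640 n`.
  have hterm : ∀ j : ℕ, (remBound β f n T j : ℝ) * 2 ^ j ≤
      n * (if j < i + 2 then (2 : ℝ) ^ j else 0) + 320 * n * (1 / 2) ^ j := by
    intro j
    split_ifs with hj
    · have h1 : (remBound β f n T j : ℝ) ≤ n := by exact_mod_cast remBound_le j
      have h2 : (0 : ℝ) ≤ 320 * n * (1 / 2) ^ j := by positivity
      have h3 : (remBound β f n T j : ℝ) * 2 ^ j ≤ n * 2 ^ j :=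
        mul_le_mul_of_nonneg_right h1 (by positivity)
      linarith
    · obtain ⟨l, rfl⟩ : ∃ l, j = l + 2 := ⟨j - 2, by omega⟩
      have h1 : (remBound β f n T (l + 2) : ℝ) * 4 ^ l ≤ 20 * n := by
        exact_mod_cast remBound_add_two_le hβ hf (by omega) hT
      have h2 : (4 : ℝ) ^ l = 2 ^ l * 2 ^ l := by rw [← mul_pow]; norm_num
      have h3 : (0 : ℝ) < 2 ^ l := by positivity
      have h4 : (1 / 2 : ℝ) ^ (l + 2) = 1 / (4 * 2 ^ l) := by
        rw [one_div_pow, pow_add]; norm_num [mul_comm]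
      rw [h4, pow_add, mul_zero, zero_add, mul_one_div, le_div_iff₀ (by positivity)]
      rw [h2] at h1
      nlinarith
  refine (Finset.sum_le_sum fun j _ => hterm j).trans ?_
  rw [Finset.sum_add_distrib, ← Finset.mul_sum, ← Finset.mul_sum]
  have h1 := sum_ite_two_pow_le (i + 2) r
  have h2 := sum_geometric_two_le r
  have h3 : (0 : ℝ) ≤ n := Nat.cast_nonneg n
  have h4 := mul_le_mul_of_nonneg_left h1 h3
  have h5 := mul_le_mul_of_nonneg_left h2 (mul_nonneg (by norm_num : (0 : ℝ) ≤ 320) h3)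
  rw [pow_add] at h4
  linarith

/-- The cost per element `60 (2^j + 2) + 48` is at most `228 * 2^j`. The additive terms `24 β` of
the rounds are harmless because there are only doubly logarithmically many rounds. -/
theorem mainCost_le {β f n T i r : ℕ} (hβ : 0 < β) (hf : 2 ≤ f)
    (hT : T ≤ 5 * n * (β * f ^ 2 ^ i)) (hr : r ≤ 1 ∨ β * f ^ 2 ^ (r - 2) ≤ n) :
    (mainCost β f n T r : ℝ) ≤ 228 * (n * (4 * 2 ^ i + 640)) + 24 * (β + n) := by
  have h1 : (mainCost β f n T r : ℝ) ≤
      228 * ∑ j ∈ Finset.range r, (remBound β f n T j : ℝ) * 2 ^ j + 24 * (r * β) := by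
    rw [mainCost, Finset.mul_sum, Nat.cast_sum]
    have : (24 * (r * β) : ℝ) = ∑ j ∈ Finset.range r, (24 * β : ℝ) := by
      simp; ring
    rw [this, ← Finset.sum_add_distrib]
    refine Finset.sum_le_sum fun j _ => ?_
    push_cast
    have h2 : (1 : ℝ) ≤ 2 ^ j := one_le_pow₀ (by norm_num)
    have h3 : (0 : ℝ) ≤ remBound β f n T j := Nat.cast_nonneg _
    nlinarith
  -- For `r = l + 2` the number of rounds is at most `f^(2^l)`, which times `β` is at most `n` by
  -- `hr`.
  have h2 : r * β ≤ β + n := by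
    rcases hr with hr | hr
    · have : r * β ≤ 1 * β := Nat.mul_le_mul_right _ hr
      omega
    · rcases Nat.lt_or_ge r 2 with h3 | h3
      · have : r * β ≤ 1 * β := Nat.mul_le_mul_right _ (by omega)
        omega
      · obtain ⟨l, rfl⟩ : ∃ l, r = l + 2 := ⟨r - 2, by omega⟩
        rw [Nat.add_sub_cancel] at hr
        have h4 : l + 2 ≤ f ^ 2 ^ l :=
          calc l + 2 ≤ 2 ^ (l + 1) := Nat.lt_two_pow_self
            _ ≤ 2 ^ 2 ^ l := Nat.pow_le_pow_right (by omega) Nat.lt_two_pow_self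
            _ ≤ f ^ 2 ^ l := Nat.pow_le_pow_left hf _
        have h5 := Nat.mul_le_mul_left β h4
        rw [Nat.mul_comm]
        omega
  have h3 : (r * β : ℝ) ≤ β + n := by exact_mod_cast h2
  have h4 := sum_remBound_le hβ hf hT r
  linarith

/-- The bound on the number of block transfers in terms of real logarithms. -/
theorem transfers_le {M B N K β f r t : ℕ} (hN : 0 < N) (hB : 1 ≤ B) (hM : 2 * B ≤ M) (hβ : 0 < β)
    (hBβ : B ≤ 10 * β) (hf : 2 ≤ f) (hMf : M ≤ B * f ^ 5)
    (hr : r ≤ 1 ∨ β * f ^ 2 ^ (r - 2) ≤ 2 * N)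
    (ht : β * t ≤ 8 * N + 6 * β + mainCost β f (2 * N) K r) :
    (t : ℝ) ≤ 3000000 * (⌈(N : ℝ) / B⌉₊ + N / B * max 0 (Real.logb (M / B) (K / (N * B)))) := by
  have hN' : (0 : ℝ) < N := by exact_mod_cast hN
  have hB' : (0 : ℝ) < B := by exact_mod_cast hB
  have hβ' : (0 : ℝ) < β := by exact_mod_cast hβ
  have hf' : (2 : ℝ) ≤ f := by exact_mod_cast hf
  have hb2 : (2 : ℝ) ≤ M / B := by
    rw [le_div_iff₀ hB']; exact_mod_cast hM
  have hbf : (M : ℝ) / B ≤ (f : ℝ) ^ 5 := by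
    rw [div_le_iff₀' hB']; exact_mod_cast hMf
  set x : ℝ := K / (N * B) with hx
  set L : ℝ := max 0 (Real.logb (M / B) x) with hL
  have hL0 : 0 ≤ L := le_max_left _ _
  -- A power of two at least `5 L`, yet not much larger: then `(M/B)^L ≤ f^(5L) ≤ f^(2^i)`, while
  -- `2^i` remains linear in `1 + L`.
  obtain ⟨i, hi1, hi2⟩ : ∃ i : ℕ, 5 * L ≤ 2 ^ i ∧ (2 : ℝ) ^ i ≤ 1 + 10 * L := by
    rcases le_or_gt (5 * L) 1 with h | h
    · exact ⟨0, by simpa using h, by simp; linarith⟩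
    · obtain ⟨k, hk1, hk2⟩ := exists_nat_pow_near h.le (by norm_num : (1 : ℝ) < 2)
      exact ⟨k + 1, hk2.le, by rw [pow_succ]; linarith⟩
  have hxf : x ≤ (f : ℝ) ^ 2 ^ i := by
    have h1 : x ≤ ((M : ℝ) / B) ^ L := by
      rcases le_or_gt x 1 with h | h
      · exact h.trans (Real.one_le_rpow (by linarith) hL0)
      · refine (Real.logb_le_iff_le_rpow (by linarith) (by linarith)).1 (le_max_right _ _)
    have h2 : ((M : ℝ) / B) ^ L ≤ ((f : ℝ) ^ 5) ^ L :=
      Real.rpow_le_rpow (by linarith) hbf hL0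
    have h3 : ((f : ℝ) ^ 5) ^ L = (f : ℝ) ^ (5 * L) := by
      rw [← Real.rpow_natCast, ← Real.rpow_mul (by linarith)]
      norm_num
    have h4 : (f : ℝ) ^ (5 * L) ≤ (f : ℝ) ^ ((2 ^ i : ℕ) : ℝ) :=
      Real.rpow_le_rpow_of_exponent_le (by linarith) (by push_cast; exact hi1)
    rw [Real.rpow_natCast] at h4
    exact h1.trans (h2.trans (h3.le.trans h4))
  -- The interleaved sequence has `n = 2 N` elements, and `N B ≤ 10 N β = 5 n β`; this is the origin
  -- of the factor 5 in the estimates.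
  have hK : K ≤ 5 * (2 * N) * (β * f ^ 2 ^ i) := by
    have h1 : (K : ℝ) ≤ N * B * (f : ℝ) ^ 2 ^ i := by
      rw [hx, div_le_iff₀ (by positivity)] at hxf
      linarith
    have h2 : (B : ℝ) ≤ 10 * β := by exact_mod_cast hBβ
    have h3 : (N * B * (f : ℝ) ^ 2 ^ i : ℝ) ≤ N * (10 * β) * (f : ℝ) ^ 2 ^ i := by gcongr
    have h4 : (K : ℝ) ≤ 5 * (2 * N) * (β * (f : ℝ) ^ 2 ^ i) := by
      refine (h1.trans h3).trans (le_of_eq ?_)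
      ring
    exact_mod_cast h4
  have hcost := mainCost_le hβ hf hK hr
  push_cast at hcost
  have ht' : (β * t : ℝ) ≤ 8 * N + 6 * β + mainCost β f (2 * N) K r := by exact_mod_cast ht
  have hc1 : (N : ℝ) / B ≤ ⌈(N : ℝ) / B⌉₊ := Nat.le_ceil _
  have hc2 : (1 : ℝ) ≤ ⌈(N : ℝ) / B⌉₊ := by
    exact_mod_cast Nat.ceil_pos.2 (div_pos hN' hB')
  set c : ℝ := ((⌈(N : ℝ) / B⌉₊ : ℕ) : ℝ) with hc
  have hβN : (N : ℝ) ≤ 10 * β * (N / B) := by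
    have h2 : (B : ℝ) ≤ 10 * β := by exact_mod_cast hBβ
    have h3 : (B : ℝ) * (N / B) = N := by field_simp
    calc (N : ℝ) = B * (N / B) := h3.symm
      _ ≤ 10 * β * (N / B) := by gcongr
  set y : ℝ := N / B with hy
  have hy0 : 0 ≤ y := by positivity
  have h1 : (β * t : ℝ) ≤ 30 * β + N * (56 + 456 * (644 + 40 * L)) := by
    have : (N : ℝ) * 2 ^ i ≤ N * (1 + 10 * L) := by gcongr
    linarith
  have h2 : (N : ℝ) * (56 + 456 * (644 + 40 * L)) ≤ 10 * β * y * (56 + 456 * (644 + 40 * L)) := by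
    gcongr
  have h3 : (β * t : ℝ) ≤ β * (30 + 10 * y * (56 + 456 * (644 + 40 * L))) := by
    linarith
  have h4 := le_of_mul_le_mul_left h3 hβ'
  have h5 : 0 ≤ y * L := by positivity
  linarith

/-- The factor `b` contributes 1 to the logarithm, and the logarithm of the constant is largest for
the smallest base 2. Taking `max A 1` covers small and negative `A`. -/
theorem logb_le_of_le_mul {b x A : ℝ} (hb : 2 ≤ b) (hx : 0 ≤ x) (h : x ≤ A * b) :
    max 0 (Real.logb b x) ≤ 1 + Real.logb 2 (max A 1) := by
  have hA : 1 ≤ max A 1 := le_max_right _ _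
  have h0 : 0 ≤ Real.logb 2 (max A 1) := Real.logb_nonneg (by norm_num) hA
  refine max_le (by linarith) ?_
  rcases hx.eq_or_lt with rfl | hx
  · simp; linarith
  · have h1 : x ≤ max A 1 * b := h.trans (by gcongr; exact le_max_left _ _)
    have h2 : Real.logb b x ≤ Real.logb b (max A 1 * b) :=
      Real.logb_le_logb_of_le (by linarith) hx h1
    rw [Real.logb_mul (by linarith) (by linarith),
      Real.logb_self_eq_one (by linarith)] at h2
    have h3 : Real.logb b (max A 1) ≤ Real.logb 2 (max A 1) := by
      rw [Real.logb, Real.logb]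
      have h4 : Real.log 2 ≤ Real.log b := Real.log_le_log (by norm_num) hb
      have h5 : 0 < Real.log 2 := Real.log_pos (by norm_num)
      exact div_le_div_of_nonneg_left (Real.log_nonneg hA) h5 h4
    linarith


/-! ### Reduction to colored sequences, and assembly of the proof -/

theorem dominationPairs_self {N : ℕ} (L : Fin N → ℝ) : dominationPairs L L = inversions L := by
  unfold dominationPairs inversions
  congr 1
  ext p
  simp [Dominates, toPoint]

theorem above_mix (z : ℝ) (R S : ℕ → ℝ) (n : ℕ) :
    above z (mix R S n) = ∑ i ∈ Finset.range n, if z < R i then 1 else 0 := by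
  induction n with
  | zero => simp [mix, above]
  | succ n ih =>
    rw [Finset.sum_range_succ, ← ih, mix, above_append, above_append]
    simp [above, List.countP_cons]

/-- The blue element of an index precedes the red one, so equal indices form no pair and the inner
sum runs over `i < j` only. -/
theorem cnt_mix (R S : ℕ → ℝ) (n : ℕ) :
    cnt (mix R S n) =
      ∑ j ∈ Finset.range n, ∑ i ∈ Finset.range j, if S j < R i then 1 else 0 := by
  induction n with
  | zero => simp [mix, cnt]
  | succ n ih =>
    rw [Finset.sum_range_succ, ← ih, mix, cnt_concat, cnt_concat, crs_red _ (y := (true, R n)) rfl,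
      crs_blue _ (y := (false, S n)) rfl, above_mix, Nat.add_zero]

/-- Extend a list by zeros. -/
noncomputable def extend {N : ℕ} (L : Fin N → ℝ) (i : ℕ) : ℝ := if h : i < N then L ⟨i, h⟩ else 0

theorem extend_val {N : ℕ} (L : Fin N → ℝ) (i : Fin N) : extend L i = L i := by simp [extend]

theorem dominationPairs_eq_cnt {N : ℕ} (red blue : Fin N → ℝ) :
    dominationPairs red blue = cnt (mix (extend red) (extend blue) N) := by
  classical
  rw [cnt_mix, dominationPairs, Finset.card_filter, Fintype.sum_prod_type_right,
    Finset.sum_range fun j => ∑ i ∈ Finset.range j, if extend blue j < extend red i then 1 else 0]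
  refine Finset.sum_congr rfl fun j _ => ?_
  have h1 : ∑ i ∈ Finset.range j, (if extend blue j < extend red i then 1 else 0) =
      ∑ i ∈ Finset.range N, if i < j ∧ extend blue j < extend red i then 1 else 0 := by
    rw [← Finset.card_filter, ← Finset.card_filter]
    congr 1
    ext i
    have := j.2
    simp only [Finset.mem_filter, Finset.mem_range]
    constructor
    · rintro ⟨h1, h2⟩; exact ⟨by omega, h1, h2⟩
    · rintro ⟨_, h1, h2⟩; exact ⟨h1, h2⟩
  rw [h1, Finset.sum_range]
  refine Finset.sum_congr rfl fun i _ => ?_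
  simp [Dominates, toPoint, extend_val]

theorem initDisk_red {N B : ℕ} (red blue : Fin N → ℝ) (hB : 0 < B) {i : ℕ} (hi : i < N) :
    initDisk B red blue (i / B) (i % B) = .key (extend red i) := by
  have h := Nat.div_add_mod' i B
  simp [initDisk, extend, Nat.mod_lt i hB, h, hi]

theorem initDisk_blue {N B : ℕ} (red blue : Fin N → ℝ) (hB : 0 < B) {i : ℕ} (hi : i < N) :
    initDisk B red blue ((N + B - 1) / B + i / B) (i % B) = .key (extend blue i) := by
  have h := Nat.div_add_mod' i B
  -- From block `⌈N/B⌉` on, positions lie behind the red list, so the first case in `initDisk` does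
  -- not apply.
  have h1 : N ≤ (N + B - 1) / B * B := by
    have := Nat.lt_div_mul_add (a := N + B - 1) hB
    omega
  have h2 : ¬ ((N + B - 1) / B + i / B) * B + i % B < N := by
    rw [Nat.add_mul]; omega
  simp [initDisk, extend, Nat.mod_lt i hB, h, hi, h2]

/-- The parameters `β`, `f` and `r` remain visible, so that the passage to real logarithms in
`transfers_le` is free of the machine. -/
theorem exists_runs {M B N : ℕ} (red blue : Fin N → ℝ) (hB : 1 ≤ B) (hM : 2 * B ≤ M)
    (hN : 0 < N) : ∃ β f r t, 0 < β ∧ B ≤ 10 * β ∧ 2 ≤ f ∧ M ≤ B * f ^ 5 ∧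
      (r ≤ 1 ∨ β * f ^ 2 ^ (r - 2) ≤ 2 * N) ∧
      β * t ≤ 8 * N + 6 * β + mainCost β f (2 * N) (dominationPairs red blue) r ∧
      Runs countPairs 240 M B red blue (dominationPairs red blue) t := by
  obtain ⟨C, hP, hCX, hbase, hinp, hC, hBβ, hMf, hfβ, hsetup⟩ := setup_wp red blue hB hM hN
  have hPN : C.P.N = N := by rw [hP]
  have hPB : C.P.B = B := by rw [hP]
  have hβ := hC.β_pos
  set R := extend red
  set S := extend blue
  have hw : dominationPairs red blue = cnt (mix R S N) := dominationPairs_eq_cnt red blue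
  have hlen : (mix R S N).length = 2 * N := mix_length R S N
  -- The base is at most `(N + M)^3`, so exponent 18 would do up to strictness. This motivates `X =
  -- (N + M)^20`, whose twelfth power is the word bound with exponent 240.
  have hX : (2 * N + C.f + C.β + 2) ^ 6 < C.X := by
    rw [hCX]
    have h1 : 2 * N + C.f + C.β + 2 ≤ (N + M) ^ 3 := by
      have h2 : 3 * 3 ≤ (N + M) * (N + M) := Nat.mul_le_mul (by omega) (by omega)
      have h3 : (N + M) * (3 * 3) ≤ (N + M) * ((N + M) * (N + M)) := Nat.mul_le_mul_left _ h2
      have h4 : (N + M) ^ 3 = (N + M) * ((N + M) * (N + M)) := by ring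
      omega
    calc (2 * N + C.f + C.β + 2) ^ 6 ≤ ((N + M) ^ 3) ^ 6 := Nat.pow_le_pow_left h1 _
      _ = (N + M) ^ 18 := by rw [← pow_mul]
      _ < (N + M) ^ 20 := Nat.pow_lt_pow_right (by omega) (by omega)
  have hXN : 2 * N + 1 < C.X := by
    have : 2 * N + C.f + C.β + 2 ≤ (2 * N + C.f + C.β + 2) ^ 6 :=
      Nat.le_self_pow (by omega) _
    omega
  have hKX : cnt (mix R S N) < C.X := by
    refine lt_of_le_of_lt ?_ hX
    have h1 := cnt_le (mix R S N)
    have h2 := reds_add_blues (mix R S N)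
    have h3 : reds (mix R S N) * blues (mix R S N) ≤ (2 * N) * (2 * N) :=
      Nat.mul_le_mul (by omega) (by omega)
    have h4 : (2 * N) * (2 * N) ≤ (2 * N + C.f + C.β + 2) ^ 2 := by
      rw [pow_two]; exact Nat.mul_le_mul (by omega) (by omega)
    have h5 : (2 * N + C.f + C.β + 2) ^ 2 ≤ (2 * N + C.f + C.β + 2) ^ 6 :=
      Nat.pow_le_pow_right (by omega) (by omega)
    omega
  have hin : C.base / 2 + (C.P.N - 1) / C.P.B < C.base := by
    rw [hPN, hPB, hbase, show N + B - 1 = N - 1 + B by omega, Nat.add_div_right _ hB]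
    omega
  have hbase2 : C.base / 2 = (N + B - 1) / B := by omega
  have hrun : Wp C.P countPairs (initState B red blue) fun s t =>
      ∃ r, (r ≤ 1 ∨ C.β * C.f ^ 2 ^ (r - 2) ≤ 2 * N) ∧
        C.β * t ≤ 8 * N + 6 * C.β + mainCost C.β C.f (2 * N) (cnt (mix R S N)) r ∧
        s.reg 0 = .num (cnt (mix R S N)) := by
    refine Wp.ite (b := true) ?_ (fun _ => ?_) (fun h => by simp at h)
    · have hX0 := hC.X_le
      have hNX := hC.NX
      rw [Test.eval_lt (Expr.eval_const (by omega)) (Expr.eval_inputSize (by omega)), hPN]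
      simpa using hN
    · refine Wp.seq (hsetup _ fun s a hs h0 => ?_)
      have htr : C.Tr (convert ;; mainLoop) a fun a' t =>
          ∃ r, (r ≤ 1 ∨ C.β * C.f ^ 2 ^ (r - 2) ≤ 2 * N) ∧
            C.β * t ≤ 8 * N + 6 * C.β + mainCost C.β C.f (2 * N) (cnt (mix R S N)) r ∧
            a'.v 0 = cnt (mix R S N) := by
        refine Ctx.Tr.seq (Ctx.Tr.convert hC (R := R) (S := S) (by rw [hPN]; exact hXN) hin ?_ ?_
          fun a₁ t₁ h0₁ h1₁ hH₁ ht₁ => ?_)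
        · intro i hi
          rw [hPN] at hi
          rw [hinp, hPB]
          exact initDisk_red red blue hB hi
        · intro i hi
          rw [hPN] at hi
          rw [hinp, hPB, hbase2]
          exact initDisk_blue red blue hB hi
        rw [hPN] at h1₁ hH₁ ht₁
        rw [h0] at h0₁
        refine Ctx.Tr.mainLoop hC hH₁ (by rw [h1₁, hlen]) (by rw [hlen]; exact hX)
          (by rw [h0₁, Nat.zero_add]; exact hKX) fun a₂ r t₂ h0₂ hr ht₂ => ?_
        rw [h0₁, Nat.zero_add] at h0₂ ht₂
        rw [hlen] at hr ht₂
        refine ⟨r, hr, ?_, h0₂⟩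
        rw [Nat.mul_add]
        omega
      refine (htr s hs).mono fun s' t ⟨a', hs', r, h1, h2, h3⟩ => ⟨r, h1, ?_, ?_⟩
      · rw [Nat.zero_add]; exact h2
      · rw [hs'.v 0 (by omega), h3]
  obtain ⟨t, s, hexec, r, h1, h2, h3⟩ := hrun
  rw [hP] at hexec
  rw [hw]
  exact ⟨C.β, C.f, r, t, hβ, hBβ, hC.f_two, hMf, h1, h2, s, hexec, h3⟩

theorem runs_zero {M B : ℕ} (red blue : Fin 0 → ℝ) (hM : 0 < M) :
    Runs countPairs 240 M B red blue (dominationPairs red blue) 0 := by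
  have hW : 0 < (0 + M) ^ 240 := Nat.pow_pos (by omega)
  refine ⟨initState B red blue, .iteFalse ?_ (.skip _), ?_⟩
  · exact Test.eval_lt (m := 0) (n := 0) (Expr.eval_const hW) (Expr.eval_inputSize hW)
  · simp [initState, dominationPairs]

end ExtMem

theorem theorem1 :
    (∀ (N : ℕ) (L : Fin N → ℝ), ExtMem.dominationPairs L L = ExtMem.inversions L) ∧
    ∃ (p : ExtMem.Prog) (c : ℕ) (C : ℝ) (D : ℝ → ℝ),
      ∀ (M B N : ℕ), 1 ≤ B → 2 * B ≤ M → ∀ (red blue : Fin N → ℝ),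
        ∃ t : ℕ,
          ExtMem.Runs p c M B red blue (ExtMem.dominationPairs red blue) t ∧
          (t : ℝ) ≤ C * ((⌈(N : ℝ) / (B : ℝ)⌉₊ : ℝ) + (N : ℝ) / (B : ℝ) *
            max 0 (Real.logb ((M : ℝ) / (B : ℝ))
              ((ExtMem.dominationPairs red blue : ℝ) / ((N : ℝ) * (B : ℝ))))) ∧
          ∀ A : ℝ, (ExtMem.dominationPairs red blue : ℝ) ≤ A * (N : ℝ) * (M : ℝ) →
            (t : ℝ) ≤ D A * (⌈(N : ℝ) / (B : ℝ)⌉₊ : ℝ) := by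
  refine ⟨fun N L => ExtMem.dominationPairs_self L, ExtMem.countPairs, 240, 3000000,
    fun A => 3000000 * (2 + Real.logb 2 (max A 1)), fun M B N hB hM red blue => ?_⟩
  rcases Nat.eq_zero_or_pos N with rfl | hN
  · exact ⟨0, ExtMem.runs_zero red blue (by omega), by simp, by simp⟩
  obtain ⟨β, f, r, t, hβ, hBβ, hf, hMf, hr, ht, hrun⟩ := ExtMem.exists_runs red blue hB hM hN
  have hbound := ExtMem.transfers_le hN hB hM hβ hBβ hf hMf hr ht
  refine ⟨t, hrun, hbound, fun A hA => hbound.trans ?_⟩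
  have hN' : (0 : ℝ) < N := by exact_mod_cast hN
  have hB' : (0 : ℝ) < B := by exact_mod_cast hB
  have hb2 : (2 : ℝ) ≤ M / B := by
    rw [le_div_iff₀ hB']; exact_mod_cast hM
  -- Divided by `N * B`, the bound `A * N * M` becomes `A` times the base `M / B` of the logarithm.
  have hlog := ExtMem.logb_le_of_le_mul (A := A) hb2
    (x := (ExtMem.dominationPairs red blue : ℝ) / (N * B)) (by positivity) (by
      rw [div_le_iff₀ (by positivity)]
      refine hA.trans (le_of_eq ?_)
      field_simp)
  have hA0 : 0 ≤ Real.logb 2 (max A 1) := Real.logb_nonneg (by norm_num) (le_max_right _ _)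
  have h1 : (N : ℝ) / B * max 0 (Real.logb (M / B)
      ((ExtMem.dominationPairs red blue : ℝ) / (N * B))) ≤
      (⌈(N : ℝ) / B⌉₊ : ℝ) * (1 + Real.logb 2 (max A 1)) :=
    mul_le_mul (Nat.le_ceil _) hlog (le_max_left _ _) (Nat.cast_nonneg _)
  linarith
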